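/- **Setting.** Let $r\ge 0$, $d_0\ge d_1\ge\dots\ge d_r\ge 1$ be integers, $N=\sum_{j=0}^r d_j$, $d=d_0$, and let $B$ be a real $N\times N$ matrix, written in blocks of sizes $d_0,\dots,d_r$, whose only non-zero blocks are those directly below the diagonal, the block $B_j$ in block row $j$ and block column $j-1$ being a $d_j\times d_{j-1}$ matrix of rank $d_j$ ($j=1,\dots,r$). For $x\in\mathbb R^N$ let $x^{[i]}$ be its $i$-th block. On $\mathbb R^{N+1}=\mathbb R\times\mathbb R^N$, whose points are written $z=(t,x)$, $\zeta=(\tau,\xi)$, put $$z\circ\zeta=(t+\tau,\ \xi+e^{\tau B}x),\qquad \|(t,x)\|_B=|t|^{\frac12}+\sum_{i=0}^r|x^{[i]}|^{\frac1{2i+1}},\qquad \mathbf d=2+\sum_{k=0}^r(2k+1)d_k,$$ $Y=\langle Bx,\nabla\rangle+\partial_t$, $e^{h\partial_{x_i}}(t,x)=(t,x+h\mathbf e_i)$, $e^{hY}(t,x)=(t+h,e^{hB}x)$. The vector fields $\partial_{x_1},\dots,\partial_{x_d}$ have formal weight $m_{\partial_{x_i}}=1$, and $m_Y=2$. For $\beta\in\mathbb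 N_0^N$ let $\langle\beta\rangle_B=\sum_{i=0}^r(2i+1)\,|\beta^{[i]}|$, where $|\beta^{[i]}|$ is the sum of the entries of $\beta$ in the $i$-th block. Functions are real-valued, derivatives are weak derivatives which are locally integrable functions, and $\|\cdot\|_p$ is the norm of $L^p(\mathbb R^{N+1})$. For $p,q\in[1,\infty]$ and $0<\sigma<m_X$ set $$[u]_{X,\sigma,p,q}=\Big(\int_{\mathbb R}\|u(e^{hX}\cdot)-u\|_p^q\,\frac{dh}{|h|^{1+q\sigma/m_X}}\Big)^{1/q}\ (q<\infty),\qquad [u]_{X,\sigma,p,\infty}=\sup_{h\ne0}\frac{\|u(e^{hX}\cdot)-u\|_p}{|h|^{\sigma/m_X}},$$ and for $s\in(0,1)$, inductively, $$|u|_{s,p,q}=\sum_{i=1}^d[u]_{\partial_{x_i},s,p,q}+[u]_{Y,s,p,q},\qquad |u|_{1+s,p,q}=\sum_{i=1}^d|\partial_{x_i}u|_{s,p,q}+[u]_{Y,1+s,p,q},$$ $$|u|_{n+s,p,q}=\sum_{i=1}^d|\partial_{x_i}u|_{n-1+s,p,q}+|Yu|_{n-2+s,p,q}\quad(n\ge2)$$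 (a quantity is $\infty$ if a derivative that occurs in it does not exist). $\Lambda^{n+s}_{p,q,B}$ is the space of measurable $u$ on $\mathbb R^{N+1}$ with $\|u\|_p+|u|_{n+s,p,q}<\infty$. **Theorem.** Let $n\in\mathbb N_0$, $s\in(0,1)$ and $p,q\in[1,\infty]$. There is a constant $c=c(n,s,p,q,B)$ such that for every $u\in\Lambda^{n+s}_{p,q,B}$ the weak derivatives $Y^k\partial_x^\beta u$ with $2k+\langle\beta\rangle_B\le n$ exist, and the $n$-th order $B$-Taylor polynomial $$T_nu(\zeta,z)=\sum_{2k+\langle\beta\rangle_B\le n}\frac{(t-\tau)^k\,(x-e^{(t-\tau)B}\xi)^\beta}{k!\,\beta!}\,Y^k\partial^\beta_\xi u(\tau,\xi)$$ satisfies, if $q<\infty$, $$\int_{\mathbb R^{N+1}}\big\|u-T_nu(\cdot\circ\zeta,\cdot)\big\|_p^q\,\frac{d\zeta}{\|\zeta\|_B^{\mathbf d+(n+s)q}}\le c\,|u|_{n+s,p,q}^q,$$ and, if $q=\infty$, $$\sup_{\zeta\ne0}\frac{\|u-T_nu(\cdot\circ\zeta,\cdot)\|_p}{\|\zeta\|_B^{n+s}}\le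 c\,|u|_{n+s,p,\infty}.$$ -/

import Mathlib

open MeasureTheory Set
open scoped NNReal ENNReal

noncomputable section

namespace Kolmogorov

/-- Indices of the `N = ∑ d i` space coordinates, grouped in `r + 1` blocks; the `i`-th block has
`d i` coordinates. -/
abbrev Coord {r : ℕ} (d : Fin (r + 1) → ℕ) : Type := Σ i : Fin (r + 1), Fin (d i)

/-- The points `z = (t, x)` of `ℝ × ℝ^N`. -/
abbrev Pt {r : ℕ} (d : Fin (r + 1) → ℕ) : Type := ℝ × (Coord d → ℝ)

/-- `B` has zero blocks except for those directly below the diagonal; the block `B_{j+1}`, in block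
row `j + 1` and block column `j`, has full rank `d_{j+1}`. -/
structure IsBlockMatrix {r : ℕ} (d : Fin (r + 1) → ℕ) (B : Matrix (Coord d) (Coord d) ℝ) :
    Prop where
  antitone : Antitone d
  one_le_last : 1 ≤ d (Fin.last r)
  zero_block : ∀ a b : Coord d, (a.1 : ℕ) ≠ (b.1 : ℕ) + 1 → B a b = 0
  rank_block : ∀ j : Fin r,
    (B.submatrix (fun a : Fin (d j.succ) => (⟨j.succ, a⟩ : Coord d))
      (fun b : Fin (d j.castSucc) => (⟨j.castSucc, b⟩ : Coord d))).rank = d j.succ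

variable {r : ℕ} {d : Fin (r + 1) → ℕ}

/-- Euclidean norm of the `i`-th block `x^{[i]}` of `x`. -/
def blockNorm (x : Coord d → ℝ) (i : Fin (r + 1)) : ℝ :=
  Real.sqrt (∑ a : Fin (d i), x ⟨i, a⟩ ^ 2)

/-- The homogeneous norm `‖(t, x)‖_B = |t|^{1/2} + ∑ᵢ |x^{[i]}|^{1/(2i+1)}`. -/
def homNorm (z : Pt d) : ℝ :=
  |z.1| ^ (1 / 2 : ℝ) + ∑ i : Fin (r + 1), blockNorm z.2 i ^ (1 / (2 * ((i : ℕ) : ℝ) + 1))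

variable (d) in
/-- The homogeneous dimension `2 + ∑ₖ (2k+1) d_k`. -/
def homDim : ℕ := 2 + ∑ k : Fin (r + 1), (2 * (k : ℕ) + 1) * d k

/-- `e^{tB} x`. -/
def expB (B : Matrix (Coord d) (Coord d) ℝ) (t : ℝ) (x : Coord d → ℝ) : Coord d → ℝ :=
  (NormedSpace.exp (t • B)).mulVec x

/-- The group law `(t, x) ∘ (τ, ξ) = (t + τ, ξ + e^{τB} x)`. -/
def gmul (B : Matrix (Coord d) (Coord d) ℝ) (z ζ : Pt d) : Pt d :=
  (z.1 + ζ.1, ζ.2 + expB B ζ.1 z.2)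

/-- The integral curve `h ↦ e^{h ∂_{x_j}} z`. -/
def flowX (j : Coord d) (h : ℝ) (z : Pt d) : Pt d := (z.1, z.2 + h • Pi.single j 1)

/-- The integral curve `h ↦ e^{hY} z` of `Y = ⟨Bx, ∇⟩ + ∂_t`. -/
def flowY (B : Matrix (Coord d) (Coord d) ℝ) (h : ℝ) (z : Pt d) : Pt d :=
  (z.1 + h, expB B h z.2)

/-! ### Weak derivatives -/

/-- `∂_{x_j} φ`, for smooth `φ`. -/
def dX (j : Coord d) (φ : Pt d → ℝ) : Pt d → ℝ :=
  fun z => fderiv ℝ φ z (0, Pi.single j 1)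

/-- `Y φ = ⟨Bx, ∇φ⟩ + ∂_t φ`, for smooth `φ`. -/
def dY (B : Matrix (Coord d) (Coord d) ℝ) (φ : Pt d → ℝ) : Pt d → ℝ :=
  fun z => fderiv ℝ φ z (1, B.mulVec z.2)

/-- `∂^β φ`, for smooth `φ` (the order of the derivatives is then immaterial). -/
def dXs (β : Coord d → ℕ) (φ : Pt d → ℝ) : Pt d → ℝ :=
  (Finset.univ : Finset (Coord d)).toList.foldr (fun j ψ => (dX j)^[β j] ψ) φ

/-- `v` is the weak image of `u` under the differential operator whose formal adjoint is `A`: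
both are locally integrable and `∫ v φ = ∫ u (A φ)` for all test functions `φ`. -/
def IsWeak (A : (Pt d → ℝ) → Pt d → ℝ) (u v : Pt d → ℝ) : Prop :=
  LocallyIntegrable u volume ∧ LocallyIntegrable v volume ∧
    ∀ φ : Pt d → ℝ, ContDiff ℝ (⊤ : ℕ∞) φ → HasCompactSupport φ →
      ∫ z, v z * φ z = ∫ z, u z * A φ z

/-- `v = ∂_{x_j} u` weakly. -/
def IsWeakDX (j : Coord d) (u v : Pt d → ℝ) : Prop :=
  IsWeak (fun φ z => -dX j φ z) u v

/-- `v = Y u` weakly. The formal adjoint of `Y` is `-Y`, because `B` has zero trace. -/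
def IsWeakDY (B : Matrix (Coord d) (Coord d) ℝ) (u v : Pt d → ℝ) : Prop :=
  IsWeak (fun φ z => -dY B φ z) u v

/-- `v = Y^k ∂^β u` weakly; the formal adjoint of `Y^k ∂^β` is `(-1)^{k + |β|} ∂^β Y^k`. -/
def IsWeakDeriv (B : Matrix (Coord d) (Coord d) ℝ) (k : ℕ) (β : Coord d → ℕ) (u v : Pt d → ℝ) :
    Prop :=
  IsWeak (fun φ z => (-1) ^ (k + ∑ j, β j) * dXs β ((dY B)^[k] φ) z) u v

/-! ### Besov spaces -/

/-- The Besov quasi-norm `[u]_{X,σ,p,q}` along the vector field `X` of formal weight `m` with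
integral curves `Φ h z = e^{hX} z`. -/
def dirSeminorm (Φ : ℝ → Pt d → Pt d) (m σ : ℝ) (p q : ℝ≥0∞) (u : Pt d → ℝ) : ℝ≥0∞ :=
  if q = ∞ then
    ⨆ (h : ℝ) (_ : h ≠ 0),
      eLpNorm (fun z => u (Φ h z) - u z) p volume / ENNReal.ofReal (|h| ^ (σ / m))
  else
    (∫⁻ h : ℝ, eLpNorm (fun z => u (Φ h z) - u z) p volume ^ q.toReal /
      ENNReal.ofReal (|h| ^ (1 + q.toReal * (σ / m)))) ^ (1 / q.toReal)

/-- `[u]_{∂_{x_j},σ,p,q}`, where `∂_{x_j}` (`j` in the block `0`) has formal weight one. -/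
def seminormX (j : Coord d) (σ : ℝ) (p q : ℝ≥0∞) (u : Pt d → ℝ) : ℝ≥0∞ :=
  dirSeminorm (flowX j) 1 σ p q u

/-- `[u]_{Y,σ,p,q}`, where `Y` has formal weight two. -/
def seminormY (B : Matrix (Coord d) (Coord d) ℝ) (σ : ℝ) (p q : ℝ≥0∞) (u : Pt d → ℝ) : ℝ≥0∞ :=
  dirSeminorm (flowY B) 2 σ p q u

/-- The Besov quasi-norm `|u|_{n+s,p,q}`. A weak derivative is unique up to null sets, on which
the quasi-norms do not depend, so each infimum is the quasi-norm of the weak derivative if that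
exists, and it is `∞` otherwise. -/
def besovSeminorm (B : Matrix (Coord d) (Coord d) ℝ) (s : ℝ) (p q : ℝ≥0∞) :
    ℕ → (Pt d → ℝ) → ℝ≥0∞
  | 0, u => ∑ i : Fin (d 0), seminormX ⟨0, i⟩ s p q u + seminormY B s p q u
  | 1, u => ∑ i : Fin (d 0), (⨅ (v : Pt d → ℝ) (_ : IsWeakDX ⟨0, i⟩ u v),
        besovSeminorm B s p q 0 v) + seminormY B (1 + s) p q u
  | n + 2, u => ∑ i : Fin (d 0), (⨅ (v : Pt d → ℝ) (_ : IsWeakDX ⟨0, i⟩ u v),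
        besovSeminorm B s p q (n + 1) v) +
      ⨅ (v : Pt d → ℝ) (_ : IsWeakDY B u v), besovSeminorm B s p q n v

/-- `u` belongs to the intrinsic Besov space `Λ^{n+s}_{p,q,B}`. -/
def MemBesov (B : Matrix (Coord d) (Coord d) ℝ) (n : ℕ) (s : ℝ) (p q : ℝ≥0∞) (u : Pt d → ℝ) :
    Prop :=
  MemLp u p volume ∧ besovSeminorm B s p q n u < ∞

/-! ### Taylor polynomials -/

/-- The intrinsic length `⟨β⟩_B` of a multi-index. -/
def lengthB (β : Coord d → ℕ) : ℕ := ∑ j : Coord d, (2 * (j.1 : ℕ) + 1) * β j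

variable (d) in
/-- The pairs `(k, β)` with `2k + ⟨β⟩_B ≤ n`. The bounds `k ≤ n`, `β j ≤ n` follow from this; they
are there to have a finite set. -/
def taylorIndex (n : ℕ) : Finset (ℕ × (Coord d → ℕ)) :=
  ((Finset.range (n + 1)) ×ˢ (Fintype.piFinset fun _ : Coord d => Finset.range (n + 1))).filter
    fun a => 2 * a.1 + lengthB a.2 ≤ n

/-- `D k β` is the weak derivative `Y^k ∂^β u` whenever `2k + ⟨β⟩_B ≤ n`. -/
def IsDerivFamily (B : Matrix (Coord d) (Coord d) ℝ) (n : ℕ) (u : Pt d → ℝ)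
    (D : ℕ → (Coord d → ℕ) → Pt d → ℝ) : Prop :=
  ∀ (k : ℕ) (β : Coord d → ℕ), 2 * k + lengthB β ≤ n → IsWeakDeriv B k β u (D k β)

/-- The `B`-Taylor polynomial of order `n` around `ζ = (τ, ξ)` at `z = (t, x)`,
`∑ (t-τ)^k (x - e^{(t-τ)B} ξ)^β / (k! β!) · Y^k ∂^β u(ζ)`, where `D k β` stands for `Y^k ∂^β u`. -/
def taylorPoly (B : Matrix (Coord d) (Coord d) ℝ) (n : ℕ) (D : ℕ → (Coord d → ℕ) → Pt d → ℝ)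
    (ζ z : Pt d) : ℝ :=
  ∑ a ∈ taylorIndex d n,
    ((z.1 - ζ.1) ^ a.1 * ∏ j : Coord d, (z.2 - expB B (z.1 - ζ.1) ζ.2) j ^ a.2 j) /
      ((a.1.factorial : ℝ) * ∏ j : Coord d, ((a.2 j).factorial : ℝ)) * D a.1 a.2 ζ

/-- `‖u - T_n u(· ∘ ζ, ·)‖_p`. -/
def remainderNorm (B : Matrix (Coord d) (Coord d) ℝ) (n : ℕ) (p : ℝ≥0∞) (u : Pt d → ℝ)
    (D : ℕ → (Coord d → ℕ) → Pt d → ℝ) (ζ : Pt d) : ℝ≥0∞ :=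
  eLpNorm (fun z => u z - taylorPoly B n D (gmul B z ζ) z) p volume

end Kolmogorov

end

/-!
The estimate is proved at one scale at a time. `ScaleBound B p ρ n u M` says that `u` has the
derivatives required by the recursive definition of `|u|_{n+s,p,q}`, and that the increments which
the quasi-norms measure are at most `M` (times `ρ` for the increment along `Y` of a function of
order one) as long as the step is at most `ρ` along `∂_{x_i}` and at most `ρ ^ 2` along `Y`. From
this alone the Taylor remainder `u - T_n u (· ∘ ζ, ·)` is at most `C ρ ^ n M` in `L^p` whenever
`ζ⁻¹` lies in the homogeneous box of size `ρ` (`exists_remainderNorm_le`). Three facts enter.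

* *Derivatives in the higher blocks.* `[⟨a, ∇⟩, Y] = ⟨Ba, ∇⟩`, and by the rank condition the
  vectors `B e_j` with `j` in the block `k` span the directions of the block `k + 1`. Hence weak
  derivatives in the block `k` exist and cost `2k + 1` orders of regularity
  (`ScaleBound.exists_weakDX`).
* *Increments in the higher blocks.* A function of order `m ≤ 2k` need not be differentiable in
  the directions of the block `k`, but its increments of size `ρ ^ (2k + 1)` in these directions
  are at most `C ρ ^ m M` (`incrementBound`). By induction: the translation by
  `e^{hB} b - b` is the group commutator of `e^{hY}` and the translation by `b`, and its increment
  is controlled by expanding `u` along `Y` or along `b`, whichever the order allows; combinations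
  of `e^{hB} b - b` with finitely many `h` give `B b` exactly, because `e^{hB}` is a polynomial
  in `h` (`exists_differentiation_nodes`).
* *Taylor expansion along one flow.* A weak derivative along a measure-preserving flow satisfies
  the fundamental theorem of calculus almost everywhere (`IsFlow.sub_eq_average`), which is dual to
  the classical one for test functions. Integrating repeatedly, and bounding the `L^p` norm of an
  average by the largest of the averaged norms, gives the expansions `ScaleBound.taylorY` and
  `ScaleBound.taylorX`. Expanding one coordinate after the other and then along `Y` gives the
  intrinsic Taylor formula (`exists_taylor_list`).

It remains to relate the scales to the Besov quasi-norms. The `L^p` norm of an increment along a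
flow is subadditive in the step, so at each step it is controlled by an `L^q` average over longer
steps. These averages provide a modulus `M(ρ)`, and Tonelli's theorem with the tail bound for
homogeneous kernels (`exists_lintegral_homNorm_le`) bounds the weighted `L^q` norm of
`ζ ↦ M(κ ‖ζ‖_B)` by the quasi-norm (`IsFlow.exists_modulus`, `exists_scaleBound`). Taking
`ρ = κ ‖ζ‖_B` in the Taylor estimate concludes the proof.
-/

namespace Kolmogorov

/-! ### The matrix exponential of the block matrix -/

section

variable {r : ℕ} {d : Fin (r + 1) → ℕ} {B : Matrix (Coord d) (Coord d) ℝ}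

lemma IsBlockMatrix.pow_apply_eq_zero (hB : IsBlockMatrix d B) (l : ℕ) :
    ∀ a b : Coord d, (a.1 : ℕ) ≠ (b.1 : ℕ) + l → (B ^ l) a b = 0 := by
  induction l with
  | zero =>
    intro a b h
    rw [pow_zero, Matrix.one_apply_ne]
    rintro rfl
    exact h rfl
  | succ l ih =>
    intro a b h
    rw [pow_succ, Matrix.mul_apply]
    refine Finset.sum_eq_zero fun c _ => ?_
    by_cases hc : (c.1 : ℕ) = (b.1 : ℕ) + 1
    · rw [ih a c (by omega), zero_mul]
    · rw [hB.zero_block c b hc, mul_zero]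

lemma IsBlockMatrix.pow_eq_zero (hB : IsBlockMatrix d B) {l : ℕ} (hl : r + 1 ≤ l) : B ^ l = 0 := by
  ext a b
  refine hB.pow_apply_eq_zero l a b ?_
  have := a.1.2
  omega

lemma IsBlockMatrix.exp_smul (hB : IsBlockMatrix d B) (t : ℝ) :
    NormedSpace.exp (t • B) = ∑ l ∈ Finset.range (r + 1), (t ^ l / (l.factorial : ℝ)) • B ^ l := by
  rw [NormedSpace.exp_eq_tsum ℝ]
  beta_reduce
  rw [tsum_eq_sum (s := Finset.range (r + 1))]
  · refine Finset.sum_congr rfl fun l _ => ?_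
    rw [smul_pow, smul_smul]
    congr 1
    ring
  · intro l hl
    rw [smul_pow, hB.pow_eq_zero (by simpa using hl), smul_zero, smul_zero]

lemma IsBlockMatrix.expB_eq_sum (hB : IsBlockMatrix d B) (t : ℝ) (x : Coord d → ℝ) :
    expB B t x = ∑ l ∈ Finset.range (r + 1), (t ^ l / (l.factorial : ℝ)) • (B ^ l).mulVec x := by
  rw [expB, hB.exp_smul, Matrix.sum_mulVec]
  simp only [Matrix.smul_mulVec]

lemma expB_add_right (t : ℝ) (x y : Coord d → ℝ) :
    expB B t (x + y) = expB B t x + expB B t y := Matrix.mulVec_add _ _ _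

lemma expB_smul (t c : ℝ) (x : Coord d → ℝ) : expB B t (c • x) = c • expB B t x :=
  Matrix.mulVec_smul _ _ _

lemma expB_zero (x : Coord d → ℝ) : expB B 0 x = x := by simp [expB]

lemma expB_add (s t : ℝ) (x : Coord d → ℝ) : expB B (s + t) x = expB B s (expB B t x) := by
  rw [expB, expB, expB, Matrix.mulVec_mulVec, add_smul, Matrix.exp_add_of_commute]
  exact ((Commute.refl B).smul_left s).smul_right t

lemma expB_neg_expB (t : ℝ) (x : Coord d → ℝ) : expB B (-t) (expB B t x) = x := by
  rw [← expB_add, neg_add_cancel, expB_zero]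

lemma IsBlockMatrix.contDiff_expB (hB : IsBlockMatrix d B) :
    ContDiff ℝ (⊤ : ℕ∞) (fun p : ℝ × (Coord d → ℝ) => expB B p.1 p.2) := by
  simp_rw [hB.expB_eq_sum]
  refine ContDiff.sum fun l _ => ?_
  refine ContDiff.smul ((contDiff_fst.pow l).div_const _) ?_
  exact ((Matrix.mulVecLin (B ^ l)).toContinuousLinearMap.contDiff).comp contDiff_snd

lemma IsBlockMatrix.hasDerivAt_expB (hB : IsBlockMatrix d B) (t : ℝ) (x : Coord d → ℝ) :
    HasDerivAt (fun t => expB B t x) (B.mulVec (expB B t x)) t := by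
  have key : ∀ t, HasDerivAt (fun t => ∑ l ∈ Finset.range (r + 1),
      (t ^ l / (l.factorial : ℝ)) • (B ^ l).mulVec x)
      (∑ l ∈ Finset.range (r + 1), (((l : ℝ) * t ^ (l - 1)) / (l.factorial : ℝ)) •
        (B ^ l).mulVec x) t := by
    intro t
    refine HasDerivAt.fun_sum fun l _ => ?_
    exact ((hasDerivAt_pow l t).div_const _).smul_const _
  have := key t
  simp_rw [← hB.expB_eq_sum] at this
  convert this using 1
  rw [hB.expB_eq_sum]
  conv_rhs => rw [Finset.sum_range_succ']
  conv_lhs => rw [Finset.sum_range_succ, Matrix.mulVec_add,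
    Matrix.mulVec_sum, Matrix.mulVec_smul, Matrix.mulVec_mulVec, ← pow_succ', hB.pow_eq_zero le_rfl]
  simp only [Matrix.zero_mulVec, smul_zero, add_zero, Nat.cast_zero, zero_mul, zero_div, zero_smul]
  refine Finset.sum_congr rfl fun l _ => ?_
  rw [Matrix.mulVec_smul, Matrix.mulVec_mulVec, ← pow_succ', Nat.add_sub_cancel,
    Nat.factorial_succ]
  congr 1
  have : ((l : ℝ) + 1) ≠ 0 := by positivity
  push_cast
  field_simp

/-- `e^{tB}` is unipotent. -/
lemma IsBlockMatrix.det_exp (hB : IsBlockMatrix d B) (t : ℝ) :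
    (NormedSpace.exp (t • B)).det = 1 := by
  set N : Matrix (Coord d) (Coord d) ℝ :=
    ∑ l ∈ Finset.range r, (t ^ (l + 1) / ((l + 1).factorial : ℝ)) • B ^ l with hN
  have hE : NormedSpace.exp (t • B) = 1 - (-(B * N)) := by
    rw [hB.exp_smul, Finset.sum_range_succ', hN, Finset.mul_sum, sub_neg_eq_add, add_comm]
    simp [pow_succ']
  have hc : Commute B N := by
    refine Commute.sum_right _ _ _ fun l _ => ?_
    exact ((Commute.refl B).pow_right l).smul_right _
  have hnil : IsNilpotent (-(B * N)) := by
    refine IsNilpotent.neg ⟨r + 1, ?_⟩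
    rw [hc.mul_pow, hB.pow_eq_zero le_rfl, zero_mul]
  have h1 := Matrix.isNilpotent_charpoly_sub_pow_of_isNilpotent hnil
  have h2 : (-(B * N)).charpoly = Polynomial.X ^ Fintype.card (Coord d) := by
    have := h1.eq_zero
    exact sub_eq_zero.mp this
  have h3 := congrArg (Polynomial.eval (1 : ℝ)) h2
  rw [Matrix.eval_charpoly] at h3
  rw [hE]
  simpa using h3

/-! ### Measure-preserving flows -/

/-- `(t, x) ↦ (t, x + a)`. -/
def trans (a : Coord d → ℝ) (z : Pt d) : Pt d := (z.1, z.2 + a)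

lemma flowX_eq_trans (j : Coord d) (h : ℝ) : flowX j h = trans (h • Pi.single j (1 : ℝ)) := rfl

lemma trans_trans (a b : Coord d → ℝ) (z : Pt d) : trans a (trans b z) = trans (a + b) z := by
  simp [trans, add_comm a b, add_assoc]

lemma trans_zero (z : Pt d) : trans 0 z = z := by simp [trans]

lemma trans_expB_flowY (h : ℝ) (b : Coord d → ℝ) (z : Pt d) :
    trans (expB B h b) (flowY B h z) = flowY B h (trans b z) := by
  simp [trans, flowY, expB_add_right]

lemma measurePreserving_trans (a : Coord d → ℝ) :
    MeasurePreserving (trans a) (volume : Measure (Pt d)) volume := by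
  exact (MeasurePreserving.id (volume : Measure ℝ)).prod
    (measurePreserving_add_right (volume : Measure (Coord d → ℝ)) a)

/-- A smooth measure-preserving flow `Φ`, with generating vector field `V`. -/
structure IsFlow (Φ : ℝ → Pt d → Pt d) (V : Pt d → Pt d) : Prop where
  contDiff : ContDiff ℝ (⊤ : ℕ∞) (fun p : ℝ × Pt d => Φ p.1 p.2)
  contDiff_field : ContDiff ℝ (⊤ : ℕ∞) V
  add : ∀ a b z, Φ (a + b) z = Φ a (Φ b z)
  zero : ∀ z, Φ 0 z = z
  measurePreserving : ∀ h, MeasurePreserving (Φ h) (volume : Measure (Pt d)) volume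
  hasDerivAt : ∀ z h, HasDerivAt (fun h => Φ h z) (V (Φ h z)) h

lemma isFlow_flowX (j : Coord d) :
    IsFlow (flowX j) (fun _ => ((0, Pi.single j 1) : Pt d)) where
  contDiff := by unfold flowX; fun_prop
  contDiff_field := contDiff_const
  add a b z := by simp [flowX, add_smul, add_assoc, add_comm (a • _)]
  zero z := by simp [flowX]
  measurePreserving h := measurePreserving_trans _
  hasDerivAt z h := by
    unfold flowX
    refine (hasDerivAt_const h z.1).prodMk ?_
    simpa using ((hasDerivAt_id h).smul_const (Pi.single j (1 : ℝ))).const_add z.2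

lemma IsBlockMatrix.isFlow_flowY (hB : IsBlockMatrix d B) :
    IsFlow (flowY B) (fun z => ((1, B.mulVec z.2) : Pt d)) where
  contDiff := by
    unfold flowY
    have : ContDiff ℝ (⊤ : ℕ∞) (fun p : ℝ × Pt d => expB B p.1 p.2.2) :=
      hB.contDiff_expB.comp (contDiff_fst.prodMk (contDiff_snd.comp contDiff_snd))
    fun_prop
  contDiff_field := by
    refine contDiff_const.prodMk ?_
    exact (Matrix.mulVecLin B).toContinuousLinearMap.contDiff.comp contDiff_snd
  add a b z := by
    simp only [flowY, expB_add, Prod.mk.injEq, and_true]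
    ring
  zero z := by simp [flowY, expB_zero]
  measurePreserving h := by
    have h1 : MeasurePreserving (expB B h) (volume : Measure (Coord d → ℝ)) volume := by
      refine ⟨(hB.contDiff_expB.continuous.comp (Continuous.prodMk_right h)).measurable, ?_⟩
      have h0 := Real.map_matrix_volume_pi_eq_smul_volume_pi
        (M := NormedSpace.exp (h • B)) (by rw [hB.det_exp]; exact one_ne_zero)
      rw [hB.det_exp] at h0
      have h2 : expB B h = Matrix.toLin' (NormedSpace.exp (h • B)) := rfl
      rw [h2]
      simpa using h0
    exact (measurePreserving_add_right volume h).prod h1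
  hasDerivAt z h := by
    unfold flowY
    refine HasDerivAt.prodMk ?_ ?_
    · simpa using (hasDerivAt_id h).const_add z.1
    · exact hB.hasDerivAt_expB h z.2

section Flow

variable {Φ : ℝ → Pt d → Pt d} {V : Pt d → Pt d}

lemma IsFlow.continuous (hΦ : IsFlow Φ V) : Continuous (fun p : ℝ × Pt d => Φ p.1 p.2) :=
  hΦ.contDiff.continuous

lemma IsFlow.contDiff_apply (hΦ : IsFlow Φ V) (h : ℝ) : ContDiff ℝ (⊤ : ℕ∞) (Φ h) :=
  hΦ.contDiff.comp (contDiff_prodMk_right h)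

lemma IsFlow.neg_apply (hΦ : IsFlow Φ V) (h : ℝ) (z : Pt d) : Φ (-h) (Φ h z) = z := by
  rw [← hΦ.add, neg_add_cancel, hΦ.zero]

lemma IsFlow.apply_neg (hΦ : IsFlow Φ V) (h : ℝ) (z : Pt d) : Φ h (Φ (-h) z) = z := by
  rw [← hΦ.add, add_neg_cancel, hΦ.zero]

/-- The flow leaves its own vector field invariant: both sides are the derivative of
`s ↦ Φ (h + s) z` at `s = 0`. -/
lemma IsFlow.fderiv_field (hΦ : IsFlow Φ V) (h : ℝ) (z : Pt d) :
    fderiv ℝ (Φ h) z (V z) = V (Φ h z) := by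
  have h1 : HasDerivAt (fun s => Φ h (Φ s z)) (fderiv ℝ (Φ h) (Φ 0 z) (V (Φ 0 z))) 0 := by
    have := ((hΦ.contDiff_apply h).differentiable (by simp)) (Φ 0 z)
    exact this.hasFDerivAt.comp_hasDerivAt 0 (hΦ.hasDerivAt z 0)
  have h2 : HasDerivAt (fun s => Φ (h + s) z) (V (Φ (h + 0) z)) 0 :=
    HasDerivAt.comp_const_add h 0 (hΦ.hasDerivAt z (h + 0))
  simp_rw [hΦ.add] at h2
  rw [hΦ.zero] at h1 h2
  exact h1.unique h2

/-- The shear `(a, z) ↦ (a, Φ_{c a} z)` preserves product measures. -/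
lemma IsFlow.measurePreserving_shear (hΦ : IsFlow Φ V) (c : ℝ) (μ : Measure ℝ) [SFinite μ] :
    MeasurePreserving (fun p : ℝ × Pt d => (p.1, Φ (c * p.1) p.2)) (μ.prod volume)
      (μ.prod volume) := by
  refine (MeasurePreserving.id μ).skew_product (g := fun a z => Φ (c * a) z) ?_ ?_
  · exact (hΦ.continuous.comp
      ((continuous_const.mul continuous_fst).prodMk continuous_snd)).measurable
  · exact Filter.Eventually.of_forall fun a => (hΦ.measurePreserving (c * a)).map_eq

end Flow

end

/-! ### Averages in `L^p` -/

section

section Average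

variable {Θ Z : Type*} [MeasurableSpace Θ] [MeasurableSpace Z] {μ : Measure Θ}
  [IsProbabilityMeasure μ] {ν : Measure Z} [SFinite ν] {p K : ℝ≥0∞}

lemma eLpNorm_average_le_of_stronglyMeasurable {F : Θ → Z → ℝ}
    (hF : StronglyMeasurable (Function.uncurry F)) (hp : 1 ≤ p)
    (hK : ∀ᵐ θ ∂μ, eLpNorm (F θ) p ν ≤ K) :
    eLpNorm (fun z => ∫ θ, F θ z ∂μ) p ν ≤ K := by
  have hFz : ∀ z, StronglyMeasurable (fun θ => F θ z) := fun z =>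
    hF.comp_measurable measurable_prodMk_right
  have hmeas : Measurable (fun w : Θ × Z => ‖F w.1 w.2‖ₑ) := hF.enorm
  rcases eq_or_ne p ∞ with rfl | hp'
  · rw [eLpNorm_exponent_top]
    refine eLpNormEssSup_le_of_ae_enorm_bound ?_
    have h1 : ∀ᵐ θ ∂μ, ∀ᵐ z ∂ν, ‖F θ z‖ₑ ≤ K := by
      filter_upwards [hK] with θ hθ
      rw [eLpNorm_exponent_top] at hθ
      filter_upwards [enorm_ae_le_eLpNormEssSup (F θ) ν] with z hz
      exact hz.trans hθ
    have h2 : ∀ᵐ z ∂ν, ∀ᵐ θ ∂μ, ‖F θ z‖ₑ ≤ K := by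
      refine (Measure.ae_ae_comm ?_).1 h1
      exact measurableSet_le hmeas measurable_const
    filter_upwards [h2] with z hz
    calc ‖∫ θ, F θ z ∂μ‖ₑ ≤ ∫⁻ θ, ‖F θ z‖ₑ ∂μ := enorm_integral_le_lintegral_enorm _
      _ ≤ ∫⁻ _, K ∂μ := lintegral_mono_ae hz
      _ = K := by simp
  · have hp0 : p ≠ 0 := (zero_lt_one.trans_le hp).ne'
    have hpr : 0 < p.toReal := ENNReal.toReal_pos hp0 hp'
    rw [eLpNorm_eq_lintegral_rpow_enorm_toReal hp0 hp', one_div, ENNReal.rpow_inv_le_iff hpr]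
    calc ∫⁻ z, ‖∫ θ, F θ z ∂μ‖ₑ ^ p.toReal ∂ν
        ≤ ∫⁻ z, ∫⁻ θ, ‖F θ z‖ₑ ^ p.toReal ∂μ ∂ν := by
          refine lintegral_mono fun z => ?_
          have h1 : ‖∫ θ, F θ z ∂μ‖ₑ ≤ eLpNorm (fun θ => F θ z) 1 μ := by
            rw [eLpNorm_one_eq_lintegral_enorm]
            exact enorm_integral_le_lintegral_enorm _
          have h2 := h1.trans
            (eLpNorm_le_eLpNorm_of_exponent_le hp (hFz z).aestronglyMeasurable)
          rwa [eLpNorm_eq_lintegral_rpow_enorm_toReal hp0 hp', one_div,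
            ENNReal.le_rpow_inv_iff hpr] at h2
      _ = ∫⁻ θ, ∫⁻ z, ‖F θ z‖ₑ ^ p.toReal ∂ν ∂μ := by
          refine lintegral_lintegral_swap ?_
          exact ((hmeas.comp measurable_swap).pow_const _).aemeasurable
      _ ≤ ∫⁻ _, K ^ p.toReal ∂μ := by
          refine lintegral_mono_ae ?_
          filter_upwards [hK] with θ hθ
          rwa [eLpNorm_eq_lintegral_rpow_enorm_toReal hp0 hp', one_div,
            ENNReal.rpow_inv_le_iff hpr] at hθ
      _ = K ^ p.toReal := by simp

/-- The `L^p` norm of an average is at most the largest `L^p` norm of the averaged functions. -/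
lemma eLpNorm_average_le {F : Θ → Z → ℝ}
    (hF : AEStronglyMeasurable (Function.uncurry F) (μ.prod ν)) (hp : 1 ≤ p)
    (hK : ∀ᵐ θ ∂μ, eLpNorm (F θ) p ν ≤ K) :
    eLpNorm (fun z => ∫ θ, F θ z ∂μ) p ν ≤ K := by
  have h1 : ∀ᵐ θ ∂μ, ∀ᵐ z ∂ν, F θ z = hF.mk _ (θ, z) :=
    Measure.ae_ae_of_ae_prod hF.ae_eq_mk
  have h2 : ∀ᵐ z ∂ν, ∀ᵐ θ ∂μ, F θ z = hF.mk _ (θ, z) := by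
    have hsw : ∀ᵐ w ∂(ν.prod μ), Function.uncurry F w.swap = hF.mk _ w.swap :=
      (Measure.measurePreserving_swap (μ := ν) (ν := μ)).quasiMeasurePreserving.ae hF.ae_eq_mk
    exact Measure.ae_ae_of_ae_prod hsw
  have h3 := eLpNorm_average_le_of_stronglyMeasurable (μ := μ) (ν := ν) (p := p) (K := K)
    (F := fun θ z => hF.mk _ (θ, z)) hF.stronglyMeasurable_mk hp (by
      filter_upwards [hK, h1] with θ hθ h1θ
      rwa [← eLpNorm_congr_ae h1θ])
  rwa [eLpNorm_congr_ae]
  filter_upwards [h2] with z hz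
  exact integral_congr_ae hz

end Average

/-! ### Weak derivatives along a flow -/

variable {r : ℕ} {d : Fin (r + 1) → ℕ} {B : Matrix (Coord d) (Coord d) ℝ}

/-- Lebesgue measure on `[0, 1]`. -/
noncomputable abbrev unitMeasure : Measure ℝ := volume.restrict (Icc 0 1)

instance : IsProbabilityMeasure unitMeasure := ⟨by simp⟩

section Flow

variable {Φ : ℝ → Pt d → Pt d} {V : Pt d → Pt d} {u v : Pt d → ℝ}

/-- The time `h` map of a flow as a homeomorphism. -/
def IsFlow.homeomorph (hΦ : IsFlow Φ V) (h : ℝ) : Pt d ≃ₜ Pt d where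
  toFun := Φ h
  invFun := Φ (-h)
  left_inv := hΦ.neg_apply h
  right_inv := hΦ.apply_neg h
  continuous_toFun := (hΦ.contDiff_apply h).continuous
  continuous_invFun := (hΦ.contDiff_apply (-h)).continuous

lemma IsFlow.integral_comp (hΦ : IsFlow Φ V) (h : ℝ) (f : Pt d → ℝ) :
    ∫ z, f (Φ h z) = ∫ z, f z :=
  (hΦ.measurePreserving h).integral_comp (hΦ.homeomorph h).measurableEmbedding f

lemma IsFlow.integrableOn_shear (hΦ : IsFlow Φ V) (hv : LocallyIntegrable v volume) (a : ℝ)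
    {K : Set (Pt d)} (hK : IsCompact K) :
    Integrable (fun w : ℝ × Pt d => v (Φ (a * w.1) w.2))
      (unitMeasure.prod (volume.restrict K)) := by
  have hc : ∀ c : ℝ, Continuous (fun w : ℝ × Pt d => Φ (c * w.1) w.2) := fun c =>
    hΦ.continuous.comp ((continuous_const.mul continuous_fst).prodMk continuous_snd)
  set K' : Set (Pt d) := (fun w : ℝ × Pt d => Φ (a * w.1) w.2) '' (Icc 0 1 ×ˢ K) with hK'
  have hK'c : IsCompact K' := (isCompact_Icc.prod hK).image (hc a)
  set S : Set (ℝ × Pt d) := (fun w : ℝ × Pt d => Φ (-a * w.1) w.2) ⁻¹' K with hS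
  have hSm : MeasurableSet S := (hK.isClosed.preimage (hc (-a))).measurableSet
  have h1 : IntegrableOn (fun w : ℝ × Pt d => v w.2) (univ ×ˢ K') (unitMeasure.prod volume) := by
    rw [IntegrableOn, ← Measure.prod_restrict, Measure.restrict_univ]
    exact Integrable.comp_snd (hv.integrableOn_isCompact hK'c) _
  have h2 : IntegrableOn (fun w : ℝ × Pt d => v w.2) S (unitMeasure.prod volume) := by
    refine h1.mono_set_ae ?_
    have hae : ∀ᵐ w : ℝ × Pt d ∂(unitMeasure.prod volume), w.1 ∈ Icc (0 : ℝ) 1 :=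
      Measure.quasiMeasurePreserving_fst.ae (ae_restrict_mem measurableSet_Icc)
    filter_upwards [hae] with w hw hwS
    refine ⟨mem_univ _, (w.1, Φ (-a * w.1) w.2), ⟨hw, hwS⟩, ?_⟩
    change Φ (a * w.1) (Φ (-a * w.1) w.2) = w.2
    rw [neg_mul, hΦ.apply_neg]
  rw [← integrable_indicator_iff hSm] at h2
  have h3 := (hΦ.measurePreserving_shear a unitMeasure).integrable_comp_of_integrable h2
  have h4 : (S.indicator (fun w : ℝ × Pt d => v w.2)) ∘
      (fun w : ℝ × Pt d => (w.1, Φ (a * w.1) w.2)) =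
      (univ ×ˢ K).indicator (fun w : ℝ × Pt d => v (Φ (a * w.1) w.2)) := by
    ext w
    have hmem : (w.1, Φ (a * w.1) w.2) ∈ S ↔ w ∈ (univ ×ˢ K : Set (ℝ × Pt d)) := by
      simp [hS, hΦ.neg_apply]
    by_cases hw : w ∈ (univ ×ˢ K : Set (ℝ × Pt d))
    · rw [indicator_of_mem hw, Function.comp_apply, indicator_of_mem (hmem.2 hw)]
    · rw [indicator_of_notMem hw, Function.comp_apply, indicator_of_notMem (mt hmem.1 hw)]
  rw [h4, integrable_indicator_iff (MeasurableSet.univ.prod hK.measurableSet), IntegrableOn,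
    ← Measure.prod_restrict, Measure.restrict_univ] at h3
  exact h3

lemma IsFlow.integrable_mul_shear (hΦ : IsFlow Φ V) (hv : LocallyIntegrable v volume) (a : ℝ)
    {φ : Pt d → ℝ} (hφ : Continuous φ) (hφc : HasCompactSupport φ) :
    Integrable (fun w : ℝ × Pt d => φ w.2 * v (Φ (a * w.1) w.2)) (unitMeasure.prod volume) := by
  have h1 := hΦ.integrableOn_shear hv a hφc.isCompact
  obtain ⟨C, hC⟩ := hφc.exists_bound_of_continuous hφ
  have h2 := h1.bdd_mul (c := C) (f := fun w : ℝ × Pt d => φ w.2)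
    (hφ.comp continuous_snd).aestronglyMeasurable (Filter.Eventually.of_forall fun w => hC w.2)
  have h3 : IntegrableOn (fun w : ℝ × Pt d => φ w.2 * v (Φ (a * w.1) w.2)) (univ ×ˢ tsupport φ)
      (unitMeasure.prod volume) := by
    rwa [IntegrableOn, ← Measure.prod_restrict, Measure.restrict_univ]
  refine (integrableOn_iff_integrable_of_support_subset ?_).1 h3
  refine fun w hw => ⟨mem_univ _, ?_⟩
  by_contra hcon
  exact hw (by simp [image_eq_zero_of_notMem_tsupport hcon])

lemma IsFlow.locallyIntegrable_average (hΦ : IsFlow Φ V) (hv : LocallyIntegrable v volume)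
    (a : ℝ) :
    LocallyIntegrable (fun z => ∫ θ, v (Φ (a * θ) z) ∂unitMeasure) volume := by
  rw [locallyIntegrable_iff]
  intro K hK
  exact (hΦ.integrableOn_shear hv a hK).integral_prod_right

lemma IsFlow.locallyIntegrable_comp (hΦ : IsFlow Φ V) (hv : LocallyIntegrable v volume) (a : ℝ) :
    LocallyIntegrable (fun z => v (Φ a z)) volume := by
  rw [locallyIntegrable_iff]
  intro K hK
  have h1 : IntegrableOn v ((hΦ.homeomorph a) '' K) volume :=
    hv.integrableOn_isCompact (hK.image (hΦ.homeomorph a).continuous)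
  have h2 := ((hΦ.measurePreserving a).integrableOn_comp_preimage
    (hΦ.homeomorph a).measurableEmbedding).2 h1
  refine h2.mono_set fun z hz => ?_
  exact ⟨z, hz, rfl⟩

/-- The derivative of `φ` along the vector field `V`. -/
noncomputable def alongField (V : Pt d → Pt d) (φ : Pt d → ℝ) : Pt d → ℝ := fun z => fderiv ℝ φ z (V z)

lemma contDiff_alongField (hV : ContDiff ℝ (⊤ : ℕ∞) V) {φ : Pt d → ℝ}
    (hφ : ContDiff ℝ (⊤ : ℕ∞) φ) : ContDiff ℝ (⊤ : ℕ∞) (alongField V φ) :=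
  (hφ.fderiv_right (m := (⊤ : ℕ∞)) (by simp)).clm_apply hV

lemma hasCompactSupport_alongField {φ : Pt d → ℝ} (hφ : HasCompactSupport φ) :
    HasCompactSupport (alongField V φ) := by
  refine (hφ.fderiv (𝕜 := ℝ)).mono' ?_
  refine fun z hz => subset_tsupport _ ?_
  intro h0
  exact hz (by simp [alongField, h0])

lemma IsFlow.alongField_comp (hΦ : IsFlow Φ V) {φ : Pt d → ℝ} (hφ : ContDiff ℝ (⊤ : ℕ∞) φ)
    (h : ℝ) (z : Pt d) : alongField V (fun z => φ (Φ h z)) z = alongField V φ (Φ h z) := by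
  have h1 : HasFDerivAt (fun z => φ (Φ h z)) _ z :=
    ((hφ.differentiable (by simp)) (Φ h z)).hasFDerivAt.comp z
    (((hΦ.contDiff_apply h).differentiable (by simp)) z).hasFDerivAt
  rw [alongField, h1.fderiv, ContinuousLinearMap.comp_apply, hΦ.fderiv_field, alongField]

lemma IsFlow.average_alongField (hΦ : IsFlow Φ V) {φ : Pt d → ℝ} (hφ : ContDiff ℝ (⊤ : ℕ∞) φ)
    (a : ℝ) (z : Pt d) :
    a * ∫ θ, alongField V φ (Φ (a * θ) z) ∂unitMeasure = φ (Φ a z) - φ z := by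
  have hd : ∀ θ : ℝ, HasDerivAt (fun θ => φ (Φ (a * θ) z)) (a * alongField V φ (Φ (a * θ) z)) θ := by
    intro θ
    have h1 := ((hφ.differentiable (by simp)) (Φ (a * θ) z)).hasFDerivAt.comp_hasDerivAt _
      (hΦ.hasDerivAt z (a * θ))
    have h2 : HasDerivAt (fun θ : ℝ => a * θ) a θ := by simpa using (hasDerivAt_id θ).const_mul a
    have h3 := h1.scomp θ h2
    simpa [alongField, Function.comp_def] using h3
  have hcont : Continuous (fun θ : ℝ => a * alongField V φ (Φ (a * θ) z)) := by
    refine continuous_const.mul ?_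
    exact (contDiff_alongField hΦ.contDiff_field hφ).continuous.comp
      (hΦ.continuous.comp ((continuous_const.mul continuous_id).prodMk continuous_const))
  have h4 := intervalIntegral.integral_eq_sub_of_hasDerivAt (a := 0) (b := 1)
    (fun θ _ => hd θ) (hcont.intervalIntegrable 0 1)
  rw [intervalIntegral.integral_of_le zero_le_one, ← integral_Icc_eq_integral_Ioc] at h4
  rw [← integral_const_mul, h4]
  simp [hΦ.zero]

/-- The fundamental theorem of calculus along a flow, for weak derivatives. It is the dual of the
classical one for test functions. -/
lemma IsFlow.sub_eq_average (hΦ : IsFlow Φ V)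
    (h : IsWeak (fun φ z => -alongField V φ z) u v) (a : ℝ) :
    ∀ᵐ z, u (Φ a z) - u z = a * ∫ θ, v (Φ (a * θ) z) ∂unitMeasure := by
  obtain ⟨hu, hv, huv⟩ := h
  have hlu := (hΦ.locallyIntegrable_comp hu a)
  refine ae_eq_of_integral_contDiff_smul_eq (hlu.sub hu)
    ((hΦ.locallyIntegrable_average hv a).smul a) ?_
  intro φ hφ hφc
  simp only [smul_eq_mul]
  set ψ := alongField V φ with hψ
  have hψs : ContDiff ℝ (⊤ : ℕ∞) ψ := contDiff_alongField hΦ.contDiff_field hφ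
  have hψc : HasCompactSupport ψ := hasCompactSupport_alongField hφc
  have e0 : ∀ θ : ℝ, ∫ z, φ z * v (Φ (a * θ) z) = -∫ z, u z * ψ (Φ (-a * θ) z) := by
    intro θ
    rw [← hΦ.integral_comp (-(a * θ))]
    simp_rw [hΦ.apply_neg]
    have := huv (fun z => φ (Φ (-(a * θ)) z)) (hφ.comp (hΦ.contDiff_apply _))
      (hφc.comp_homeomorph (hΦ.homeomorph (-(a * θ))))
    simp_rw [hΦ.alongField_comp hφ, mul_neg, integral_neg] at this
    rw [neg_mul, ← this]
    exact integral_congr_ae (Filter.Eventually.of_forall fun z => mul_comm _ _)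
  have i1 := hΦ.integrable_mul_shear hv a hφ.continuous hφc
  have i2 : Integrable (fun w : ℝ × Pt d => u w.2 * ψ (Φ (-a * w.1) w.2))
      (unitMeasure.prod volume) := by
    have := (hΦ.measurePreserving_shear (-a) unitMeasure).integrable_comp_of_integrable
      (hΦ.integrable_mul_shear hu a hψs.continuous hψc)
    convert this using 2 with w
    simp only [Function.comp_apply, neg_mul, hΦ.apply_neg]
    ring
  have iφ : ∀ f : Pt d → ℝ, LocallyIntegrable f volume → Integrable (fun z => φ z * f z) := by
    intro f hf
    exact hf.integrable_smul_left_of_hasCompactSupport hφ.continuous hφc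
  calc ∫ z, φ z * (u (Φ a z) - u z)
      = (∫ z, φ z * u (Φ a z)) - ∫ z, φ z * u z := by
        simp_rw [mul_sub]
        exact integral_sub (iφ _ hlu) (iφ _ hu)
    _ = (∫ z, φ (Φ (-a) z) * u z) - ∫ z, φ z * u z := by
        rw [← hΦ.integral_comp (-a) (fun z => φ z * u (Φ a z))]
        simp_rw [hΦ.apply_neg]
    _ = ∫ z, u z * (φ (Φ (-a) z) - φ z) := by
        rw [← integral_sub _ (iφ _ hu)]
        · exact integral_congr_ae (Filter.Eventually.of_forall fun z => by ring)
        · have := (hΦ.measurePreserving (-a)).integrable_comp_of_integrable (iφ _ hlu)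
          simpa only [Function.comp_def, hΦ.apply_neg] using this
    _ = ∫ z, -a * ∫ θ, u z * ψ (Φ (-a * θ) z) ∂unitMeasure := by
        refine integral_congr_ae (Filter.Eventually.of_forall fun z => ?_)
        beta_reduce
        rw [← hΦ.average_alongField hφ (-a) z, integral_const_mul]
        ring
    _ = -a * ∫ θ, (∫ z, u z * ψ (Φ (-a * θ) z)) ∂unitMeasure := by
        rw [integral_const_mul]
        congr 1
        exact (integral_integral_swap (f := fun θ z => u z * ψ (Φ (-a * θ) z)) i2).symm
    _ = a * ∫ θ, (∫ z, φ z * v (Φ (a * θ) z)) ∂unitMeasure := by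
        simp_rw [e0, integral_neg]
        ring
    _ = a * ∫ z, ∫ θ, φ z * v (Φ (a * θ) z) ∂unitMeasure := by
        congr 1
        exact integral_integral_swap (f := fun θ z => φ z * v (Φ (a * θ) z)) i1
    _ = ∫ z, φ z * (a * ∫ θ, v (Φ (a * θ) z) ∂unitMeasure) := by
        rw [← integral_const_mul]
        refine integral_congr_ae (Filter.Eventually.of_forall fun z => ?_)
        beta_reduce
        rw [integral_const_mul]
        ring

end Flow

end

/-! ### Calculus of weak derivatives -/

section

variable {r : ℕ} {d : Fin (r + 1) → ℕ} {B : Matrix (Coord d) (Coord d) ℝ}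

/-- Test functions: smooth functions of compact support. -/
def IsTest (φ : Pt d → ℝ) : Prop := ContDiff ℝ (⊤ : ℕ∞) φ ∧ HasCompactSupport φ

/-- Operators that map test functions to test functions. -/
def IsTestOp (A : (Pt d → ℝ) → Pt d → ℝ) : Prop := ∀ φ, IsTest φ → IsTest (A φ)

lemma IsTest.integrable_mul {φ f : Pt d → ℝ} (hφ : IsTest φ) (hf : LocallyIntegrable f volume) :
    Integrable (fun z => f z * φ z) :=
  hf.integrable_smul_right_of_hasCompactSupport hφ.1.continuous hφ.2

section IsWeak

variable {A A₁ A₂ : (Pt d → ℝ) → Pt d → ℝ} {u u' v v' w : Pt d → ℝ}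

lemma IsWeak.ae_unique (h : IsWeak A u v) (h' : IsWeak A u v') : v =ᵐ[volume] v' := by
  refine ae_eq_of_integral_contDiff_smul_eq h.2.1 h'.2.1 fun φ hφ hφc => ?_
  simp_rw [smul_eq_mul, mul_comm (φ _)]
  rw [h.2.2 φ hφ hφc, h'.2.2 φ hφ hφc]

lemma IsWeak.congr_left (h : IsWeak A u v) (hu : u =ᵐ[volume] u') : IsWeak A u' v := by
  refine ⟨h.1.congr hu, h.2.1, fun φ hφ hφc => ?_⟩
  rw [h.2.2 φ hφ hφc]
  refine integral_congr_ae ?_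
  filter_upwards [hu] with z hz
  rw [hz]

lemma IsWeak.congr_op (h : IsWeak A u v) (hA : ∀ φ, IsTest φ → A φ = A₁ φ) : IsWeak A₁ u v :=
  ⟨h.1, h.2.1, fun φ hφ hφc => by rw [h.2.2 φ hφ hφc, hA φ ⟨hφ, hφc⟩]⟩

lemma IsWeak.add (hA : IsTestOp A) (h : IsWeak A u v) (h' : IsWeak A u' v') :
    IsWeak A (u + u') (v + v') := by
  refine ⟨h.1.add h'.1, h.2.1.add h'.2.1, fun φ hφ hφc => ?_⟩
  have hφ' : IsTest φ := ⟨hφ, hφc⟩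
  simp_rw [Pi.add_apply, add_mul]
  rw [integral_add (hφ'.integrable_mul h.2.1) (hφ'.integrable_mul h'.2.1),
    integral_add ((hA φ hφ').integrable_mul h.1) ((hA φ hφ').integrable_mul h'.1),
    h.2.2 φ hφ hφc, h'.2.2 φ hφ hφc]

lemma IsWeak.smul (h : IsWeak A u v) (c : ℝ) : IsWeak A (c • u) (c • v) := by
  refine ⟨h.1.smul c, h.2.1.smul c, fun φ hφ hφc => ?_⟩
  simp_rw [Pi.smul_apply, smul_eq_mul, mul_assoc, integral_const_mul]
  rw [h.2.2 φ hφ hφc]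

lemma IsWeak.add_op (hA₁ : IsTestOp A₁) (hA₂ : IsTestOp A₂) (h : IsWeak A₁ u v)
    (h' : IsWeak A₂ u v') : IsWeak (fun φ z => A₁ φ z + A₂ φ z) u (v + v') := by
  refine ⟨h.1, h.2.1.add h'.2.1, fun φ hφ hφc => ?_⟩
  have hφ' : IsTest φ := ⟨hφ, hφc⟩
  simp_rw [Pi.add_apply, add_mul, mul_add]
  rw [integral_add (hφ'.integrable_mul h.2.1) (hφ'.integrable_mul h'.2.1),
    integral_add ((hA₁ φ hφ').integrable_mul h.1) ((hA₂ φ hφ').integrable_mul h.1),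
    h.2.2 φ hφ hφc, h'.2.2 φ hφ hφc]

lemma IsWeak.smul_op (h : IsWeak A u v) (c : ℝ) : IsWeak (fun φ z => c * A φ z) u (c • v) := by
  refine ⟨h.1, h.2.1.smul c, fun φ hφ hφc => ?_⟩
  simp_rw [Pi.smul_apply, smul_eq_mul, mul_assoc, mul_left_comm _ c, integral_const_mul]
  rw [h.2.2 φ hφ hφc]

lemma IsWeak.comp (h : IsWeak A₁ u v) (h' : IsWeak A₂ v w) (hA₂ : IsTestOp A₂) :
    IsWeak (fun φ => A₁ (A₂ φ)) u w := by
  refine ⟨h.1, h'.2.1, fun φ hφ hφc => ?_⟩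
  rw [h'.2.2 φ hφ hφc, h.2.2 _ (hA₂ φ ⟨hφ, hφc⟩).1 (hA₂ φ ⟨hφ, hφc⟩).2]

lemma isWeak_id (hu : LocallyIntegrable u volume) : IsWeak (fun φ => φ) u u :=
  ⟨hu, hu, fun _ _ _ => rfl⟩

end IsWeak

lemma IsTest.neg {φ : Pt d → ℝ} (hφ : IsTest φ) : IsTest (fun z => -φ z) :=
  ⟨hφ.1.neg, hφ.2.neg⟩

lemma IsTest.map_alongField {V : Pt d → Pt d} (hV : ContDiff ℝ (⊤ : ℕ∞) V) {φ : Pt d → ℝ}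
    (hφ : IsTest φ) : IsTest (alongField V φ) :=
  ⟨contDiff_alongField hV hφ.1, hasCompactSupport_alongField hφ.2⟩

lemma contDiff_fieldY : ContDiff ℝ (⊤ : ℕ∞) (fun z : Pt d => ((1, B.mulVec z.2) : Pt d)) :=
  contDiff_const.prodMk ((Matrix.mulVecLin B).toContinuousLinearMap.contDiff.comp contDiff_snd)

lemma IsTest.map_dY {φ : Pt d → ℝ} (hφ : IsTest φ) : IsTest (dY B φ) :=
  hφ.map_alongField contDiff_fieldY

lemma IsTest.map_dX {φ : Pt d → ℝ} (hφ : IsTest φ) (j : Coord d) : IsTest (dX j φ) :=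
  hφ.map_alongField contDiff_const

/-- `v = ⟨a, ∇u⟩` weakly. -/
def IsWeakDV (a : Coord d → ℝ) (u v : Pt d → ℝ) : Prop :=
  IsWeak (fun φ z => -fderiv ℝ φ z (0, a)) u v

lemma isTestOp_dV (a : Coord d → ℝ) : IsTestOp (fun (φ : Pt d → ℝ) z => -fderiv ℝ φ z (0, a)) :=
  fun _ hφ => (hφ.map_alongField (V := fun _ => (0, a)) contDiff_const).neg

lemma isTestOp_dY : IsTestOp (fun (φ : Pt d → ℝ) z => -dY B φ z) := fun _ hφ => hφ.map_dY.neg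

section

variable {u v v' f g w : Pt d → ℝ} {a b : Coord d → ℝ}

lemma IsWeakDV.add_dir (h : IsWeakDV a u v) (h' : IsWeakDV b u v') :
    IsWeakDV (a + b) u (v + v') := by
  refine (IsWeak.add_op (isTestOp_dV a) (isTestOp_dV b) h h').congr_op fun φ _ => ?_
  ext z
  have : ((0, a + b) : Pt d) = (0, a) + (0, b) := by simp
  rw [this, map_add]
  ring

lemma IsWeakDV.smul_dir (h : IsWeakDV a u v) (c : ℝ) : IsWeakDV (c • a) u (c • v) := by
  refine (IsWeak.smul_op h c).congr_op fun φ _ => ?_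
  ext z
  have : ((0, c • a) : Pt d) = c • (0, a) := by simp
  rw [this, map_smul, smul_eq_mul]
  ring

lemma isWeakDV_zero (hu : LocallyIntegrable u volume) : IsWeakDV (0 : Coord d → ℝ) u 0 := by
  refine ⟨hu, locallyIntegrable_zero, fun φ _ _ => ?_⟩
  have : ((0, 0) : Pt d) = 0 := rfl
  simp [this]

lemma IsWeakDV.sum {ι : Type*} {s : Finset ι} {a : ι → Coord d → ℝ} {v : ι → Pt d → ℝ}
    (hu : LocallyIntegrable u volume) (h : ∀ j ∈ s, IsWeakDV (a j) u (v j)) :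
    IsWeakDV (∑ j ∈ s, a j) u (∑ j ∈ s, v j) := by
  classical
  induction s using Finset.induction_on with
  | empty => exact isWeakDV_zero hu
  | insert j s hj ih =>
    rw [Finset.sum_insert hj, Finset.sum_insert hj]
    exact (h j (Finset.mem_insert_self _ _)).add_dir
      (ih fun i hi => h i (Finset.mem_insert_of_mem hi))

/-- `[⟨a, ∇⟩, Y] = ⟨Ba, ∇⟩` on smooth functions. -/
lemma dV_dY_sub {φ : Pt d → ℝ} (hφ : ContDiff ℝ (⊤ : ℕ∞) φ) (a : Coord d → ℝ) (z : Pt d) :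
    fderiv ℝ (dY B φ) z (0, a) - dY B (fun z => fderiv ℝ φ z (0, a)) z
      = fderiv ℝ φ z (0, B.mulVec a) := by
  have hd : DifferentiableAt ℝ (fderiv ℝ φ) z :=
    ((hφ.fderiv_right (m := (⊤ : ℕ∞)) (by simp)).differentiable (by simp)) z
  have hV : HasFDerivAt (fun z : Pt d => ((1, B.mulVec z.2) : Pt d))
      ((0 : Pt d →L[ℝ] ℝ).prod ((Matrix.mulVecLin B).toContinuousLinearMap.comp
        (ContinuousLinearMap.snd ℝ ℝ (Coord d → ℝ)))) z :=
    (hasFDerivAt_const (1 : ℝ) z).prodMk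
      ((Matrix.mulVecLin B).toContinuousLinearMap.hasFDerivAt.comp z hasFDerivAt_snd)
  have h1 : HasFDerivAt (dY B φ) _ z := hd.hasFDerivAt.clm_apply hV
  have h2 : HasFDerivAt (fun z => fderiv ℝ φ z (0, a)) _ z :=
    hd.hasFDerivAt.clm_apply (hasFDerivAt_const ((0, a) : Pt d) z)
  have hsymm : IsSymmSndFDerivAt ℝ φ z :=
    (hφ.contDiffAt).isSymmSndFDerivAt (by simpa using WithTop.coe_le_coe.2 (le_top : (2 : ℕ∞) ≤ ⊤))
  rw [h1.fderiv, dY, h2.fderiv]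
  simp only [add_apply, ContinuousLinearMap.comp_apply,
    ContinuousLinearMap.flip_apply, ContinuousLinearMap.prod_apply]
  rw [hsymm.eq (0, a) (1, B.mulVec z.2)]
  simp

/-- `⟨Ba, ∇⟩ u = ⟨a, ∇⟩ Y u - Y ⟨a, ∇⟩ u` weakly. -/
lemma IsWeakDV.commutator (hf : IsWeakDY B u f) (hg : IsWeakDV a f g) (hv : IsWeakDV a u v)
    (hw : IsWeakDY B v w) : IsWeakDV (B.mulVec a) u (g - w) := by
  have h1 := IsWeak.comp hf hg (isTestOp_dV a)
  have h2 := (IsWeak.comp hv hw isTestOp_dY).smul_op (-1)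
  have h3 := IsWeak.add_op ?_ ?_ h1 h2
  · have e : g - w = g + (-1 : ℝ) • w := by simp [sub_eq_add_neg]
    rw [e]
    refine h3.congr_op fun φ hφ => ?_
    ext z
    rw [← dV_dY_sub hφ.1]
    have e1 : dY B (fun z => -fderiv ℝ φ z (0, a)) z
        = -dY B (fun z => fderiv ℝ φ z (0, a)) z := by
      simp [dY]
    have e2 : fderiv ℝ (fun z => -dY B φ z) z (0, a) = -fderiv ℝ (dY B φ) z (0, a) := by
      simp
    rw [e1, e2]
    ring
  · exact fun φ hφ => isTestOp_dY _ (isTestOp_dV a φ hφ)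
  · intro φ hφ
    have := (isTestOp_dV a _ (isTestOp_dY (B := B) φ hφ)).neg
    simpa using this

end

/-! ### Translations -/

section Translations

variable {p : ℝ≥0∞} {u : Pt d → ℝ} {a b : Coord d → ℝ}

lemma aestronglyMeasurable_trans (hu : AEStronglyMeasurable u volume) (a : Coord d → ℝ) :
    AEStronglyMeasurable (fun z => u (trans a z)) volume :=
  hu.comp_measurePreserving (measurePreserving_trans a)

lemma eLpNorm_trans (hu : AEStronglyMeasurable u volume) (a : Coord d → ℝ) :
    eLpNorm (fun z => u (trans a z)) p volume = eLpNorm u p volume :=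
  eLpNorm_comp_measurePreserving hu (measurePreserving_trans a)

lemma IsFlow.aestronglyMeasurable {Φ V} (hΦ : IsFlow Φ V) (hu : AEStronglyMeasurable u volume)
    (h : ℝ) : AEStronglyMeasurable (fun z => u (Φ h z)) volume :=
  hu.comp_measurePreserving (hΦ.measurePreserving h)

lemma IsFlow.eLpNorm_comp {Φ V} (hΦ : IsFlow Φ V) (hu : AEStronglyMeasurable u volume) (h : ℝ) :
    eLpNorm (fun z => u (Φ h z)) p volume = eLpNorm u p volume :=
  eLpNorm_comp_measurePreserving hu (hΦ.measurePreserving h)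

lemma eLpNorm_trans_add_sub_le (hp : 1 ≤ p) (hu : AEStronglyMeasurable u volume)
    (a b : Coord d → ℝ) :
    eLpNorm (fun z => u (trans (a + b) z) - u z) p volume ≤
      eLpNorm (fun z => u (trans a z) - u z) p volume +
        eLpNorm (fun z => u (trans b z) - u z) p volume := by
  have h1 : AEStronglyMeasurable (fun z => u (trans a z) - u z) volume :=
    (aestronglyMeasurable_trans hu a).sub hu
  have h2 : AEStronglyMeasurable (fun z => u (trans b z) - u z) volume :=
    (aestronglyMeasurable_trans hu b).sub hu
  rw [← eLpNorm_trans h1 b]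
  refine le_trans (le_of_eq ?_) (eLpNorm_add_le (aestronglyMeasurable_trans h1 b) h2 hp)
  congr 1
  ext z
  simp [trans_trans]

lemma eLpNorm_trans_sum_sub_le (hp : 1 ≤ p) (hu : AEStronglyMeasurable u volume) {ι : Type*}
    (s : Finset ι) (a : ι → Coord d → ℝ) :
    eLpNorm (fun z => u (trans (∑ i ∈ s, a i) z) - u z) p volume ≤
      ∑ i ∈ s, eLpNorm (fun z => u (trans (a i) z) - u z) p volume := by
  classical
  induction s using Finset.induction_on with
  | empty => simp [trans_zero]
  | insert j s hj ih =>
    rw [Finset.sum_insert hj, Finset.sum_insert hj]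
    exact (eLpNorm_trans_add_sub_le hp hu _ _).trans (by gcongr)

/-- A bound for small translations in a fixed direction gives one for larger translations. -/
lemma eLpNorm_trans_smul_sub_le (hp : 1 ≤ p) (hu : AEStronglyMeasurable u volume) {R : ℝ}
    {K : ℝ≥0∞} (h : ∀ c : ℝ, |c| ≤ R → eLpNorm (fun z => u (trans (c • a) z) - u z) p volume ≤ K)
    {N : ℕ} (hN : 0 < N) {c : ℝ} (hc : |c| ≤ N * R) :
    eLpNorm (fun z => u (trans (c • a) z) - u z) p volume ≤ N * K := by
  have hN' : (0 : ℝ) < N := by exact_mod_cast hN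
  have e : c • a = ∑ _i ∈ Finset.range N, (c / N) • a := by
    rw [Finset.sum_const, Finset.card_range, ← Nat.cast_smul_eq_nsmul ℝ, smul_smul]
    congr 1
    field_simp
  rw [e]
  refine (eLpNorm_trans_sum_sub_le hp hu _ _).trans ?_
  have : eLpNorm (fun z => u (trans ((c / N) • a) z) - u z) p volume ≤ K := by
    refine h _ ?_
    rw [abs_div, abs_of_pos hN', div_le_iff₀ hN']
    linarith
  calc _ ≤ ∑ _i ∈ Finset.range N, K := Finset.sum_le_sum fun _ _ => this
    _ = N * K := by simp

end Translations

end

/-! ### Regularity at a fixed scale -/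

section

variable {r : ℕ} {d : Fin (r + 1) → ℕ} {B : Matrix (Coord d) (Coord d) ℝ}

/-- `u` has intrinsic regularity of order `n` at the scale `ρ`, with constant `M`. The recursion is
the one of the Besov quasi-norm, with each quasi-norm along a vector field of weight `m` replaced by
a bound for the increments along its flow up to the time `ρ ^ m`. -/
def ScaleBound (B : Matrix (Coord d) (Coord d) ℝ) (p : ℝ≥0∞) (ρ : ℝ≥0) :
    ℕ → (Pt d → ℝ) → ℝ≥0∞ → Prop
  | 0, u, M => LocallyIntegrable u volume ∧
      (∀ (i : Fin (d 0)) (h : ℝ), |h| ≤ ρ →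
        eLpNorm (fun z => u (flowX ⟨0, i⟩ h z) - u z) p volume ≤ M) ∧
      ∀ h : ℝ, |h| ≤ (ρ : ℝ) ^ 2 → eLpNorm (fun z => u (flowY B h z) - u z) p volume ≤ M
  | 1, u, M => LocallyIntegrable u volume ∧
      (∀ i : Fin (d 0), ∃ v, IsWeakDX ⟨0, i⟩ u v ∧ ScaleBound B p ρ 0 v M) ∧
      ∀ h : ℝ, |h| ≤ (ρ : ℝ) ^ 2 → eLpNorm (fun z => u (flowY B h z) - u z) p volume ≤ ρ * M
  | n + 2, u, M => LocallyIntegrable u volume ∧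
      (∀ i : Fin (d 0), ∃ v, IsWeakDX ⟨0, i⟩ u v ∧ ScaleBound B p ρ (n + 1) v M) ∧
      ∃ v, IsWeakDY B u v ∧ ScaleBound B p ρ n v M

section ScaleBound

variable {p : ℝ≥0∞} {ρ : ℝ≥0} {n : ℕ} {u u' : Pt d → ℝ} {M M' : ℝ≥0∞}

lemma ScaleBound.locallyIntegrable (h : ScaleBound B p ρ n u M) :
    LocallyIntegrable u volume := by
  match n, h with
  | 0, h => exact h.1
  | 1, h => exact h.1
  | n + 2, h => exact h.1

lemma ScaleBound.aestronglyMeasurable (h : ScaleBound B p ρ n u M) :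
    AEStronglyMeasurable u volume := h.locallyIntegrable.aestronglyMeasurable

lemma ScaleBound.exists_dX (h : ScaleBound B p ρ (n + 1) u M) (i : Fin (d 0)) :
    ∃ v, IsWeakDX ⟨0, i⟩ u v ∧ ScaleBound B p ρ n v M := by
  match n, h with
  | 0, h => exact h.2.1 i
  | n + 1, h => exact h.2.1 i

lemma ScaleBound.exists_dY (h : ScaleBound B p ρ (n + 2) u M) :
    ∃ v, IsWeakDY B u v ∧ ScaleBound B p ρ n v M := h.2.2

lemma ScaleBound.mono (hM : M ≤ M') (h : ScaleBound B p ρ n u M) : ScaleBound B p ρ n u M' := by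
  induction n using Nat.twoStepInduction generalizing u with
  | zero => exact ⟨h.1, fun i t ht => (h.2.1 i t ht).trans hM, fun t ht => (h.2.2 t ht).trans hM⟩
  | one =>
    refine ⟨h.1, fun i => ?_, fun t ht => (h.2.2 t ht).trans (by gcongr)⟩
    obtain ⟨v, hv, hv'⟩ := h.2.1 i
    exact ⟨v, hv, hv'.1, fun i t ht => (hv'.2.1 i t ht).trans hM,
      fun t ht => (hv'.2.2 t ht).trans hM⟩
  | more n ih1 ih2 =>
    refine ⟨h.1, fun i => ?_, ?_⟩
    · obtain ⟨v, hv, hv'⟩ := h.2.1 i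
      exact ⟨v, hv, ih2 hv'⟩
    · obtain ⟨v, hv, hv'⟩ := h.2.2
      exact ⟨v, hv, ih1 hv'⟩

lemma eLpNorm_comp_sub_add_le (hp : 1 ≤ p) {Ψ : Pt d → Pt d}
    (hΨ : MeasurePreserving Ψ volume volume)
    (hu : AEStronglyMeasurable u volume) (hu' : AEStronglyMeasurable u' volume) :
    eLpNorm (fun z => (u + u') (Ψ z) - (u + u') z) p volume ≤
      eLpNorm (fun z => u (Ψ z) - u z) p volume + eLpNorm (fun z => u' (Ψ z) - u' z) p volume := by
  refine le_trans (le_of_eq ?_) (eLpNorm_add_le ((hu.comp_measurePreserving hΨ).sub hu)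
    ((hu'.comp_measurePreserving hΨ).sub hu') hp)
  congr 1
  ext z
  simp only [Pi.add_apply]
  ring

lemma eLpNorm_comp_sub_smul (Ψ : Pt d → Pt d) (c : ℝ) :
    eLpNorm (fun z => (c • u) (Ψ z) - (c • u) z) p volume =
      ‖c‖ₑ * eLpNorm (fun z => u (Ψ z) - u z) p volume := by
  rw [← eLpNorm_const_smul]
  congr 1
  ext z
  simp [mul_sub]

lemma IsWeakDX.add {j : Coord d} {v v' : Pt d → ℝ} (h : IsWeakDX j u v) (h' : IsWeakDX j u' v') :
    IsWeakDX j (u + u') (v + v') :=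
  IsWeak.add (isTestOp_dV _) h h'

lemma IsWeakDX.smul {j : Coord d} {v : Pt d → ℝ} (h : IsWeakDX j u v) (c : ℝ) :
    IsWeakDX j (c • u) (c • v) :=
  IsWeak.smul h c

lemma ScaleBound.add (hB : IsBlockMatrix d B) (hp : 1 ≤ p) (h : ScaleBound B p ρ n u M)
    (h' : ScaleBound B p ρ n u' M') : ScaleBound B p ρ n (u + u') (M + M') := by
  have H0 : ∀ {u u' : Pt d → ℝ}, ScaleBound B p ρ 0 u M → ScaleBound B p ρ 0 u' M' →
      ScaleBound B p ρ 0 (u + u') (M + M') := by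
    intro u u' h h'
    refine ⟨h.1.add h'.1, fun i t ht => ?_, fun t ht => ?_⟩
    · exact (eLpNorm_comp_sub_add_le hp ((isFlow_flowX _).measurePreserving t)
        h.1.aestronglyMeasurable h'.1.aestronglyMeasurable).trans
        (add_le_add (h.2.1 i t ht) (h'.2.1 i t ht))
    · exact (eLpNorm_comp_sub_add_le hp (hB.isFlow_flowY.measurePreserving t)
        h.1.aestronglyMeasurable h'.1.aestronglyMeasurable).trans
        (add_le_add (h.2.2 t ht) (h'.2.2 t ht))
  induction n using Nat.twoStepInduction generalizing u u' with
  | zero => exact H0 h h'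
  | one =>
    refine ⟨h.1.add h'.1, fun i => ?_, fun t ht => ?_⟩
    · obtain ⟨v, hv, hv1⟩ := h.2.1 i
      obtain ⟨v', hv', hv1'⟩ := h'.2.1 i
      exact ⟨v + v', hv.add hv', H0 hv1 hv1'⟩
    · rw [mul_add]
      exact (eLpNorm_comp_sub_add_le hp (hB.isFlow_flowY.measurePreserving t)
        h.1.aestronglyMeasurable h'.1.aestronglyMeasurable).trans
        (add_le_add (h.2.2 t ht) (h'.2.2 t ht))
  | more n ih1 ih2 =>
    refine ⟨h.1.add h'.1, fun i => ?_, ?_⟩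
    · obtain ⟨v, hv, hv1⟩ := h.2.1 i
      obtain ⟨v', hv', hv1'⟩ := h'.2.1 i
      exact ⟨v + v', hv.add hv', ih2 hv1 hv1'⟩
    · obtain ⟨v, hv, hv1⟩ := h.2.2
      obtain ⟨v', hv', hv1'⟩ := h'.2.2
      exact ⟨v + v', IsWeak.add isTestOp_dY hv hv', ih1 hv1 hv1'⟩

lemma ScaleBound.smul (h : ScaleBound B p ρ n u M) (c : ℝ) :
    ScaleBound B p ρ n (c • u) (‖c‖ₑ * M) := by
  have H0 : ∀ {u : Pt d → ℝ}, ScaleBound B p ρ 0 u M →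
      ScaleBound B p ρ 0 (c • u) (‖c‖ₑ * M) := by
    intro u h
    refine ⟨h.1.smul c, fun i t ht => ?_, fun t ht => ?_⟩
    · rw [eLpNorm_comp_sub_smul]
      gcongr
      exact h.2.1 i t ht
    · rw [eLpNorm_comp_sub_smul]
      gcongr
      exact h.2.2 t ht
  induction n using Nat.twoStepInduction generalizing u with
  | zero => exact H0 h
  | one =>
    refine ⟨h.1.smul c, fun i => ?_, fun t ht => ?_⟩
    · obtain ⟨v, hv, hv1⟩ := h.2.1 i
      exact ⟨c • v, hv.smul c, H0 hv1⟩
    · rw [eLpNorm_comp_sub_smul, mul_left_comm]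
      gcongr
      exact h.2.2 t ht
  | more n ih1 ih2 =>
    refine ⟨h.1.smul c, fun i => ?_, ?_⟩
    · obtain ⟨v, hv, hv1⟩ := h.2.1 i
      exact ⟨c • v, hv.smul c, ih2 hv1⟩
    · obtain ⟨v, hv, hv1⟩ := h.2.2
      exact ⟨c • v, IsWeak.smul hv c, ih1 hv1⟩

lemma scaleBound_zero : ScaleBound B p ρ n (0 : Pt d → ℝ) 0 := by
  have hw : ∀ A : (Pt d → ℝ) → Pt d → ℝ, IsWeak A (0 : Pt d → ℝ) 0 := fun A =>
    ⟨locallyIntegrable_zero, locallyIntegrable_zero, by simp⟩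
  have H0 : ScaleBound B p ρ 0 (0 : Pt d → ℝ) 0 := ⟨locallyIntegrable_zero, by simp, by simp⟩
  induction n using Nat.twoStepInduction with
  | zero => exact H0
  | one => exact ⟨locallyIntegrable_zero, fun i => ⟨0, hw _, H0⟩, by simp⟩
  | more n ih1 ih2 =>
    exact ⟨locallyIntegrable_zero, fun i => ⟨0, hw _, ih2⟩, 0, hw _, ih1⟩

lemma ScaleBound.sum (hB : IsBlockMatrix d B) (hp : 1 ≤ p) {ι : Type*} {s : Finset ι}
    {u : ι → Pt d → ℝ} {M : ι → ℝ≥0∞} (h : ∀ i ∈ s, ScaleBound B p ρ n (u i) (M i)) :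
    ScaleBound B p ρ n (∑ i ∈ s, u i) (∑ i ∈ s, M i) := by
  classical
  induction s using Finset.induction_on with
  | empty => exact scaleBound_zero
  | insert j s hj ih =>
    rw [Finset.sum_insert hj, Finset.sum_insert hj]
    exact (h j (Finset.mem_insert_self _ _)).add hB hp
      (ih fun i hi => h i (Finset.mem_insert_of_mem hi))

end ScaleBound

/-! ### Derivatives in the higher blocks -/

/-- By the rank condition, each coordinate direction of the block `k + 1` is a combination of
the images under `B` of the coordinate directions of the block `k`. -/
lemma IsBlockMatrix.exists_coeff (hB : IsBlockMatrix d B) (i : Coord d) {k : ℕ}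
    (hi : (i.1 : ℕ) = k + 1) :
    ∃ γ : Coord d → ℝ, (∀ j : Coord d, (j.1 : ℕ) ≠ k → γ j = 0) ∧
      ∑ j, γ j • B.mulVec (Pi.single j 1) = Pi.single i 1 := by
  obtain ⟨i1, i2⟩ := i
  have hk : k < r := by
    have := i1.2
    simp only at hi
    omega
  let kk : Fin r := ⟨k, hk⟩
  obtain rfl : i1 = kk.succ := Fin.ext hi
  set S := B.submatrix (fun a : Fin (d kk.succ) => (⟨kk.succ, a⟩ : Coord d))
      (fun b : Fin (d kk.castSucc) => (⟨kk.castSucc, b⟩ : Coord d)) with hS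
  have hrank : S.rank = d kk.succ := hB.rank_block kk
  have hsurj : Function.Surjective S.mulVecLin := by
    rw [← LinearMap.range_eq_top]
    apply Submodule.eq_top_of_finrank_eq
    rw [Module.finrank_fin_fun]
    exact hrank
  obtain ⟨y, hy⟩ := hsurj (Pi.single i2 1)
  let γ : Coord d → ℝ := fun j => if h : j.1 = kk.castSucc then y (h ▸ j.2) else 0
  refine ⟨γ, fun j hj => ?_, ?_⟩
  · simp only [γ]
    rw [dif_neg]
    intro h
    exact hj (by rw [h]; rfl)
  · have hsum : ∀ f : Coord d → ℝ, (∑ j, γ j * f j) = ∑ b, y b * f ⟨kk.castSucc, b⟩ := by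
      intro f
      rw [Fintype.sum_sigma, Finset.sum_eq_single kk.castSucc]
      · simp [γ]
      · intro b _ hb
        simp [γ, hb]
      · simp
    ext a
    simp only [Finset.sum_apply, Pi.smul_apply, smul_eq_mul, Matrix.mulVec_single_one,
      Matrix.col_apply]
    rw [hsum]
    obtain ⟨a1, a2⟩ := a
    by_cases ha : a1 = kk.succ
    · subst ha
      have := congrFun hy a2
      simp only [Matrix.mulVecLin_apply, Matrix.mulVec, dotProduct, hS,
        Matrix.submatrix_apply] at this
      simp_rw [mul_comm (y _)]
      rw [this]
      simp [Pi.single_apply]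
    · rw [Pi.single_apply, if_neg (by intro h; exact ha (by rw [Sigma.mk.injEq] at h; exact h.1))]
      refine Finset.sum_eq_zero fun b _ => ?_
      rw [hB.zero_block, mul_zero]
      intro h
      exact ha (Fin.ext h)

lemma IsBlockMatrix.exists_coeff_matrix (hB : IsBlockMatrix d B) (k : ℕ) :
    ∃ γ : Coord d → Coord d → ℝ, ∀ i : Coord d, (i.1 : ℕ) = k + 1 →
      (∀ j : Coord d, (j.1 : ℕ) ≠ k → γ i j = 0) ∧
      ∑ j, γ i j • B.mulVec (Pi.single j 1) = Pi.single i 1 := by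
  have hγ : ∀ i : Coord d, ∃ γ : Coord d → ℝ, (i.1 : ℕ) = k + 1 →
      (∀ j : Coord d, (j.1 : ℕ) ≠ k → γ j = 0) ∧
      ∑ j, γ j • B.mulVec (Pi.single j 1) = Pi.single i 1 := by
    intro i
    by_cases hi : (i.1 : ℕ) = k + 1
    · obtain ⟨γ, hγ⟩ := hB.exists_coeff i hi
      exact ⟨γ, fun _ => hγ⟩
    · exact ⟨0, fun h => absurd h hi⟩
  choose γ hγ using hγ
  exact ⟨γ, hγ⟩

/-- Regularity of order `n` controls the weak derivatives in the directions of the block `k`, which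
have the weight `2k + 1`: those in the block `k + 1` are commutators of `Y` and those in the
block `k`. -/
lemma ScaleBound.exists_weakDX (hB : IsBlockMatrix d B) {p : ℝ≥0∞} (hp : 1 ≤ p) (k : ℕ) :
    ∃ C : ℝ≥0, ∀ (n : ℕ), 2 * k + 1 ≤ n → ∀ (ρ : ℝ≥0) (u : Pt d → ℝ) (M : ℝ≥0∞),
      ScaleBound B p ρ n u M → ∀ j : Coord d, (j.1 : ℕ) = k →
        ∃ v, IsWeakDX j u v ∧ ScaleBound B p ρ (n - (2 * k + 1)) v (C * M) := by
  induction k with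
  | zero =>
    refine ⟨1, fun n hn ρ u M h j hj => ?_⟩
    obtain ⟨j1, j2⟩ := j
    obtain rfl : j1 = 0 := Fin.ext hj
    obtain ⟨m, rfl⟩ : ∃ m, n = m + 1 := ⟨n - 1, by omega⟩
    simpa using h.exists_dX j2
  | succ k ih =>
    obtain ⟨C, hC⟩ := ih
    obtain ⟨γ, hγ⟩ := hB.exists_coeff_matrix k
    refine ⟨∑ i, ∑ j, ‖γ i j‖₊ * (C + C), fun n hn ρ u M h i hi => ?_⟩
    obtain ⟨hγ1, hγ2⟩ := hγ i hi
    have key : ∀ j : Coord d, ∃ v, IsWeakDV (γ i j • B.mulVec (Pi.single j 1)) u v ∧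
        ScaleBound B p ρ (n - (2 * (k + 1) + 1)) v (‖γ i j‖ₑ * (C * M + C * M)) := by
      intro j
      by_cases hj : (j.1 : ℕ) = k
      · obtain ⟨m, rfl⟩ : ∃ m, n = m + 2 := ⟨n - 2, by omega⟩
        obtain ⟨f, hf, hf'⟩ := h.exists_dY
        obtain ⟨g, hg, hg'⟩ := hC m (by omega) ρ f M hf' j hj
        obtain ⟨v, hv, hv'⟩ := hC (m + 2) (by omega) ρ u M h j hj
        obtain ⟨l, hl⟩ : ∃ l, m + 2 - (2 * k + 1) = l + 2 := ⟨m + 2 - (2 * k + 1) - 2, by omega⟩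
        rw [hl] at hv'
        obtain ⟨w, hw, hw'⟩ := hv'.exists_dY
        have e1 : m - (2 * k + 1) = l := by omega
        have e2 : m + 2 - (2 * (k + 1) + 1) = l := by omega
        rw [e1] at hg'
        refine ⟨γ i j • (g - w), (IsWeakDV.commutator hf hg hv hw).smul_dir _, ?_⟩
        rw [e2]
        refine ScaleBound.smul ?_ _
        have e3 : g - w = g + (-1 : ℝ) • w := by simp [sub_eq_add_neg]
        rw [e3]
        refine hg'.add hB hp ?_
        simpa using hw'.smul (-1)
      · refine ⟨0, ?_, ?_⟩
        · rw [hγ1 j hj, zero_smul]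
          exact isWeakDV_zero h.locallyIntegrable
        · exact scaleBound_zero.mono zero_le
    choose v hv hv' using key
    refine ⟨∑ j, v j, ?_, ?_⟩
    · have := IsWeakDV.sum (s := Finset.univ) h.locallyIntegrable fun j _ => hv j
      rw [hγ2] at this
      exact this
    · refine (ScaleBound.sum hB hp (s := Finset.univ) fun j _ => hv' j).mono ?_
      have h1 : (∑ j, ‖γ i j‖ₑ * (C * M + C * M)) = ((∑ j, ‖γ i j‖₊ * (C + C) : ℝ≥0) : ℝ≥0∞) * M := by
        push_cast
        rw [Finset.sum_mul]
        refine Finset.sum_congr rfl fun j _ => ?_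
        rw [← enorm_eq_nnnorm]
        ring
      have h2 := Finset.single_le_sum (f := fun i => ∑ j, ‖γ i j‖₊ * (C + C))
        (fun _ _ => zero_le) (Finset.mem_univ i)
      rw [h1]
      exact mul_le_mul' (by exact_mod_cast h2) le_rfl

end

/-! ### Taylor expansion along one flow -/

section

variable {r : ℕ} {d : Fin (r + 1) → ℕ} {B : Matrix (Coord d) (Coord d) ℝ}

section Flow

variable {Φ : ℝ → Pt d → Pt d} {V : Pt d → Pt d} {u v : Pt d → ℝ} {p : ℝ≥0∞}

lemma IsFlow.integrable_slice (hΦ : IsFlow Φ V) (hv : LocallyIntegrable v volume) (a : ℝ) :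
    ∀ᵐ z, Integrable (fun θ => v (Φ (a * θ) z)) unitMeasure := by
  rw [← Measure.restrict_univ (μ := (volume : Measure (Pt d))), ← iUnion_compactCovering,
    ae_restrict_iUnion_iff]
  exact fun n => (hΦ.integrableOn_shear hv a (isCompact_compactCovering _ n)).prod_left_ae

lemma IsFlow.aestronglyMeasurable_shear (hΦ : IsFlow Φ V) (hv : AEStronglyMeasurable v volume)
    (a : ℝ) : AEStronglyMeasurable (fun w : ℝ × Pt d => v (Φ (a * w.1) w.2))
      (unitMeasure.prod volume) :=
  (hv.comp_snd (μ := unitMeasure)).comp_measurePreserving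
    (hΦ.measurePreserving_shear a unitMeasure)

lemma integral_unitMeasure_pow (l : ℕ) : ∫ θ, θ ^ l ∂unitMeasure = 1 / ((l : ℝ) + 1) := by
  rw [integral_Icc_eq_integral_Ioc, ← intervalIntegral.integral_of_le zero_le_one]
  simp [integral_pow]

/-- Integrating an expansion of the derivative `v` of `u` along a flow gives an expansion of `u`
with one more term. -/
lemma IsFlow.eLpNorm_taylor_succ_le (hΦ : IsFlow Φ V) (hp : 1 ≤ p)
    (h : IsWeak (fun φ z => -alongField V φ z) u v) (N : ℕ) {w : ℕ → Pt d → ℝ}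
    (hw : ∀ l < N, AEStronglyMeasurable (w l) volume) (a : ℝ) {K : ℝ≥0∞}
    (hK : ∀ θ ∈ Icc (0 : ℝ) 1, eLpNorm (fun z => v (Φ (a * θ) z) -
      ∑ l ∈ Finset.range N, (a * θ) ^ l / (l.factorial : ℝ) * w l z) p volume ≤ K) :
    eLpNorm (fun z => u (Φ a z) - (u z +
      ∑ l ∈ Finset.range N, a ^ (l + 1) / ((l + 1).factorial : ℝ) * w l z)) p volume
      ≤ ‖a‖ₑ * K := by
  set F : ℝ → Pt d → ℝ := fun θ z => v (Φ (a * θ) z) -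
      ∑ l ∈ Finset.range N, (a * θ) ^ l / (l.factorial : ℝ) * w l z with hF
  have hFm : AEStronglyMeasurable (Function.uncurry F) (unitMeasure.prod volume) := by
    refine (hΦ.aestronglyMeasurable_shear h.2.1.aestronglyMeasurable a).sub ?_
    refine Finset.aestronglyMeasurable_fun_sum _ fun l hl => ?_
    refine AEStronglyMeasurable.mul (Continuous.aestronglyMeasurable (by fun_prop)) ?_
    exact (hw l (Finset.mem_range.1 hl)).comp_snd
  have hle := eLpNorm_average_le (K := K) hFm hp (by
    filter_upwards [ae_restrict_mem measurableSet_Icc] with θ hθ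
    exact hK θ hθ)
  have heq : (fun z => u (Φ a z) - (u z +
      ∑ l ∈ Finset.range N, a ^ (l + 1) / ((l + 1).factorial : ℝ) * w l z)) =ᵐ[volume]
      a • (fun z => ∫ θ, F θ z ∂unitMeasure) := by
    filter_upwards [hΦ.sub_eq_average h a, hΦ.integrable_slice h.2.1 a] with z hz hzi
    have hi : ∀ l, Integrable (fun θ : ℝ => (a * θ) ^ l / (l.factorial : ℝ) * w l z)
        unitMeasure := fun l =>
      (Continuous.integrableOn_Icc (by fun_prop))
    rw [Pi.smul_apply, smul_eq_mul, integral_sub hzi (integrable_finsetSum _ fun l _ => hi l),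
      integral_finsetSum _ fun l _ => hi l, mul_sub, ← hz, Finset.mul_sum, ← sub_sub]
    congr 1
    refine Finset.sum_congr rfl fun l _ => ?_
    have e : (fun θ : ℝ => (a * θ) ^ l / (l.factorial : ℝ) * w l z) =
        fun θ => (a ^ l / (l.factorial : ℝ) * w l z) * θ ^ l := by
      ext θ
      rw [mul_pow]
      ring
    rw [e, integral_const_mul, integral_unitMeasure_pow, Nat.factorial_succ]
    have : (l : ℝ) + 1 ≠ 0 := by positivity
    push_cast
    field_simp
    ring
  rw [eLpNorm_congr_ae heq, eLpNorm_const_smul]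
  gcongr

end Flow

section Taylor

variable {p : ℝ≥0∞}

lemma enorm_le_pow {a : ℝ} {ρ : ℝ≥0} {m : ℕ} (ha : |a| ≤ (ρ : ℝ) ^ m) :
    ‖a‖ₑ ≤ (ρ : ℝ≥0∞) ^ m := by
  rw [Real.enorm_eq_ofReal_abs]
  refine (ENNReal.ofReal_le_ofReal ha).trans ?_
  rw [ENNReal.ofReal_pow ρ.coe_nonneg, ENNReal.ofReal_coe_nnreal]

lemma abs_mul_le_of_mem_Icc {a θ R : ℝ} (ha : |a| ≤ R) (hθ : θ ∈ Icc (0 : ℝ) 1) :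
    |a * θ| ≤ R := by
  rw [abs_mul, abs_of_nonneg hθ.1]
  exact (mul_le_of_le_one_right (abs_nonneg a) hθ.2).trans ha

/-- The Taylor expansion along `Y`. -/
lemma ScaleBound.taylorY (hB : IsBlockMatrix d B) (hp : 1 ≤ p) {ρ : ℝ≥0} {M : ℝ≥0∞} (m : ℕ) :
    ∀ u : Pt d → ℝ, ScaleBound B p ρ m u M →
    ∃ w : ℕ → Pt d → ℝ, w 0 = u ∧ (∀ l, 2 * (l + 1) ≤ m → IsWeakDY B (w l) (w (l + 1))) ∧
      (∀ l, 2 * l ≤ m → ScaleBound B p ρ (m - 2 * l) (w l) M) ∧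
      ∀ h : ℝ, |h| ≤ (ρ : ℝ) ^ 2 → eLpNorm (fun z => u (flowY B h z) -
        ∑ l ∈ Finset.range (m / 2 + 1), h ^ l / (l.factorial : ℝ) * w l z) p volume
        ≤ (ρ : ℝ≥0∞) ^ m * M := by
  induction m using Nat.twoStepInduction with
  | zero =>
    intro u hu
    refine ⟨fun _ => u, rfl, fun l hl => by omega, fun l hl => ?_, fun h hh => ?_⟩
    · obtain rfl : l = 0 := by omega
      exact hu
    · simpa using hu.2.2 h hh
  | one =>
    intro u hu
    refine ⟨fun _ => u, rfl, fun l hl => by omega, fun l hl => ?_, fun h hh => ?_⟩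
    · obtain rfl : l = 0 := by omega
      exact hu
    · simpa using hu.2.2 h hh
  | more m ih _ =>
    intro u hu
    obtain ⟨v, hv, hv'⟩ := hu.exists_dY
    obtain ⟨w, hw0, hw1, hw2, hw3⟩ := ih v hv'
    refine ⟨fun l => Nat.casesOn l u w, rfl, fun l hl => ?_, fun l hl => ?_, fun h hh => ?_⟩
    · cases l with
      | zero => simpa [hw0] using hv
      | succ l => exact hw1 l (by omega)
    · cases l with
      | zero => exact hu
      | succ l =>
        have e : m + 2 - 2 * (l + 1) = m - 2 * l := by omega
        rw [e]
        exact hw2 l (by omega)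
    · have e : (m + 2) / 2 + 1 = (m / 2 + 1) + 1 := by omega
      have key := hB.isFlow_flowY.eLpNorm_taylor_succ_le hp hv (m / 2 + 1) (w := w)
        (fun l hl => (hw2 l (by omega)).aestronglyMeasurable) h
        (fun θ hθ => hw3 (h * θ) (abs_mul_le_of_mem_Icc hh hθ))
      rw [e]
      refine le_trans (le_of_eq ?_) (key.trans ?_)
      · congr 1
        ext z
        rw [Finset.sum_range_succ', add_comm (u z)]
        simp
      refine (mul_le_mul' (enorm_le_pow hh) le_rfl).trans (le_of_eq ?_)
      ring

/-- Regularity of order `m` controls the increments in the directions of the block `k`. -/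
def IncrementBound (B : Matrix (Coord d) (Coord d) ℝ) (p : ℝ≥0∞) (k m : ℕ) : Prop :=
  ∃ C : ℝ≥0, ∀ (ρ : ℝ≥0) (u : Pt d → ℝ) (M : ℝ≥0∞), ScaleBound B p ρ m u M →
    ∀ j : Coord d, (j.1 : ℕ) = k → ∀ a : ℝ, |a| ≤ (ρ : ℝ) ^ (2 * k + 1) →
      eLpNorm (fun z => u (flowX j a z) - u z) p volume ≤ C * ((ρ : ℝ≥0∞) ^ m * M)

/-- The Taylor expansion in a coordinate direction of the block `k`, given the bounds for the
increments of functions of order less than the weight `2k + 1` of that direction. -/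
lemma ScaleBound.taylorX (hB : IsBlockMatrix d B) (hp : 1 ≤ p) {k : ℕ}
    (hk : ∀ m ≤ 2 * k, IncrementBound B p k m) (m : ℕ) :
    ∃ C : ℝ≥0, ∀ (ρ : ℝ≥0) (u : Pt d → ℝ) (M : ℝ≥0∞), ScaleBound B p ρ m u M →
      ∀ j : Coord d, (j.1 : ℕ) = k →
    ∃ w : ℕ → Pt d → ℝ, w 0 = u ∧
      (∀ l, (2 * k + 1) * (l + 1) ≤ m → IsWeakDX j (w l) (w (l + 1))) ∧
      (∀ l, (2 * k + 1) * l ≤ m → ScaleBound B p ρ (m - (2 * k + 1) * l) (w l) (C * M)) ∧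
      ∀ a : ℝ, |a| ≤ (ρ : ℝ) ^ (2 * k + 1) → eLpNorm (fun z => u (flowX j a z) -
        ∑ l ∈ Finset.range (m / (2 * k + 1) + 1), a ^ l / (l.factorial : ℝ) * w l z) p volume
        ≤ C * ((ρ : ℝ≥0∞) ^ m * M) := by
  induction m using Nat.strong_induction_on with
  | _ m ih =>
  by_cases hm : m ≤ 2 * k
  · obtain ⟨C, hC⟩ := hk m hm
    refine ⟨C + 1, fun ρ u M hu j hj => ⟨fun _ => u, rfl, fun l hl => ?_, fun l hl => ?_,
      fun a ha => ?_⟩⟩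
    · have := Nat.le_mul_of_pos_right (2 * k + 1) (Nat.succ_pos l)
      exact absurd (this.trans hl) (by omega)
    · obtain rfl : l = 0 := by
        by_contra h0
        have := Nat.le_mul_of_pos_right (2 * k + 1) (Nat.pos_of_ne_zero h0)
        omega
      refine ScaleBound.mono ?_ hu
      push_cast
      rw [add_mul, one_mul]
      exact le_add_self
    · have e : m / (2 * k + 1) = 0 := Nat.div_eq_of_lt (by omega)
      rw [e]
      refine le_trans ?_ ((hC ρ u M hu j hj a ha).trans ?_)
      · simp
      · gcongr
        exact le_self_add
  · obtain ⟨m, rfl⟩ : ∃ m', m = m' + (2 * k + 1) := ⟨m - (2 * k + 1), by omega⟩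
    obtain ⟨C, hC⟩ := ih m (by omega)
    obtain ⟨C₁, hC₁⟩ := ScaleBound.exists_weakDX (B := B) hB hp k
    refine ⟨C * C₁ + 1, fun ρ u M hu j hj => ?_⟩
    obtain ⟨v, hv, hv'⟩ := hC₁ _ (by omega) ρ u M hu j hj
    rw [Nat.add_sub_cancel] at hv'
    obtain ⟨w, hw0, hw1, hw2, hw3⟩ := hC ρ v _ hv' j hj
    have hCM : ∀ t : ℝ≥0∞, C * (t * (C₁ * M)) ≤ ((C * C₁ + 1 : ℝ≥0) : ℝ≥0∞) * (t * M) := by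
      intro t
      push_cast
      rw [add_mul]
      refine le_trans (le_of_eq ?_) le_self_add
      ring
    refine ⟨fun l => Nat.casesOn l u w, rfl, fun l hl => ?_, fun l hl => ?_, fun a ha => ?_⟩
    · cases l with
      | zero => simpa [hw0] using hv
      | succ l => exact hw1 l (by rw [mul_add] at hl; omega)
    · cases l with
      | zero =>
        refine ScaleBound.mono ?_ hu
        push_cast
        rw [add_mul, one_mul]
        exact le_add_self
      | succ l =>
        have e : m + (2 * k + 1) - (2 * k + 1) * (l + 1) = m - (2 * k + 1) * l := by
          rw [mul_add]
          omega
        rw [e]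
        refine (hw2 l (by rw [mul_add] at hl; omega)).mono ?_
        simpa using hCM 1
    · have e : (m + (2 * k + 1)) / (2 * k + 1) + 1 = (m / (2 * k + 1) + 1) + 1 := by
        rw [Nat.add_div_right _ (by omega)]
      have key := (isFlow_flowX j).eLpNorm_taylor_succ_le hp hv (m / (2 * k + 1) + 1) (w := w)
        (fun l hl => (hw2 l (by
          have := Nat.mul_le_of_le_div (2 * k + 1) l m (by omega)
          rwa [mul_comm] at this)).aestronglyMeasurable) a
        (fun θ hθ => hw3 (a * θ) (abs_mul_le_of_mem_Icc ha hθ))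
      rw [e]
      refine le_trans (le_of_eq ?_) (key.trans ?_)
      · congr 1
        ext z
        rw [Finset.sum_range_succ', add_comm (u z)]
        simp
      refine le_trans ?_ (hCM _)
      refine (mul_le_mul' (enorm_le_pow ha) le_rfl).trans (le_of_eq ?_)
      ring

end Taylor

end

/-! ### Increments in the higher blocks -/

section

variable {r : ℕ} {d : Fin (r + 1) → ℕ} {B : Matrix (Coord d) (Coord d) ℝ} {p : ℝ≥0∞}

lemma IsBlockMatrix.expB_apply (hB : IsBlockMatrix d B) (t : ℝ) (x : Coord d → ℝ) (i : Coord d) :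
    expB B t x i = ∑ l ∈ Finset.range (r + 1), ∑ j, t ^ l / (l.factorial : ℝ) *
      ((B ^ l) i j * x j) := by
  rw [hB.expB_eq_sum]
  simp [Finset.sum_apply, Matrix.mulVec, dotProduct, Finset.mul_sum]

lemma IsBlockMatrix.expB_apply_eq_zero (hB : IsBlockMatrix d B) (t : ℝ) {x : Coord d → ℝ} {k : ℕ}
    (hx : ∀ j : Coord d, (j.1 : ℕ) < k → x j = 0) (i : Coord d) (hi : (i.1 : ℕ) < k) :
    expB B t x i = 0 := by
  rw [hB.expB_apply]
  refine Finset.sum_eq_zero fun l _ => Finset.sum_eq_zero fun j _ => ?_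
  by_cases h : (i.1 : ℕ) = (j.1 : ℕ) + l
  · rw [hx j (by omega)]
    ring
  · rw [hB.pow_apply_eq_zero l i j h]
    ring

/-- `e^{tB}` respects the homogeneous boxes. -/
lemma IsBlockMatrix.exists_abs_expB_le (hB : IsBlockMatrix d B) :
    ∃ A : ℕ, ∀ (ρ : ℝ≥0) (t : ℝ), |t| ≤ (ρ : ℝ) ^ 2 → ∀ x : Coord d → ℝ,
      (∀ j : Coord d, |x j| ≤ (ρ : ℝ) ^ (2 * (j.1 : ℕ) + 1)) →
      ∀ i : Coord d, |expB B t x i| ≤ A * (ρ : ℝ) ^ (2 * (i.1 : ℕ) + 1) := by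
  obtain ⟨A, hA⟩ := exists_nat_ge (∑ i : Coord d, ∑ l ∈ Finset.range (r + 1), ∑ j, |(B ^ l) i j|)
  refine ⟨A, fun ρ t ht x hx i => ?_⟩
  have h1 : |expB B t x i| ≤ ∑ l ∈ Finset.range (r + 1), ∑ j, |(B ^ l) i j| *
      (ρ : ℝ) ^ (2 * (i.1 : ℕ) + 1) := by
    rw [hB.expB_apply]
    refine (Finset.abs_sum_le_sum_abs _ _).trans (Finset.sum_le_sum fun l _ => ?_)
    refine (Finset.abs_sum_le_sum_abs _ _).trans (Finset.sum_le_sum fun j _ => ?_)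
    by_cases h : (i.1 : ℕ) = (j.1 : ℕ) + l
    · have e : (ρ : ℝ) ^ (2 * (i.1 : ℕ) + 1) = ((ρ : ℝ) ^ 2) ^ l * (ρ : ℝ) ^ (2 * (j.1 : ℕ) + 1) := by
        rw [← pow_mul, ← pow_add, h]
        congr 1
        ring
      rw [abs_mul, abs_mul, e, mul_left_comm]
      refine mul_le_mul_of_nonneg_left ?_ (abs_nonneg _)
      refine mul_le_mul ?_ (hx j) (abs_nonneg _) (by positivity)
      rw [abs_div, abs_pow, Nat.abs_cast]
      refine (div_le_self (by positivity) ?_).trans (by gcongr)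
      exact_mod_cast Nat.one_le_iff_ne_zero.2 (Nat.factorial_ne_zero l)
    · rw [hB.pow_apply_eq_zero l i j h]
      simp
  refine h1.trans ?_
  simp_rw [← Finset.sum_mul]
  refine mul_le_mul_of_nonneg_right (le_trans ?_ hA) (by positivity)
  exact Finset.single_le_sum (f := fun i => ∑ l ∈ Finset.range (r + 1), ∑ j, |(B ^ l) i j|)
    (fun i _ => by positivity) (Finset.mem_univ i)

lemma eLpNorm_comp_sub_le_two_mul (hp : 1 ≤ p) {Ψ : Pt d → Pt d}
    (hΨ : MeasurePreserving Ψ volume volume) {u : Pt d → ℝ} (hu : AEStronglyMeasurable u volume) :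
    eLpNorm (fun z => u (Ψ z) - u z) p volume ≤ 2 * eLpNorm u p volume := by
  refine (eLpNorm_sub_le (hu.comp_measurePreserving hΨ) hu hp).trans (le_of_eq ?_)
  rw [eLpNorm_comp_measurePreserving hu hΨ, two_mul]

/-- Bounds for the increments in coordinate directions add up. -/
lemma exists_increment_vector_le (hp : 1 ≤ p) {m k : ℕ}
    (h : ∀ i, k ≤ i → IncrementBound B p i m) (A : ℕ) :
    ∃ C : ℝ≥0, ∀ (ρ : ℝ≥0) (u : Pt d → ℝ) (M : ℝ≥0∞), ScaleBound B p ρ m u M →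
      ∀ v : Coord d → ℝ, (∀ j : Coord d, |v j| ≤ A * (ρ : ℝ) ^ (2 * (j.1 : ℕ) + 1)) →
      (∀ j : Coord d, (j.1 : ℕ) < k → v j = 0) →
      eLpNorm (fun z => u (trans v z) - u z) p volume ≤ C * ((ρ : ℝ≥0∞) ^ m * M) := by
  have h' : ∀ i, ∃ C : ℝ≥0, k ≤ i → ∀ (ρ : ℝ≥0) (u : Pt d → ℝ) (M : ℝ≥0∞),
      ScaleBound B p ρ m u M → ∀ j : Coord d, (j.1 : ℕ) = i → ∀ a : ℝ,
      |a| ≤ (ρ : ℝ) ^ (2 * i + 1) →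
      eLpNorm (fun z => u (flowX j a z) - u z) p volume ≤ C * ((ρ : ℝ≥0∞) ^ m * M) := by
    intro i
    by_cases hi : k ≤ i
    · obtain ⟨C, hC⟩ := h i hi
      exact ⟨C, fun _ => hC⟩
    · exact ⟨0, fun h => absurd h hi⟩
  choose C hC using h'
  refine ⟨∑ j : Coord d, (A + 1 : ℕ) * C j.1, fun ρ u M hu v hv hv0 => ?_⟩
  have e : v = ∑ j, v j • Pi.single j (1 : ℝ) := by
    ext i
    simp [Finset.sum_apply, Pi.single_apply]
  rw [e]
  refine (eLpNorm_trans_sum_sub_le hp hu.aestronglyMeasurable _ _).trans ?_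
  rw [ENNReal.ofNNReal_finsetSum, Finset.sum_mul]
  refine Finset.sum_le_sum fun j _ => ?_
  by_cases hj : k ≤ (j.1 : ℕ)
  · refine (eLpNorm_trans_smul_sub_le hp hu.aestronglyMeasurable (R := (ρ : ℝ) ^ (2 * (j.1 : ℕ) + 1))
      (fun c hc => hC _ hj ρ u M hu j rfl c hc) (Nat.succ_pos A) ?_).trans (le_of_eq ?_)
    · refine (hv j).trans ?_
      gcongr
      exact Nat.le_succ A
    · push_cast
      ring
  · rw [hv0 j (by omega)]
    simp [trans_zero]

/-- The increment along `e^{hB} b - b` is a commutator of the increments along `b` and along `Y`. -/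
lemma eLpNorm_trans_expB_sub_le (hB : IsBlockMatrix d B) (hp : 1 ≤ p) {u : Pt d → ℝ}
    (hu : AEStronglyMeasurable u volume) (h : ℝ) (b : Coord d → ℝ) :
    eLpNorm (fun z => u (trans (expB B h b - b) z) - u z) p volume ≤
      eLpNorm (fun z => (u (flowY B h (trans b z)) - u (trans b z)) - (u (flowY B h z) - u z))
        p volume +
      eLpNorm (fun z => (u (trans b (flowY B h z)) - u (flowY B h z)) - (u (trans b z) - u z))
        p volume := by
  have hY := hB.isFlow_flowY
  have h1 : AEStronglyMeasurable (fun z => u (trans (expB B h b - b) z) - u z) volume :=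
    (aestronglyMeasurable_trans hu _).sub hu
  have h2 := aestronglyMeasurable_trans h1 b
  rw [← eLpNorm_trans h1 b, ← hY.eLpNorm_comp h2 h]
  have h3 := hY.aestronglyMeasurable hu h
  refine le_trans (le_of_eq ?_) (eLpNorm_sub_le ?_ ?_ hp)
  · congr 1
    ext z
    simp only [Pi.sub_apply, trans_trans, sub_add_cancel, trans_expB_flowY]
    ring
  · exact ((aestronglyMeasurable_trans h3 b).sub (aestronglyMeasurable_trans hu b)).sub
      (h3.sub hu)
  · exact ((hY.aestronglyMeasurable (aestronglyMeasurable_trans hu b) h).sub h3).sub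
      ((aestronglyMeasurable_trans hu b).sub hu)

lemma ScaleBound.increment_flowY {m : ℕ} (hm : m ≤ 1) {ρ : ℝ≥0} {u : Pt d → ℝ} {M : ℝ≥0∞}
    (hu : ScaleBound B p ρ m u M) {h : ℝ} (hh : |h| ≤ (ρ : ℝ) ^ 2) :
    eLpNorm (fun z => u (flowY B h z) - u z) p volume ≤ (ρ : ℝ≥0∞) ^ m * M := by
  interval_cases m
  · simpa using hu.2.2 h hh
  · simpa using hu.2.2 h hh

lemma abs_smul_single_le {ρ : ℝ≥0} {β : ℝ} {j : Coord d}
    (hβ : |β| ≤ (ρ : ℝ) ^ (2 * (j.1 : ℕ) + 1)) (i : Coord d) :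
    |(β • Pi.single j (1 : ℝ) : Coord d → ℝ) i| ≤ (ρ : ℝ) ^ (2 * (i.1 : ℕ) + 1) := by
  by_cases h : i = j
  · subst h
    simpa using hβ
  · simp [h]

/-- The part of the commutator in which `Y` is integrated first. -/
lemma exists_trans_increment_flowY_le (hB : IsBlockMatrix d B) (hp : 1 ≤ p) {k m : ℕ}
    (hm : m ≤ 2 * k + 2)
    (ih : ∀ m' < m, ∀ i, m' ≤ 2 * i → IncrementBound B p i m') :
    ∃ C : ℝ≥0, ∀ (ρ : ℝ≥0) (u : Pt d → ℝ) (M : ℝ≥0∞), ScaleBound B p ρ m u M →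
      ∀ j : Coord d, (j.1 : ℕ) = k → ∀ β : ℝ, |β| ≤ (ρ : ℝ) ^ (2 * k + 1) →
      ∀ h : ℝ, |h| ≤ (ρ : ℝ) ^ 2 →
      eLpNorm (fun z => (u (flowY B h (trans (β • Pi.single j 1) z)) -
        u (trans (β • Pi.single j 1) z)) - (u (flowY B h z) - u z)) p volume
        ≤ C * ((ρ : ℝ≥0∞) ^ m * M) := by
  have hY := hB.isFlow_flowY
  by_cases hm1 : m ≤ 1
  · refine ⟨2, fun ρ u M hu j hj β hβ h hh => ?_⟩
    have h1 : AEStronglyMeasurable (fun z => u (flowY B h z) - u z) volume :=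
      (hY.aestronglyMeasurable hu.aestronglyMeasurable h).sub hu.aestronglyMeasurable
    refine (eLpNorm_comp_sub_le_two_mul hp (measurePreserving_trans _) h1).trans ?_
    exact mul_le_mul' le_rfl (hu.increment_flowY hm1 hh)
  · obtain ⟨m, rfl⟩ : ∃ m', m = m' + 2 := ⟨m - 2, by omega⟩
    obtain ⟨A, hA⟩ := hB.exists_abs_expB_le
    obtain ⟨C, hC⟩ := exists_increment_vector_le (B := B) (m := m) (k := k) hp
      (fun i hi => ih m (by omega) i (by omega)) A
    refine ⟨C, fun ρ u M hu j hj β hβ h hh => ?_⟩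
    obtain ⟨f, hf, hf'⟩ := hu.exists_dY
    set b : Coord d → ℝ := β • Pi.single j 1 with hb
    subst hj
    have hfm := hf'.aestronglyMeasurable
    set F : ℝ → Pt d → ℝ := fun θ z => f (flowY B (h * θ) (trans b z)) - f (flowY B (h * θ) z)
    have hFm : AEStronglyMeasurable (Function.uncurry F) (unitMeasure.prod volume) := by
      have h1 := hY.aestronglyMeasurable_shear hfm h
      have h2 : MeasurePreserving (Prod.map id (trans b)) (unitMeasure.prod (volume : Measure (Pt d)))
          (unitMeasure.prod volume) :=
        (MeasurePreserving.id _).prod (measurePreserving_trans b)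
      exact (h1.comp_measurePreserving h2).sub h1
    have hFle : ∀ θ ∈ Icc (0 : ℝ) 1, eLpNorm (F θ) p volume ≤ C * ((ρ : ℝ≥0∞) ^ m * M) := by
      intro θ hθ
      have hθ' := abs_mul_le_of_mem_Icc hh hθ
      have e : F θ = fun z => (fun z => f (trans (expB B (h * θ) b) z) - f z)
          (flowY B (h * θ) z) := by
        ext z
        simp only [F, trans_expB_flowY]
      have hm1 : AEStronglyMeasurable (fun z => f (trans (expB B (h * θ) b) z) - f z) volume :=
        (aestronglyMeasurable_trans hfm _).sub hfm
      rw [e, hY.eLpNorm_comp hm1]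
      refine hC ρ f M hf' _ (hA ρ _ hθ' b (abs_smul_single_le hβ)) ?_
      refine hB.expB_apply_eq_zero _ fun i hi => ?_
      have : i ≠ j := by
        rintro rfl
        omega
      simp [hb, this]
    have hle := eLpNorm_average_le hFm hp (by
      filter_upwards [ae_restrict_mem measurableSet_Icc] with θ hθ
      exact hFle θ hθ)
    have heq : (fun z => (u (flowY B h (trans b z)) - u (trans b z)) - (u (flowY B h z) - u z))
        =ᵐ[volume] h • (fun z => ∫ θ, F θ z ∂unitMeasure) := by
      have h1 := hY.sub_eq_average hf h
      have h2 := hY.integrable_slice hf.2.1 h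
      have hq := (measurePreserving_trans (d := d) b).quasiMeasurePreserving
      filter_upwards [h1, h2, hq.ae h1, hq.ae h2] with z hz1 hz2 hz3 hz4
      rw [Pi.smul_apply, smul_eq_mul, integral_sub hz4 hz2, mul_sub, ← hz1, ← hz3]
    rw [eLpNorm_congr_ae heq, eLpNorm_const_smul]
    refine (mul_le_mul' (enorm_le_pow hh) hle).trans (le_of_eq ?_)
    ring

/-- The part of the commutator in which the increment in a direction of the block `k` is
expanded first. -/
lemma exists_flowY_increment_trans_le (hB : IsBlockMatrix d B) (hp : 1 ≤ p) {k m : ℕ}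
    (hm : m ≤ 2 * k + 2)
    (ih : ∀ m' < m, ∀ i, m' ≤ 2 * i → IncrementBound B p i m')
    (hk : m ≤ 2 * k → IncrementBound B p k m) :
    ∃ C : ℝ≥0, ∀ (ρ : ℝ≥0) (u : Pt d → ℝ) (M : ℝ≥0∞), ScaleBound B p ρ m u M →
      ∀ j : Coord d, (j.1 : ℕ) = k → ∀ β : ℝ, |β| ≤ (ρ : ℝ) ^ (2 * k + 1) →
      ∀ h : ℝ, |h| ≤ (ρ : ℝ) ^ 2 →
      eLpNorm (fun z => (u (trans (β • Pi.single j 1) (flowY B h z)) - u (flowY B h z)) -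
        (u (trans (β • Pi.single j 1) z) - u z)) p volume
        ≤ C * ((ρ : ℝ≥0∞) ^ m * M) := by
  have hY := hB.isFlow_flowY
  by_cases hmk : m ≤ 2 * k
  · obtain ⟨C, hC⟩ := hk hmk
    refine ⟨2 * C, fun ρ u M hu j hj β hβ h hh => ?_⟩
    have h1 : AEStronglyMeasurable (fun z => u (trans (β • Pi.single j 1) z) - u z) volume :=
      (aestronglyMeasurable_trans hu.aestronglyMeasurable _).sub hu.aestronglyMeasurable
    refine (eLpNorm_comp_sub_le_two_mul hp (hY.measurePreserving h) h1).trans ?_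
    push_cast
    rw [mul_assoc]
    exact mul_le_mul' le_rfl (hC ρ u M hu j hj β hβ)
  · obtain ⟨C, hC⟩ := ScaleBound.taylorX (B := B) hB hp (k := k)
      (fun m' hm' => ih m' (by omega) k hm') m
    set L := m / (2 * k + 1) with hL
    refine ⟨(L + 2 : ℕ) * C, fun ρ u M hu j hj β hβ h hh => ?_⟩
    obtain ⟨w, hw0, -, hw2, hw3⟩ := hC ρ u M hu j hj
    have hlm : ∀ l < L, (2 * k + 1) * (l + 1) ≤ m := fun l hl => by
      have := Nat.mul_le_of_le_div (2 * k + 1) (l + 1) m (by omega)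
      rwa [mul_comm] at this
    have hum := hu.aestronglyMeasurable
    have hwm : ∀ l < L, AEStronglyMeasurable (w (l + 1)) volume := fun l hl =>
      (hw2 (l + 1) (hlm l hl)).aestronglyMeasurable
    set R : Pt d → ℝ := fun z => u (flowX j β z) -
      ∑ l ∈ Finset.range (L + 1), β ^ l / (l.factorial : ℝ) * w l z with hR
    set G : ℕ → Pt d → ℝ := fun l => (β ^ (l + 1) / ((l + 1).factorial : ℝ)) •
      (fun z => w (l + 1) (flowY B h z) - w (l + 1) z) with hG
    have hGm : ∀ l ∈ Finset.range L, AEStronglyMeasurable (G l) volume := fun l hl =>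
      ((hY.aestronglyMeasurable (hwm l (Finset.mem_range.1 hl)) h).sub
        (hwm l (Finset.mem_range.1 hl))).const_smul _
    have hRm : AEStronglyMeasurable R volume := by
      refine ((isFlow_flowX j).aestronglyMeasurable hum β).sub ?_
      refine Finset.aestronglyMeasurable_fun_sum _ fun l hl => ?_
      refine AEStronglyMeasurable.const_mul ?_ _
      cases l with
      | zero => rwa [hw0]
      | succ l => exact hwm l (by simpa using hl)
    have hsplit : (fun z => (u (trans (β • Pi.single j 1) (flowY B h z)) - u (flowY B h z)) -
        (u (trans (β • Pi.single j 1) z) - u z)) =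
        (fun z => R (flowY B h z) - R z) + ∑ l ∈ Finset.range L, G l := by
      ext z
      simp only [Pi.add_apply, Finset.sum_apply, hG, Pi.smul_apply, smul_eq_mul, hR, mul_sub,
        Finset.sum_sub_distrib, flowX_eq_trans, Finset.sum_range_succ' _ L, hw0, pow_zero,
        Nat.factorial_zero, Nat.cast_one, div_one, one_mul]
      ring
    have hGle : ∀ l ∈ Finset.range L, eLpNorm (G l) p volume ≤ C * ((ρ : ℝ≥0∞) ^ m * M) := by
      intro l hl
      have hl' := hlm l (Finset.mem_range.1 hl)
      rw [hG]
      beta_reduce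
      rw [eLpNorm_const_smul]
      have hmul : (2 * k + 1) * (l + 1) = (2 * k + 1) * l + (2 * k + 1) := by ring
      have h1 := (hw2 (l + 1) hl').increment_flowY (by omega) hh
      have h2 : ‖β ^ (l + 1) / ((l + 1).factorial : ℝ)‖ₑ
          ≤ (ρ : ℝ≥0∞) ^ ((2 * k + 1) * (l + 1)) := by
        refine enorm_le_pow ?_
        rw [abs_div, abs_pow, Nat.abs_cast, pow_mul]
        refine (div_le_self (by positivity) ?_).trans (by gcongr)
        exact_mod_cast Nat.one_le_iff_ne_zero.2 (Nat.factorial_ne_zero _)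
      refine (mul_le_mul' h2 h1).trans (le_of_eq ?_)
      rw [← mul_assoc, ← pow_add, Nat.add_sub_cancel' hl']
      ring
    have hRle := hw3 β hβ
    rw [hsplit]
    refine (eLpNorm_add_le ((hY.aestronglyMeasurable hRm h).sub hRm)
      (Finset.aestronglyMeasurable_sum _ hGm) hp).trans ?_
    have h3 := eLpNorm_comp_sub_le_two_mul hp (hY.measurePreserving h) hRm
    calc _ ≤ 2 * (C * ((ρ : ℝ≥0∞) ^ m * M)) +
          ∑ l ∈ Finset.range L, C * ((ρ : ℝ≥0∞) ^ m * M) := by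
          refine add_le_add (h3.trans (mul_le_mul' le_rfl hRle)) ?_
          exact (eLpNorm_sum_le hGm hp).trans (Finset.sum_le_sum hGle)
      _ = _ := by
          rw [Finset.sum_const, Finset.card_range, nsmul_eq_mul]
          push_cast
          ring

/-- Numerical differentiation at `0`, exact for polynomials of degree at most `r`. -/
lemma exists_differentiation_nodes (r : ℕ) :
    ∃ c x : Fin (r + 1) → ℝ, (∀ i, x i ∈ Icc (0 : ℝ) 1) ∧
      ∀ l < r + 1, ∑ i, c i * x i ^ l = if l = 1 then 1 else 0 := by
  let x : Fin (r + 1) → ℝ := fun i => (i : ℝ) / (r + 1)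
  have hr : (0 : ℝ) < r + 1 := by positivity
  have hx : Function.Injective x := by
    intro i j hij
    have := (div_left_inj' hr.ne').1 hij
    exact Fin.ext (by exact_mod_cast this)
  have hdet : IsUnit (Matrix.vandermonde x).det :=
    (Matrix.det_vandermonde_ne_zero_iff.2 hx).isUnit
  let e : Fin (r + 1) → ℝ := fun l => if (l : ℕ) = 1 then 1 else 0
  refine ⟨Matrix.vecMul e (Matrix.vandermonde x)⁻¹, x, fun i => ⟨by positivity, ?_⟩, fun l hl => ?_⟩
  · rw [div_le_one hr]
    have := i.2
    exact_mod_cast this.le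
  · have h1 : Matrix.vecMul (Matrix.vecMul e (Matrix.vandermonde x)⁻¹) (Matrix.vandermonde x) = e := by
      rw [Matrix.vecMul_vecMul, Matrix.nonsing_inv_mul _ hdet, Matrix.vecMul_one]
    have h2 := congrFun h1 ⟨l, hl⟩
    simpa [Matrix.vecMul, dotProduct, Matrix.vandermonde_apply, e] using h2

lemma IsBlockMatrix.sum_expB_sub (hB : IsBlockMatrix d B) {c x : Fin (r + 1) → ℝ}
    (hc : ∀ l < r + 1, ∑ i, c i * x i ^ l = if l = 1 then 1 else 0) (h : ℝ) (b : Coord d → ℝ) :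
    ∑ i, c i • (expB B (h * x i) b - b) = h • B.mulVec b := by
  have h0 : ∑ i, c i = 0 := by simpa using hc 0 (Nat.succ_pos r)
  simp_rw [smul_sub, Finset.sum_sub_distrib, ← Finset.sum_smul, h0, zero_smul, sub_zero,
    hB.expB_eq_sum, Finset.smul_sum]
  rw [Finset.sum_comm]
  have h1 : ∀ l ∈ Finset.range (r + 1), ∑ i, c i • ((h * x i) ^ l / (l.factorial : ℝ)) •
      (B ^ l).mulVec b = if l = 1 then h • B.mulVec b else 0 := by
    intro l hl
    have e : ∀ i, c i • ((h * x i) ^ l / (l.factorial : ℝ)) • (B ^ l).mulVec b =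
        (c i * x i ^ l) • (h ^ l / (l.factorial : ℝ)) • (B ^ l).mulVec b := by
      intro i
      rw [smul_smul, smul_smul]
      congr 1
      ring
    simp_rw [e, ← Finset.sum_smul, hc l (Finset.mem_range.1 hl)]
    split_ifs with h1
    · subst h1
      simp
    · simp
  rw [Finset.sum_congr rfl h1, Finset.sum_ite_eq']
  split_ifs with h2
  · rfl
  · have : B = 0 := by
      have := hB.pow_eq_zero (l := 1) (by simpa using h2)
      simpa using this
    simp [this]

/-- Regularity of order `m ≤ 2k` controls the increments in the directions of the block `k`. -/
theorem incrementBound (hB : IsBlockMatrix d B) (hp : 1 ≤ p) (m : ℕ) :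
    ∀ k, m ≤ 2 * k → IncrementBound B p k m := by
  induction m using Nat.strong_induction_on with
  | _ m ih =>
  intro k
  induction k with
  | zero =>
    intro hm
    obtain rfl : m = 0 := by omega
    refine ⟨1, fun ρ u M hu j hj a ha => ?_⟩
    obtain ⟨j1, j2⟩ := j
    obtain rfl : j1 = 0 := Fin.ext hj
    simpa using hu.2.1 j2 a (by simpa using ha)
  | succ k ihk =>
    intro hm
    obtain ⟨C₁, hC₁⟩ := exists_trans_increment_flowY_le hB hp (k := k) (m := m) (by omega) ih
    obtain ⟨C₂, hC₂⟩ := exists_flowY_increment_trans_le hB hp (k := k) (m := m) (by omega) ih ihk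
    obtain ⟨c, x, hx, hcx⟩ := exists_differentiation_nodes r
    obtain ⟨γ, hγ⟩ := hB.exists_coeff_matrix k
    obtain ⟨N, hN⟩ := exists_nat_ge ((∑ i, ∑ j, |γ i j|) * ∑ l, |c l|)
    refine ⟨(Fintype.card (Coord d) * (r + 1) * (N + 1) : ℕ) * (C₁ + C₂),
      fun ρ u M hu i hi a ha => ?_⟩
    obtain ⟨hγ1, hγ2⟩ := hγ i hi
    rcases eq_or_ne ρ 0 with rfl | hρ
    · obtain rfl : a = 0 := by simpa using ha
      simp [flowX]
    have hρ' : (0 : ℝ) < ρ := by exact_mod_cast pos_iff_ne_zero.2 hρ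
    -- `a e_i` as a combination of the vectors `e^{hB} e_j - e_j`, with `h` between `0` and `ρ ^ 2`
    have key : a • Pi.single i (1 : ℝ) = ∑ j : Coord d, ∑ l, (a * γ i j / (ρ : ℝ) ^ 2 * c l) •
        (expB B ((ρ : ℝ) ^ 2 * x l) (Pi.single j 1) - Pi.single j 1) := by
      rw [← hγ2, Finset.smul_sum]
      refine Finset.sum_congr rfl fun j _ => ?_
      simp_rw [← smul_smul _ (c _), ← Finset.smul_sum, hB.sum_expB_sub hcx, smul_smul]
      congr 1
      field_simp
    rw [flowX_eq_trans, key]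
    have hum := hu.aestronglyMeasurable
    have hterm : ∀ (j : Coord d) (l : Fin (r + 1)), eLpNorm (fun z =>
        u (trans ((a * γ i j / (ρ : ℝ) ^ 2 * c l) •
        (expB B ((ρ : ℝ) ^ 2 * x l) (Pi.single j 1) - Pi.single j 1)) z) - u z) p volume ≤
        (N + 1 : ℕ) * ((C₁ + C₂ : ℝ≥0) * ((ρ : ℝ≥0∞) ^ m * M)) := by
      intro j l
      by_cases hj : (j.1 : ℕ) = k
      · refine eLpNorm_trans_smul_sub_le hp hum (R := (ρ : ℝ) ^ (2 * k + 1)) (fun β hβ => ?_)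
          (Nat.succ_pos N) ?_
        · have hl : |(ρ : ℝ) ^ 2 * x l| ≤ (ρ : ℝ) ^ 2 :=
            abs_mul_le_of_mem_Icc (abs_of_nonneg (by positivity)).le (hx l)
          rw [smul_sub, ← expB_smul]
          refine (eLpNorm_trans_expB_sub_le hB hp hum _ _).trans ?_
          refine (add_le_add (hC₁ ρ u M hu j hj β hβ _ hl) (hC₂ ρ u M hu j hj β hβ _ hl)).trans
            (le_of_eq ?_)
          push_cast
          ring
        · have h1 : |γ i j| ≤ ∑ i, ∑ j, |γ i j| :=
            (Finset.single_le_sum (f := fun j => |γ i j|) (fun _ _ => abs_nonneg _)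
              (Finset.mem_univ j)).trans
            (Finset.single_le_sum (f := fun i => ∑ j, |γ i j|)
              (fun _ _ => Finset.sum_nonneg fun _ _ => abs_nonneg _) (Finset.mem_univ i))
          have h2 : |c l| ≤ ∑ l, |c l| :=
            Finset.single_le_sum (f := fun l => |c l|) (fun _ _ => abs_nonneg _)
              (Finset.mem_univ l)
          have h3 : |γ i j| * |c l| ≤ (N + 1 : ℕ) := by
            refine (mul_le_mul h1 h2 (abs_nonneg _) ((abs_nonneg _).trans h1)).trans (hN.trans ?_)
            exact_mod_cast Nat.le_succ N
          have h4 : |a| / (ρ : ℝ) ^ 2 ≤ (ρ : ℝ) ^ (2 * k + 1) := by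
            rw [div_le_iff₀ (by positivity), ← pow_add]
            exact ha
          calc |a * γ i j / (ρ : ℝ) ^ 2 * c l| = (|γ i j| * |c l|) * (|a| / (ρ : ℝ) ^ 2) := by
                rw [abs_mul, abs_div, abs_mul, abs_of_pos (by positivity : (0 : ℝ) < (ρ : ℝ) ^ 2)]
                ring
            _ ≤ (N + 1 : ℕ) * (ρ : ℝ) ^ (2 * k + 1) := by gcongr
      · simp [hγ1 j hj, trans_zero]
    refine (eLpNorm_trans_sum_sub_le hp hum _ _).trans ?_
    calc _ ≤ ∑ j : Coord d, ∑ l : Fin (r + 1),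
          (N + 1 : ℕ) * ((C₁ + C₂ : ℝ≥0) * ((ρ : ℝ≥0∞) ^ m * M)) :=
          Finset.sum_le_sum fun j _ => (eLpNorm_trans_sum_sub_le hp hum _ _).trans
            (Finset.sum_le_sum fun l _ => hterm j l)
      _ = _ := by
          simp only [Finset.sum_const, Finset.card_univ, Fintype.card_fin, nsmul_eq_mul]
          push_cast
          ring

end

/-! ### The Taylor formula at a fixed scale -/

section

variable {r : ℕ} {d : Fin (r + 1) → ℕ} {B : Matrix (Coord d) (Coord d) ℝ} {p : ℝ≥0∞}

/-- `∂^β φ` with respect to the coordinates in the list `l`. -/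
noncomputable def dXList (l : List (Coord d)) (β : Coord d → ℕ) (φ : Pt d → ℝ) : Pt d → ℝ :=
  l.foldr (fun j ψ => (dX j)^[β j] ψ) φ

lemma IsTest.iterate_dX {φ : Pt d → ℝ} (hφ : IsTest φ) (j : Coord d) (b : ℕ) :
    IsTest ((dX j)^[b] φ) := by
  induction b with
  | zero => exact hφ
  | succ b ih =>
    rw [Function.iterate_succ_apply']
    exact ih.map_dX j

lemma IsTest.iterate_dY {φ : Pt d → ℝ} (hφ : IsTest φ) (k : ℕ) :
    IsTest ((dY B)^[k] φ) := by
  induction k with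
  | zero => exact hφ
  | succ k ih =>
    rw [Function.iterate_succ_apply']
    exact ih.map_dY

lemma IsTest.map_dXList {φ : Pt d → ℝ} (hφ : IsTest φ) (l : List (Coord d)) (β : Coord d → ℕ) :
    IsTest (dXList l β φ) := by
  induction l with
  | nil => exact hφ
  | cons j l ih => exact ih.iterate_dX j (β j)

lemma IsTest.const_mul {φ : Pt d → ℝ} (hφ : IsTest φ) (c : ℝ) : IsTest (fun z => c * φ z) :=
  ⟨contDiff_const.mul hφ.1, hφ.2.mul_left⟩

lemma dX_const_mul (j : Coord d) (c : ℝ) (φ : Pt d → ℝ) :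
    dX j (fun z => c * φ z) = fun z => c * dX j φ z := by
  ext z
  have : (fun z => c * φ z) = c • φ := rfl
  rw [dX, this, fderiv_const_smul_field]
  rfl

lemma iterate_dX_const_mul (j : Coord d) (c : ℝ) (φ : Pt d → ℝ) (b : ℕ) :
    (dX j)^[b] (fun z => c * φ z) = fun z => c * (dX j)^[b] φ z := by
  induction b with
  | zero => rfl
  | succ b ih => rw [Function.iterate_succ_apply', ih, dX_const_mul, Function.iterate_succ_apply']

lemma dY_neg (φ : Pt d → ℝ) : dY B (fun z => -φ z) = fun z => -dY B φ z := by
  ext z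
  simp [dY]

lemma iterate_dY_neg (φ : Pt d → ℝ) (k : ℕ) :
    (dY B)^[k] (fun z => -φ z) = fun z => -(dY B)^[k] φ z := by
  induction k with
  | zero => rfl
  | succ k ih => rw [Function.iterate_succ_apply', ih, dY_neg, Function.iterate_succ_apply']

lemma dXList_congr {l : List (Coord d)} {β β' : Coord d → ℕ} (h : ∀ j ∈ l, β j = β' j)
    (φ : Pt d → ℝ) : dXList l β φ = dXList l β' φ := by
  induction l with
  | nil => rfl
  | cons j l ih =>
    have h1 := ih fun i hi => h i (List.mem_cons_of_mem _ hi)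
    have h2 := h j List.mem_cons_self
    simp only [dXList, List.foldr_cons] at h1 ⊢
    rw [h1, h2]

lemma isWeak_iterate_dX {j : Coord d} {w : ℕ → Pt d → ℝ} (h0 : LocallyIntegrable (w 0) volume)
    (b : ℕ) (hw : ∀ l < b, IsWeakDX j (w l) (w (l + 1))) :
    IsWeak (fun φ z => (-1) ^ b * (dX j)^[b] φ z) (w 0) (w b) := by
  induction b with
  | zero => simpa using isWeak_id h0
  | succ b ih =>
    have h1 := IsWeak.comp (ih fun l hl => hw l (by omega)) (hw b (Nat.lt_succ_self b))
      (isTestOp_dV _)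
    refine h1.congr_op fun φ _ => ?_
    ext z
    have e : (fun z => -dX j φ z) = fun z => (-1) * dX j φ z := by simp
    rw [e, iterate_dX_const_mul, Function.iterate_succ_apply, pow_succ]
    ring

lemma isWeak_iterate_dY {w : ℕ → Pt d → ℝ} (h0 : LocallyIntegrable (w 0) volume)
    (k : ℕ) (hw : ∀ l < k, IsWeakDY B (w l) (w (l + 1))) :
    IsWeak (fun φ z => (-1) ^ k * (dY B)^[k] φ z) (w 0) (w k) := by
  induction k with
  | zero => simpa using isWeak_id h0
  | succ k ih =>
    have h1 := IsWeak.comp (ih fun l hl => hw l (by omega)) (hw k (Nat.lt_succ_self k)) isTestOp_dY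
    refine h1.congr_op fun φ _ => ?_
    ext z
    rw [iterate_dY_neg, Function.iterate_succ_apply, pow_succ]
    ring

/-! #### Multi-indices -/

lemma apply_le_lengthB (β : Coord d → ℕ) (j : Coord d) : β j ≤ lengthB β :=
  (Nat.le_mul_of_pos_left _ (Nat.succ_pos _)).trans
    (Finset.single_le_sum (f := fun j : Coord d => (2 * (j.1 : ℕ) + 1) * β j)
      (fun _ _ => Nat.zero_le _) (Finset.mem_univ j))

lemma mem_taylorIndex {n : ℕ} {a : ℕ × (Coord d → ℕ)} :
    a ∈ taylorIndex d n ↔ 2 * a.1 + lengthB a.2 ≤ n := by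
  simp only [taylorIndex, Finset.mem_filter, Finset.mem_product, Finset.mem_range,
    Fintype.mem_piFinset, and_iff_right_iff_imp]
  intro h
  refine ⟨by omega, fun j => ?_⟩
  have := apply_le_lengthB a.2 j
  omega

lemma lengthB_update (β : Coord d → ℕ) (j : Coord d) (b : ℕ) (hj : β j = 0) :
    lengthB (Function.update β j b) = (2 * (j.1 : ℕ) + 1) * b + lengthB β := by
  rw [lengthB, lengthB, ← Finset.add_sum_erase _ _ (Finset.mem_univ j),
    ← Finset.add_sum_erase (a := j) _ (fun j : Coord d => (2 * (j.1 : ℕ) + 1) * β j)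
      (Finset.mem_univ j), hj, Function.update_self, mul_zero, zero_add]
  congr 1
  refine Finset.sum_congr rfl fun i hi => ?_
  rw [Function.update_of_ne (Finset.ne_of_mem_erase hi)]

/-- The pairs `(k, β)` of order at most `n` with `β` supported in the list `l`. -/
noncomputable def listIndex (l : List (Coord d)) (n : ℕ) : Finset (ℕ × (Coord d → ℕ)) := by
  classical exact (taylorIndex d n).filter fun a => ∀ j, j ∉ l → a.2 j = 0

lemma mem_listIndex {l : List (Coord d)} {n : ℕ} {a : ℕ × (Coord d → ℕ)} :
    a ∈ listIndex l n ↔ 2 * a.1 + lengthB a.2 ≤ n ∧ ∀ j, j ∉ l → a.2 j = 0 := by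
  simp [listIndex, mem_taylorIndex]

lemma sum_listIndex_nil {M : Type*} [AddCommMonoid M] (n : ℕ) (f : ℕ × (Coord d → ℕ) → M) :
    ∑ a ∈ listIndex ([] : List (Coord d)) n, f a = ∑ k ∈ Finset.range (n / 2 + 1), f (k, 0) := by
  have h0 : lengthB (0 : Coord d → ℕ) = 0 := by simp [lengthB]
  refine Finset.sum_bij' (fun a _ => a.1) (fun k _ => (k, 0)) ?_ ?_ ?_ ?_ ?_
  · intro a ha
    rw [mem_listIndex] at ha
    rw [Finset.mem_range]
    omega
  · intro k hk
    rw [Finset.mem_range] at hk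
    refine mem_listIndex.2 ⟨?_, fun _ _ => rfl⟩
    rw [h0]
    dsimp only
    omega
  · intro a ha
    have : a.2 = 0 := funext fun j => (mem_listIndex.1 ha).2 j (by simp)
    exact Prod.ext rfl this.symm
  · intro k _
    rfl
  · intro a ha
    have : a.2 = 0 := funext fun j => (mem_listIndex.1 ha).2 j (by simp)
    rw [← this]

lemma sum_listIndex_cons {M : Type*} [AddCommMonoid M] {j : Coord d} {l : List (Coord d)}
    (hj : j ∉ l) (n : ℕ) (f : ℕ × (Coord d → ℕ) → M) :
    ∑ a ∈ listIndex (j :: l) n, f a = ∑ b ∈ Finset.range (n / (2 * (j.1 : ℕ) + 1) + 1),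
      ∑ a ∈ listIndex l (n - (2 * (j.1 : ℕ) + 1) * b), f (a.1, Function.update a.2 j b) := by
  rw [Finset.sum_sigma']
  have hpos : 0 < 2 * (j.1 : ℕ) + 1 := Nat.succ_pos _
  have hlen : ∀ β : Coord d → ℕ, lengthB β =
      (2 * (j.1 : ℕ) + 1) * β j + lengthB (Function.update β j 0) := by
    intro β
    rw [← lengthB_update (Function.update β j 0) j (β j) (by simp)]
    simp
  refine Finset.sum_bij' (fun a _ => ⟨a.2 j, (a.1, Function.update a.2 j 0)⟩)
    (fun x _ => (x.2.1, Function.update x.2.2 j x.1)) ?_ ?_ ?_ ?_ ?_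
  · intro a ha
    rw [mem_listIndex] at ha
    have h1 := hlen a.2
    rw [Finset.mem_sigma, Finset.mem_range, Nat.lt_succ_iff, Nat.le_div_iff_mul_le hpos,
      mem_listIndex, mul_comm]
    dsimp only
    refine ⟨by omega, by omega, fun i hi => ?_⟩
    by_cases hij : i = j
    · subst hij
      simp
    · rw [Function.update_of_ne hij]
      exact ha.2 i (by simp [hij, hi])
  · intro x hx
    rw [Finset.mem_sigma, Finset.mem_range, Nat.lt_succ_iff, Nat.le_div_iff_mul_le hpos,
      mem_listIndex, mul_comm] at hx
    rw [mem_listIndex]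
    dsimp only
    rw [lengthB_update _ _ _ (hx.2.2 j hj)]
    refine ⟨by omega, fun i hi => ?_⟩
    rw [List.mem_cons, not_or] at hi
    rw [Function.update_of_ne hi.1]
    exact hx.2.2 i hi.2
  · intro a _
    simp
  · intro x hx
    have h0 : x.2.2 j = 0 := (mem_listIndex.1 (Finset.mem_sigma.1 hx).2).2 j hj
    ext1
    · simp
    · simp [← h0]
  · intro a _
    simp

/-- The monomial `τ^k ξ^β / (k! β!)`. -/
noncomputable def monomial (τ : ℝ) (ξ : Coord d → ℝ) (a : ℕ × (Coord d → ℕ)) : ℝ :=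
  (τ ^ a.1 * ∏ j : Coord d, ξ j ^ a.2 j) /
    ((a.1.factorial : ℝ) * ∏ j : Coord d, ((a.2 j).factorial : ℝ))

lemma monomial_zero (τ : ℝ) (ξ : Coord d → ℝ) (k : ℕ) :
    monomial τ ξ (k, 0) = τ ^ k / (k.factorial : ℝ) := by
  simp [monomial]

lemma monomial_update (τ : ℝ) (ξ : Coord d → ℝ) (a : ℕ × (Coord d → ℕ)) {j : Coord d}
    (hj : a.2 j = 0) (b : ℕ) : monomial τ ξ (a.1, Function.update a.2 j b) =
      ξ j ^ b / (b.factorial : ℝ) * monomial τ ξ a := by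
  have h1 : ∏ i : Coord d, ξ i ^ Function.update a.2 j b i = ξ j ^ b * ∏ i, ξ i ^ a.2 i := by
    rw [← Finset.mul_prod_erase _ _ (Finset.mem_univ j),
      ← Finset.mul_prod_erase (a := j) _ (fun i : Coord d => ξ i ^ a.2 i) (Finset.mem_univ j),
      hj, Function.update_self, pow_zero, one_mul]
    congr 1
    refine Finset.prod_congr rfl fun i hi => ?_
    rw [Function.update_of_ne (Finset.ne_of_mem_erase hi)]
  have h2 : ∏ i : Coord d, ((Function.update a.2 j b i).factorial : ℝ) =
      (b.factorial : ℝ) * ∏ i, ((a.2 i).factorial : ℝ) := by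
    rw [← Finset.mul_prod_erase _ _ (Finset.mem_univ j),
      ← Finset.mul_prod_erase (a := j) _ (fun i : Coord d => ((a.2 i).factorial : ℝ))
      (Finset.mem_univ j), hj, Function.update_self, Nat.factorial_zero, Nat.cast_one, one_mul]
    congr 1
    refine Finset.prod_congr rfl fun i hi => ?_
    rw [Function.update_of_ne (Finset.ne_of_mem_erase hi)]
  rw [monomial, monomial, h1, h2, div_mul_div_comm]
  congr 1 <;> ring

/-- The Taylor formula for translations in the coordinates of a list, followed by the flow of `Y`.
The coordinates are expanded one after the other. -/
lemma exists_taylor_list (hB : IsBlockMatrix d B) (hp : 1 ≤ p) (l : List (Coord d))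
    (hl : l.Nodup) : ∀ n : ℕ, ∃ C : ℝ≥0, ∀ (ρ : ℝ≥0) (u : Pt d → ℝ) (M : ℝ≥0∞),
      ScaleBound B p ρ n u M → ∃ D : ℕ → (Coord d → ℕ) → Pt d → ℝ,
      (∀ a ∈ listIndex l n, IsWeak (fun φ z => (-1) ^ (a.1 + ∑ j, a.2 j) *
        dXList l a.2 ((dY B)^[a.1] φ) z) u (D a.1 a.2)) ∧
      ∀ (τ : ℝ) (ξ : Coord d → ℝ), |τ| ≤ (ρ : ℝ) ^ 2 →
        (∀ j : Coord d, |ξ j| ≤ (ρ : ℝ) ^ (2 * (j.1 : ℕ) + 1)) →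
        eLpNorm (fun z => u (trans (l.map fun j => ξ j • Pi.single j (1 : ℝ)).sum (flowY B τ z)) -
          ∑ a ∈ listIndex l n, monomial τ ξ a * D a.1 a.2 z) p volume
          ≤ C * ((ρ : ℝ≥0∞) ^ n * M) := by
  have hY := hB.isFlow_flowY
  induction l with
  | nil =>
    intro n
    refine ⟨1, fun ρ u M hu => ?_⟩
    obtain ⟨w, hw0, hw1, hw2, hw3⟩ := hu.taylorY hB hp n
    refine ⟨fun k _ => w k, fun a ha => ?_, fun τ ξ hτ _ => ?_⟩
    · obtain ⟨ha1, ha2⟩ := mem_listIndex.1 ha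
      have h1 := isWeak_iterate_dY (by rw [hw0]; exact hu.locallyIntegrable) a.1
        (fun l hl => hw1 l (by omega))
      rw [hw0] at h1
      have h2 : ∑ j, a.2 j = 0 := Finset.sum_eq_zero fun j _ => ha2 j (by simp)
      rw [h2]
      exact h1
    · simp_rw [sum_listIndex_nil, monomial_zero]
      simpa [trans_zero] using hw3 τ hτ
  | cons j l ih =>
    intro n
    obtain ⟨hjl, hl'⟩ := List.nodup_cons.1 hl
    obtain ⟨C₀, hC₀⟩ := ScaleBound.taylorX (B := B) hB hp (k := (j.1 : ℕ))
      (fun m hm => incrementBound hB hp m _ hm) n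
    choose C hC using fun b => ih hl' (n - (2 * (j.1 : ℕ) + 1) * b)
    set L := n / (2 * (j.1 : ℕ) + 1) with hL
    refine ⟨C₀ + ∑ b ∈ Finset.range (L + 1), C b * C₀, fun ρ u M hu => ?_⟩
    obtain ⟨w, hw0, hw1, hw2, hw3⟩ := hC₀ ρ u M hu j rfl
    have hbn : ∀ b ∈ Finset.range (L + 1), (2 * (j.1 : ℕ) + 1) * b ≤ n := fun b hb => by
      have := Nat.mul_le_of_le_div (2 * (j.1 : ℕ) + 1) b n
        (Nat.lt_succ_iff.1 (Finset.mem_range.1 hb))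
      rwa [mul_comm] at this
    have hD : ∀ b, ∃ D : ℕ → (Coord d → ℕ) → Pt d → ℝ, b ∈ Finset.range (L + 1) → _ := fun b => by
      by_cases hb : b ∈ Finset.range (L + 1)
      · obtain ⟨D, hD⟩ := hC b ρ (w b) _ (hw2 b (hbn b hb))
        exact ⟨D, fun _ => hD⟩
      · exact ⟨fun _ _ => 0, fun h => absurd h hb⟩
    choose D hD using hD
    refine ⟨fun k β => D (β j) k (Function.update β j 0), fun a ha => ?_, fun τ ξ hτ hξ => ?_⟩
    · obtain ⟨ha1, ha2⟩ := mem_listIndex.1 ha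
      have hlen := lengthB_update (Function.update a.2 j 0) j (a.2 j) (by simp)
      simp only [Function.update_idem, Function.update_eq_self] at hlen
      have hbL : a.2 j ∈ Finset.range (L + 1) := by
        rw [Finset.mem_range, Nat.lt_succ_iff, hL, Nat.le_div_iff_mul_le (by omega), mul_comm]
        omega
      have hmem : (a.1, Function.update a.2 j 0) ∈
          listIndex l (n - (2 * (j.1 : ℕ) + 1) * a.2 j) := by
        refine mem_listIndex.2 ⟨by dsimp only; omega, fun i hi => ?_⟩
        dsimp only
        by_cases hij : i = j
        · subst hij
          simp
        · rw [Function.update_of_ne hij]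
          exact ha2 i (by simp [hij, hi])
      have h1 := (hD _ hbL).1 _ hmem
      have h2 := isWeak_iterate_dX (j := j) (w := w) (by rw [hw0]; exact hu.locallyIntegrable)
        (a.2 j) (fun l hl => hw1 l (le_trans (Nat.mul_le_mul le_rfl hl) (hbn _ hbL)))
      rw [hw0] at h2
      refine (IsWeak.comp h2 h1 fun φ hφ => ?_).congr_op fun φ hφ => ?_
      · exact ((hφ.iterate_dY a.1).map_dXList l _).const_mul _
      · ext z
        have e1 : ∑ i, a.2 i = a.2 j + ∑ i, Function.update a.2 j 0 i := by
          rw [← Finset.add_sum_erase _ _ (Finset.mem_univ j),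
            ← Finset.add_sum_erase (a := j) _ (Function.update a.2 j 0) (Finset.mem_univ j),
            Function.update_self, zero_add]
          congr 1
          refine Finset.sum_congr rfl fun i hi => ?_
          rw [Function.update_of_ne (Finset.ne_of_mem_erase hi)]
        have e2 : dXList l (Function.update a.2 j 0) ((dY B)^[a.1] φ) =
            dXList l a.2 ((dY B)^[a.1] φ) := by
          refine dXList_congr (fun i hi => ?_) _
          rw [Function.update_of_ne]
          rintro rfl
          exact hjl hi
        have e3 : dXList (j :: l) a.2 ((dY B)^[a.1] φ) =
            (dX j)^[a.2 j] (dXList l a.2 ((dY B)^[a.1] φ)) := rfl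
        rw [iterate_dX_const_mul, e3, e2, e1]
        ring
    · set v : Coord d → ℝ := (l.map fun j => ξ j • Pi.single j (1 : ℝ)).sum with hv
      set R : Pt d → ℝ := fun z => u (flowX j (ξ j) z) -
        ∑ b ∈ Finset.range (L + 1), ξ j ^ b / (b.factorial : ℝ) * w b z with hR
      set G : ℕ → Pt d → ℝ := fun b => (ξ j ^ b / (b.factorial : ℝ)) •
        (fun z => w b (trans v (flowY B τ z)) -
          ∑ a ∈ listIndex l (n - (2 * (j.1 : ℕ) + 1) * b), monomial τ ξ a * D b a.1 a.2 z) with hG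
      have hsplit : (fun z => u (trans ((j :: l).map fun j => ξ j • Pi.single j (1 : ℝ)).sum
          (flowY B τ z)) - ∑ a ∈ listIndex (j :: l) n, monomial τ ξ a *
            D (a.2 j) a.1 (Function.update a.2 j 0) z) =
          (fun z => R (trans v (flowY B τ z))) + ∑ b ∈ Finset.range (L + 1), G b := by
        ext z
        have e1 : trans ((j :: l).map fun j => ξ j • Pi.single j (1 : ℝ)).sum (flowY B τ z) =
            flowX j (ξ j) (trans v (flowY B τ z)) := by
          rw [List.map_cons, List.sum_cons, flowX_eq_trans, trans_trans]
        have e2 : ∑ a ∈ listIndex (j :: l) n, monomial τ ξ a *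
            D (a.2 j) a.1 (Function.update a.2 j 0) z = ∑ b ∈ Finset.range (L + 1),
            ξ j ^ b / (b.factorial : ℝ) * ∑ a ∈ listIndex l (n - (2 * (j.1 : ℕ) + 1) * b),
              monomial τ ξ a * D b a.1 a.2 z := by
          rw [sum_listIndex_cons hjl]
          refine Finset.sum_congr rfl fun b _ => ?_
          rw [Finset.mul_sum]
          refine Finset.sum_congr rfl fun a ha => ?_
          have h0 : a.2 j = 0 := (mem_listIndex.1 ha).2 j hjl
          rw [monomial_update τ ξ a h0, ← mul_assoc]
          dsimp only
          rw [Function.update_self, Function.update_idem, ← h0, Function.update_eq_self]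
        rw [e1, e2]
        simp only [Pi.add_apply, Finset.sum_apply, hG, Pi.smul_apply, smul_eq_mul, hR, mul_sub,
          Finset.sum_sub_distrib]
        ring
      have hwm : ∀ b ∈ Finset.range (L + 1), AEStronglyMeasurable (w b) volume := fun b hb =>
        (hw2 b (hbn b hb)).aestronglyMeasurable
      have hRm : AEStronglyMeasurable R volume := by
        refine ((isFlow_flowX j).aestronglyMeasurable hu.aestronglyMeasurable _).sub ?_
        exact Finset.aestronglyMeasurable_fun_sum _ fun b hb => (hwm b hb).const_mul _
      have hGm : ∀ b ∈ Finset.range (L + 1), AEStronglyMeasurable (G b) volume := by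
        intro b hb
        refine AEStronglyMeasurable.const_smul ?_ _
        refine (hY.aestronglyMeasurable (aestronglyMeasurable_trans (hwm b hb) v) τ).sub ?_
        refine Finset.aestronglyMeasurable_fun_sum _ fun a ha => ?_
        exact (((hD b hb).1 a ha).2.1.aestronglyMeasurable).const_mul _
      rw [hsplit]
      refine (eLpNorm_add_le (hY.aestronglyMeasurable (aestronglyMeasurable_trans hRm v) τ)
        (Finset.aestronglyMeasurable_sum _ hGm) hp).trans ?_
      push_cast
      rw [add_mul, Finset.sum_mul]
      refine add_le_add ?_ ((eLpNorm_sum_le hGm hp).trans (Finset.sum_le_sum fun b hb => ?_))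
      · rw [hY.eLpNorm_comp (aestronglyMeasurable_trans hRm v), eLpNorm_trans hRm]
        exact hw3 (ξ j) (hξ j)
      · rw [hG]
        beta_reduce
        rw [eLpNorm_const_smul]
        have h2 : ‖ξ j ^ b / (b.factorial : ℝ)‖ₑ ≤ (ρ : ℝ≥0∞) ^ ((2 * (j.1 : ℕ) + 1) * b) := by
          refine enorm_le_pow ?_
          rw [abs_div, abs_pow, Nat.abs_cast, pow_mul]
          refine (div_le_self (by positivity) ?_).trans (by gcongr; exact hξ j)
          exact_mod_cast Nat.one_le_iff_ne_zero.2 (Nat.factorial_ne_zero _)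
        refine (mul_le_mul' h2 ((hD b hb).2 τ ξ hτ hξ)).trans (le_of_eq ?_)
        have e : (ρ : ℝ≥0∞) ^ n = (ρ : ℝ≥0∞) ^ ((2 * (j.1 : ℕ) + 1) * b) *
            (ρ : ℝ≥0∞) ^ (n - (2 * (j.1 : ℕ) + 1) * b) := by
          rw [← pow_add, Nat.add_sub_cancel' (hbn b hb)]
        rw [e]
        ring

/-- The Taylor formula at the scale `ρ`. -/
theorem exists_taylor (hB : IsBlockMatrix d B) (hp : 1 ≤ p) (n : ℕ) :
    ∃ C : ℝ≥0, ∀ (ρ : ℝ≥0) (u : Pt d → ℝ) (M : ℝ≥0∞), ScaleBound B p ρ n u M →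
      ∃ D : ℕ → (Coord d → ℕ) → Pt d → ℝ, IsDerivFamily B n u D ∧
      ∀ (τ : ℝ) (ξ : Coord d → ℝ), |τ| ≤ (ρ : ℝ) ^ 2 →
        (∀ j : Coord d, |ξ j| ≤ (ρ : ℝ) ^ (2 * (j.1 : ℕ) + 1)) →
        eLpNorm (fun z => u (trans ξ (flowY B τ z)) -
          ∑ a ∈ taylorIndex d n, monomial τ ξ a * D a.1 a.2 z) p volume
          ≤ C * ((ρ : ℝ≥0∞) ^ n * M) := by
  obtain ⟨C, hC⟩ := exists_taylor_list hB hp (Finset.univ : Finset (Coord d)).toList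
    (Finset.nodup_toList _) n
  have e : listIndex (Finset.univ : Finset (Coord d)).toList n = taylorIndex d n := by
    ext a
    simp [mem_listIndex, mem_taylorIndex]
  refine ⟨C, fun ρ u M hu => ?_⟩
  obtain ⟨D, hD1, hD2⟩ := hC ρ u M hu
  rw [e] at hD1 hD2
  refine ⟨D, fun k β hkβ => hD1 (k, β) (mem_taylorIndex.2 hkβ), fun τ ξ hτ hξ => ?_⟩
  have h := hD2 τ ξ hτ hξ
  have e2 : ((Finset.univ : Finset (Coord d)).toList.map fun j => ξ j • Pi.single j (1 : ℝ)).sum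
      = ξ := by
    rw [Finset.sum_map_toList]
    ext i
    simp [Finset.sum_apply, Pi.single_apply]
  rwa [e2] at h

/-- The same bound holds for every family of weak derivatives, and it is one for the remainder in
the Taylor formula around `z ∘ ζ`, since `z = (z ∘ ζ) ∘ ζ⁻¹`. -/
theorem exists_remainderNorm_le (hB : IsBlockMatrix d B) (hp : 1 ≤ p) (n : ℕ) :
    ∃ C : ℝ≥0, ∀ (ρ : ℝ≥0) (u : Pt d → ℝ) (M : ℝ≥0∞), ScaleBound B p ρ n u M →
      ∀ D : ℕ → (Coord d → ℕ) → Pt d → ℝ, IsDerivFamily B n u D →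
      ∀ ζ : Pt d, |ζ.1| ≤ (ρ : ℝ) ^ 2 →
        (∀ j : Coord d, |expB B (-ζ.1) ζ.2 j| ≤ (ρ : ℝ) ^ (2 * (j.1 : ℕ) + 1)) →
        remainderNorm B n p u D ζ ≤ C * ((ρ : ℝ≥0∞) ^ n * M) := by
  obtain ⟨C, hC⟩ := exists_taylor (B := B) hB hp n
  refine ⟨C, fun ρ u M hu D hD ζ hζ1 hζ2 => ?_⟩
  obtain ⟨D', hD', hle⟩ := hC ρ u M hu
  have h := hle (-ζ.1) (-expB B (-ζ.1) ζ.2) (by rwa [abs_neg])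
    (fun j => by rw [Pi.neg_apply, abs_neg]; exact hζ2 j)
  set ξ := -expB B (-ζ.1) ζ.2 with hξ
  have hae : ∀ᵐ z, ∀ a ∈ taylorIndex d n, D' a.1 a.2 z = D a.1 a.2 z := by
    rw [ae_all_iff]
    intro a
    by_cases ha : a ∈ taylorIndex d n
    · filter_upwards [(hD' a.1 a.2 (mem_taylorIndex.1 ha)).ae_unique
        (hD a.1 a.2 (mem_taylorIndex.1 ha))] with z hz _
      exact hz
    · exact Filter.Eventually.of_forall fun z hz => absurd hz ha
  set G : Pt d → ℝ := fun z => u (trans ξ (flowY B (-ζ.1) z)) -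
          ∑ a ∈ taylorIndex d n, monomial (-ζ.1) ξ a * D a.1 a.2 z with hG
  have hG' : eLpNorm G p volume ≤ C * ((ρ : ℝ≥0∞) ^ n * M) := by
    refine le_trans (le_of_eq (eLpNorm_congr_ae ?_)) h
    filter_upwards [hae] with z hz
    rw [hG]
    beta_reduce
    congr 1
    exact Finset.sum_congr rfl fun a ha => by rw [hz a ha]
  have hum := hu.aestronglyMeasurable
  have hY := hB.isFlow_flowY
  have hGm : AEStronglyMeasurable G volume := by
    refine (hY.aestronglyMeasurable (aestronglyMeasurable_trans hum ξ) _).sub ?_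
    refine Finset.aestronglyMeasurable_fun_sum _ fun a ha => ?_
    exact ((hD a.1 a.2 (mem_taylorIndex.1 ha)).2.1.aestronglyMeasurable).const_mul _
  have hrem : remainderNorm B n p u D ζ =
      eLpNorm (fun z => G (trans ζ.2 (flowY B ζ.1 z))) p volume := by
    rw [remainderNorm]
    congr 1
    ext z
    have e1 : gmul B z ζ = trans ζ.2 (flowY B ζ.1 z) := by
      simp [gmul, trans, flowY, add_comm]
    have e2 : trans ξ (flowY B (-ζ.1) (trans ζ.2 (flowY B ζ.1 z))) = z := by
      rw [← trans_expB_flowY, trans_trans, hY.neg_apply, hξ, neg_add_cancel, trans_zero]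
    have e3 : z.1 - (gmul B z ζ).1 = -ζ.1 := by simp [gmul]
    have e4 : z.2 - expB B (-ζ.1) (gmul B z ζ).2 = ξ := by
      simp [gmul, expB_add_right, expB_neg_expB, hξ]
    rw [hG]
    beta_reduce
    rw [e2, taylorPoly, e3, e4, e1]
    rfl
  rw [hrem, hY.eLpNorm_comp (aestronglyMeasurable_trans hGm _), eLpNorm_trans hGm]
  exact hG'

end

/-! ### The homogeneous norm -/

section

variable {r : ℕ} {d : Fin (r + 1) → ℕ}

lemma blockNorm_nonneg (x : Coord d → ℝ) (i : Fin (r + 1)) : 0 ≤ blockNorm x i := Real.sqrt_nonneg _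

lemma abs_le_blockNorm (x : Coord d → ℝ) (j : Coord d) : |x j| ≤ blockNorm x j.1 := by
  rw [blockNorm, ← Real.sqrt_sq_eq_abs]
  refine Real.sqrt_le_sqrt ?_
  exact Finset.single_le_sum (f := fun a => x ⟨j.1, a⟩ ^ 2) (fun _ _ => sq_nonneg _)
    (Finset.mem_univ j.2)

lemma homNorm_nonneg (z : Pt d) : 0 ≤ homNorm z :=
  add_nonneg (by positivity)
    (Finset.sum_nonneg fun i _ => Real.rpow_nonneg (blockNorm_nonneg _ _) _)

lemma abs_fst_le_homNorm (z : Pt d) : |z.1| ≤ homNorm z ^ 2 := by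
  have h : |z.1| ^ (1 / 2 : ℝ) ≤ homNorm z :=
    le_add_of_nonneg_right
      (Finset.sum_nonneg fun i _ => Real.rpow_nonneg (blockNorm_nonneg _ _) _)
  rw [← Real.sqrt_eq_rpow] at h
  exact (Real.sqrt_le_left (homNorm_nonneg z)).1 h

lemma abs_snd_le_homNorm (z : Pt d) (j : Coord d) :
    |z.2 j| ≤ homNorm z ^ (2 * (j.1 : ℕ) + 1) := by
  have h : blockNorm z.2 j.1 ^ (1 / (2 * ((j.1 : ℕ) : ℝ) + 1)) ≤ homNorm z := by
    refine le_add_of_nonneg_of_le (by positivity) ?_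
    exact Finset.single_le_sum
      (f := fun i : Fin (r + 1) => blockNorm z.2 i ^ (1 / (2 * ((i : ℕ) : ℝ) + 1)))
      (fun i _ => Real.rpow_nonneg (blockNorm_nonneg _ _) _) (Finset.mem_univ j.1)
  have e : (1 / (2 * ((j.1 : ℕ) : ℝ) + 1)) = ((2 * (j.1 : ℕ) + 1 : ℕ) : ℝ)⁻¹ := by
    push_cast
    rw [one_div]
  rw [e] at h
  refine (abs_le_blockNorm _ j).trans ?_
  rw [← Real.rpow_inv_natCast_pow (blockNorm_nonneg z.2 j.1) (Nat.succ_ne_zero (2 * (j.1 : ℕ)))]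
  exact pow_le_pow_left₀ (Real.rpow_nonneg (blockNorm_nonneg _ _) _) h _

lemma homNorm_pos {z : Pt d} (hz : z ≠ 0) : 0 < homNorm z := by
  refine (homNorm_nonneg z).lt_of_ne fun h => hz ?_
  have h1 := abs_fst_le_homNorm z
  rw [← h] at h1
  refine Prod.ext ?_ (funext fun j => ?_)
  · simpa using h1
  · have h2 := abs_snd_le_homNorm z j
    rw [← h, zero_pow (Nat.succ_ne_zero _)] at h2
    simpa using h2

lemma continuous_homNorm : Continuous (homNorm : Pt d → ℝ) := by
  unfold homNorm blockNorm
  refine Continuous.add ?_ (continuous_finsetSum _ fun i _ => ?_)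
  · exact continuous_fst.abs.rpow_const fun _ => Or.inr (by norm_num)
  · refine Continuous.rpow_const ?_ fun _ => Or.inr (by positivity)
    fun_prop

lemma measurable_homNorm : Measurable (homNorm : Pt d → ℝ) := continuous_homNorm.measurable

lemma homDim_eq : homDim d = 2 + ∑ j : Coord d, (2 * (j.1 : ℕ) + 1) := by
  rw [homDim, Fintype.sum_sigma]
  simp [mul_comm]

/-- The measure of a homogeneous ball is at most that of the homogeneous box around it. -/
lemma volume_homNorm_le {ρ : ℝ} (hρ : 0 ≤ ρ) :
    volume {z : Pt d | homNorm z ≤ ρ} ≤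
      ENNReal.ofReal (2 ^ (Fintype.card (Coord d) + 1) * ρ ^ homDim d) := by
  have hsub : {z : Pt d | homNorm z ≤ ρ} ⊆ Icc (-ρ ^ 2) (ρ ^ 2) ×ˢ
      (Set.pi univ fun j : Coord d => Icc (-ρ ^ (2 * (j.1 : ℕ) + 1)) (ρ ^ (2 * (j.1 : ℕ) + 1))) := by
    intro z hz
    refine ⟨abs_le.1 ((abs_fst_le_homNorm z).trans ?_), fun j _ =>
      abs_le.1 ((abs_snd_le_homNorm z j).trans ?_)⟩
    · exact pow_le_pow_left₀ (homNorm_nonneg z) hz _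
    · exact pow_le_pow_left₀ (homNorm_nonneg z) hz _
  refine (measure_mono hsub).trans (le_of_eq ?_)
  rw [Measure.volume_eq_prod, Measure.prod_prod, volume_pi_pi]
  simp only [Real.volume_Icc, sub_neg_eq_add, ← two_mul]
  rw [← ENNReal.ofReal_prod_of_nonneg (fun _ _ => by positivity),
    ← ENNReal.ofReal_mul (by positivity), Finset.prod_mul_distrib, Finset.prod_const,
    Finset.prod_pow_eq_pow_sum, homDim_eq, Finset.card_univ]
  congr 1
  ring

/-- The tails of the homogeneous kernels, by a decomposition into dyadic shells. -/
lemma exists_lintegral_homNorm_le {a : ℝ} (ha : 0 < a) :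
    ∃ C : ℝ, 0 ≤ C ∧ ∀ R : ℝ, 0 < R →
      ∫⁻ ζ in {ζ : Pt d | R ≤ homNorm ζ}, (ENNReal.ofReal (homNorm ζ ^ ((homDim d : ℝ) + a)))⁻¹
        ≤ ENNReal.ofReal (C * R ^ (-a)) := by
  set D := homDim d with hD
  set c : ℝ := 2 ^ (Fintype.card (Coord d) + 1) * 2 ^ D with hc
  have hq0 : (0 : ℝ) ≤ 2 ^ (-a) := by positivity
  have hq1 : (2 : ℝ) ^ (-a) < 1 := Real.rpow_lt_one_of_one_lt_of_neg one_lt_two (by linarith)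
  refine ⟨c * (1 - 2 ^ (-a))⁻¹, by have := sub_pos.2 hq1; positivity, fun R hR => ?_⟩
  let S : ℕ → Set (Pt d) := fun k => {ζ | 2 ^ k * R ≤ homNorm ζ ∧ homNorm ζ ≤ 2 * (2 ^ k * R)}
  have hcover : {ζ : Pt d | R ≤ homNorm ζ} ⊆ ⋃ k, S k := by
    intro ζ hζ
    obtain ⟨k, hk1, hk2⟩ := exists_nat_pow_near (x := homNorm ζ / R) (y := 2)
      ((one_le_div hR).2 hζ) one_lt_two
    rw [le_div_iff₀ hR] at hk1
    rw [div_lt_iff₀ hR, pow_succ] at hk2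
    exact mem_iUnion.2 ⟨k, hk1, by linarith⟩
  have hshell : ∀ k, ∫⁻ ζ in S k, (ENNReal.ofReal (homNorm ζ ^ ((D : ℝ) + a)))⁻¹
      ≤ ENNReal.ofReal (c * R ^ (-a) * (2 ^ (-a)) ^ k) := by
    intro k
    set X : ℝ := 2 ^ k * R with hX
    have hXpos : 0 < X := by positivity
    have hSm : MeasurableSet (S k) :=
      (measurableSet_le measurable_const measurable_homNorm).inter
        (measurableSet_le measurable_homNorm measurable_const)
    calc ∫⁻ ζ in S k, (ENNReal.ofReal (homNorm ζ ^ ((D : ℝ) + a)))⁻¹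
        ≤ ∫⁻ _ in S k, (ENNReal.ofReal (X ^ ((D : ℝ) + a)))⁻¹ := by
          refine setLIntegral_mono' hSm fun ζ hζ => ?_
          refine ENNReal.inv_le_inv.2 (ENNReal.ofReal_le_ofReal ?_)
          exact Real.rpow_le_rpow hXpos.le hζ.1 (by positivity)
      _ = (ENNReal.ofReal (X ^ ((D : ℝ) + a)))⁻¹ * volume (S k) := by
          rw [setLIntegral_const]
      _ ≤ (ENNReal.ofReal (X ^ ((D : ℝ) + a)))⁻¹ *
          ENNReal.ofReal (2 ^ (Fintype.card (Coord d) + 1) * (2 * X) ^ D) := by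
          gcongr
          exact (measure_mono fun ζ hζ => hζ.2).trans (volume_homNorm_le (by positivity))
      _ = ENNReal.ofReal (c * R ^ (-a) * (2 ^ (-a)) ^ k) := by
          rw [← ENNReal.ofReal_inv_of_pos (by positivity), ← ENNReal.ofReal_mul (by positivity)]
          congr 1
          have e1 : X ^ (-a) = R ^ (-a) * (2 ^ (-a)) ^ k := by
            rw [hX, Real.mul_rpow (by positivity) hR.le, mul_comm, ← Real.rpow_natCast,
              ← Real.rpow_natCast, ← Real.rpow_mul (by norm_num), ← Real.rpow_mul (by norm_num),
              mul_comm (k : ℝ)]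
          rw [mul_assoc, ← e1, hc, Real.rpow_add hXpos, Real.rpow_natCast, Real.rpow_neg hXpos.le,
            mul_pow 2 X D]
          have : X ^ a ≠ 0 := (Real.rpow_pos_of_pos hXpos a).ne'
          field_simp
  calc ∫⁻ ζ in {ζ : Pt d | R ≤ homNorm ζ}, (ENNReal.ofReal (homNorm ζ ^ ((D : ℝ) + a)))⁻¹
      ≤ ∫⁻ ζ in ⋃ k, S k, (ENNReal.ofReal (homNorm ζ ^ ((D : ℝ) + a)))⁻¹ :=
        lintegral_mono_set hcover
    _ ≤ ∑' k, ∫⁻ ζ in S k, (ENNReal.ofReal (homNorm ζ ^ ((D : ℝ) + a)))⁻¹ :=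
        lintegral_iUnion_le _ _
    _ ≤ ∑' k, ENNReal.ofReal (c * R ^ (-a) * (2 ^ (-a)) ^ k) := ENNReal.tsum_le_tsum hshell
    _ = ENNReal.ofReal (c * (1 - 2 ^ (-a))⁻¹ * R ^ (-a)) := by
        rw [← ENNReal.ofReal_tsum_of_nonneg (fun k => by positivity)
          ((summable_geometric_of_lt_one hq0 hq1).mul_left _), tsum_mul_left,
          tsum_geometric_of_lt_one hq0 hq1]
        congr 1
        ring

/-! ### Measurability of `L^p` norms depending on a parameter -/

lemma measurable_eLpNorm_of_uncurry {Θ Z : Type*} [MeasurableSpace Θ] [MeasurableSpace Z]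
    {ν : Measure Z} [SFinite ν] {p : ℝ≥0∞} {F : Θ → Z → ℝ}
    (hF : Measurable (Function.uncurry F)) (hp : 1 ≤ p) :
    Measurable fun θ => eLpNorm (F θ) p ν := by
  have hmeas : Measurable (fun w : Θ × Z => ‖F w.1 w.2‖ₑ) := hF.enorm
  rcases eq_or_ne p ∞ with rfl | hp'
  · simp_rw [eLpNorm_exponent_top]
    refine measurable_of_Iic fun b => ?_
    have e : (fun θ => eLpNormEssSup (F θ) ν) ⁻¹' Iic b =
        (fun θ => ν (Prod.mk θ ⁻¹' {w : Θ × Z | b < ‖F w.1 w.2‖ₑ})) ⁻¹' {0} := by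
      ext θ
      have h1 : (∀ᵐ z ∂ν, ‖F θ z‖ₑ ≤ b) ↔ ν {z | b < ‖F θ z‖ₑ} = 0 := by
        rw [ae_iff]
        simp only [not_le]
      simp only [mem_preimage, mem_Iic, mem_singleton_iff, preimage_ofPred_eq, ← h1]
      refine ⟨fun h => ?_, eLpNormEssSup_le_of_ae_enorm_bound⟩
      filter_upwards [enorm_ae_le_eLpNormEssSup (F θ) ν] with z hz
      exact hz.trans h
    rw [e]
    exact (measurable_measure_prodMk_left (measurableSet_lt measurable_const hmeas))
      (measurableSet_singleton 0)
  · have hp0 : p ≠ 0 := (zero_lt_one.trans_le hp).ne'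
    simp_rw [eLpNorm_eq_lintegral_rpow_enorm_toReal hp0 hp']
    exact ((hmeas.pow_const _).lintegral_prod_right').pow_const _

lemma IsFlow.measurable_increment {Φ : ℝ → Pt d → Pt d} {V : Pt d → Pt d} (hΦ : IsFlow Φ V)
    {p : ℝ≥0∞} (hp : 1 ≤ p) {u : Pt d → ℝ} (hu : AEStronglyMeasurable u volume) :
    Measurable fun h => eLpNorm (fun z => u (Φ h z) - u z) p volume := by
  have e : ∀ h, eLpNorm (fun z => u (Φ h z) - u z) p volume =
      eLpNorm (fun z => hu.mk u (Φ h z) - hu.mk u z) p volume := by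
    intro h
    refine eLpNorm_congr_ae ?_
    filter_upwards [hu.ae_eq_mk, (hΦ.measurePreserving h).quasiMeasurePreserving.ae hu.ae_eq_mk]
      with z h1 h2
    rw [h1, h2]
  simp_rw [e]
  refine measurable_eLpNorm_of_uncurry (F := fun h z => hu.mk u (Φ h z) - hu.mk u z) ?_ hp
  have hm := hu.stronglyMeasurable_mk.measurable
  exact (hm.comp hΦ.continuous.measurable).sub (hm.comp measurable_snd)

end

/-! ### Moduli of regularity -/

section

variable {r : ℕ} {d : Fin (r + 1) → ℕ}

variable (d) in
/-- The measure with density `‖ζ‖_B ^ (-𝐝 - s q)`. -/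
noncomputable def kernelMeasure (s : ℝ) (q : ℝ≥0∞) : Measure (Pt d) :=
  volume.withDensity fun ζ => (ENNReal.ofReal (homNorm ζ ^ ((homDim d : ℝ) + s * q.toReal)))⁻¹

/-- The scale `κ ‖ζ‖_B`. -/
noncomputable def scale (κ : ℝ≥0) (ζ : Pt d) : ℝ≥0 := κ * Real.toNNReal (homNorm ζ)

lemma coe_scale (κ : ℝ≥0) (ζ : Pt d) : (scale κ ζ : ℝ) = κ * homNorm ζ := by
  simp [scale, Real.coe_toNNReal _ (homNorm_nonneg ζ)]

lemma measurable_scale (κ : ℝ≥0) : Measurable (scale κ : Pt d → ℝ≥0) :=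
  measurable_homNorm.real_toNNReal.const_mul κ

lemma measurable_kernel (c : ℝ) :
    Measurable fun ζ : Pt d => (ENNReal.ofReal (homNorm ζ ^ c))⁻¹ :=
  (measurable_homNorm.pow_const c).ennreal_ofReal.inv

variable (d) in
/-- The size of a modulus `M`, measured in `L^q` with the weight of the Taylor estimate of order
`s`. -/
noncomputable def scaleNorm (κ : ℝ≥0) (s : ℝ) (q : ℝ≥0∞) (M : ℝ≥0 → ℝ≥0∞) : ℝ≥0∞ :=
  if q = ∞ then ⨆ (ζ : Pt d) (_ : ζ ≠ 0), M (scale κ ζ) / ENNReal.ofReal (homNorm ζ ^ s)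
  else (∫⁻ ζ : Pt d, M (scale κ ζ) ^ q.toReal ∂kernelMeasure d s q) ^ (1 / q.toReal)

lemma one_le_toReal {q : ℝ≥0∞} (hq : 1 ≤ q) (hq' : q ≠ ∞) : 1 ≤ q.toReal := by
  have := ENNReal.toReal_mono hq' hq
  simpa using this

section

variable {κ : ℝ≥0} {s : ℝ} {q : ℝ≥0∞} {M M' : ℝ≥0 → ℝ≥0∞}

lemma scaleNorm_add_le (hq : 1 ≤ q) (hM : Measurable M) (hM' : Measurable M') :
    scaleNorm d κ s q (M + M') ≤ scaleNorm d κ s q M + scaleNorm d κ s q M' := by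
  by_cases hq' : q = ∞
  · simp only [scaleNorm, if_pos hq']
    refine iSup₂_le fun ζ hζ => ?_
    rw [Pi.add_apply, ENNReal.add_div]
    exact add_le_add
      (le_iSup₂ (f := fun (ζ : Pt d) (_ : ζ ≠ 0) =>
        M (scale κ ζ) / ENNReal.ofReal (homNorm ζ ^ s)) ζ hζ)
      (le_iSup₂ (f := fun (ζ : Pt d) (_ : ζ ≠ 0) =>
        M' (scale κ ζ) / ENNReal.ofReal (homNorm ζ ^ s)) ζ hζ)
  · simp only [scaleNorm, if_neg hq']
    exact ENNReal.lintegral_Lp_add_le (hM.comp (measurable_scale κ)).aemeasurable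
      (hM'.comp (measurable_scale κ)).aemeasurable (one_le_toReal hq hq')

lemma scaleNorm_zero (hq : 1 ≤ q) : scaleNorm d κ s q 0 = 0 := by
  by_cases hq' : q = ∞
  · simp [scaleNorm, if_pos hq']
  · have h1 := zero_lt_one.trans_le (one_le_toReal hq hq')
    simp [scaleNorm, ENNReal.zero_rpow_of_pos h1, h1]

lemma scaleNorm_sum_le (hq : 1 ≤ q) {ι : Type*} (t : Finset ι) {M : ι → ℝ≥0 → ℝ≥0∞}
    (hM : ∀ i, Measurable (M i)) :
    scaleNorm d κ s q (∑ i ∈ t, M i) ≤ ∑ i ∈ t, scaleNorm d κ s q (M i) := by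
  classical
  induction t using Finset.induction_on with
  | empty => simp [scaleNorm_zero hq]
  | insert j t hj ih =>
    rw [Finset.sum_insert hj, Finset.sum_insert hj]
    have hs : Measurable (∑ i ∈ t, M i) := by
      rw [Finset.sum_fn]
      exact Finset.measurable_fun_sum t fun i _ => hM i
    exact (scaleNorm_add_le hq (hM j) hs).trans (add_le_add le_rfl ih)

end

/-- A subadditive function is controlled by its averages over longer intervals: for each `x`, one
of `F x`, `F (h - x)` is at least `F h / 2`. -/
lemma rpow_le_average_of_subadditive {F : ℝ → ℝ≥0∞} (hF : Measurable F)
    (hsub : ∀ h h', F h ≤ F h' + F (h - h')) {Q : ℝ} (hQ : 1 ≤ Q) {R : ℝ} (hR : 0 < R) {h : ℝ}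
    (hh : |h| ≤ R) :
    F h ^ Q ≤ 2 ^ (Q - 1) * (ENNReal.ofReal R)⁻¹ * ∫⁻ x in Icc (-(2 * R)) (2 * R), F x ^ Q := by
  set J := ∫⁻ x in Icc (-(2 * R)) (2 * R), F x ^ Q with hJ
  have hR0 : ENNReal.ofReal R ≠ 0 := (ENNReal.ofReal_pos.2 hR).ne'
  have h1 : ∫⁻ x in Icc (-R) R, F x ^ Q ≤ J :=
    lintegral_mono_set (Icc_subset_Icc (by linarith) (by linarith))
  have h2 : ∫⁻ x in Icc (-R) R, F (h - x) ^ Q ≤ J := by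
    rw [← lintegral_indicator measurableSet_Icc, hJ, ← lintegral_indicator measurableSet_Icc]
    refine (lintegral_sub_left_eq_self
      ((Icc (-R) R).indicator fun x => F (h - x) ^ Q) h).symm.le.trans (lintegral_mono fun x => ?_)
    by_cases hx : h - x ∈ Icc (-R) R
    · have hx' : x ∈ Icc (-(2 * R)) (2 * R) := by
        have := abs_le.1 hh
        exact ⟨by linarith [hx.2], by linarith [hx.1]⟩
      rw [indicator_of_mem hx, indicator_of_mem hx', sub_sub_cancel]
    · rw [indicator_of_notMem hx]
      exact zero_le
  have h3 : F h ^ Q * (2 * ENNReal.ofReal R) ≤ 2 ^ (Q - 1) * (J + J) := by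
    calc F h ^ Q * (2 * ENNReal.ofReal R) = ∫⁻ _ in Icc (-R) R, F h ^ Q := by
          rw [setLIntegral_const, Real.volume_Icc, sub_neg_eq_add, ← two_mul,
            ENNReal.ofReal_mul (by norm_num), ENNReal.ofReal_ofNat]
      _ ≤ ∫⁻ x in Icc (-R) R, 2 ^ (Q - 1) * (F x ^ Q + F (h - x) ^ Q) := by
          refine lintegral_mono fun x => ?_
          refine (ENNReal.rpow_le_rpow (hsub h x) (by linarith)).trans ?_
          exact ENNReal.rpow_add_le_mul_rpow_add_rpow _ _ hQ
      _ = 2 ^ (Q - 1) * (∫⁻ x in Icc (-R) R, F x ^ Q + F (h - x) ^ Q) :=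
          lintegral_const_mul _
            ((hF.pow_const Q).add ((hF.comp (measurable_const.sub measurable_id)).pow_const Q))
      _ = 2 ^ (Q - 1) * ((∫⁻ x in Icc (-R) R, F x ^ Q) + ∫⁻ x in Icc (-R) R, F (h - x) ^ Q) := by
          rw [lintegral_add_left (hF.pow_const Q)]
      _ ≤ 2 ^ (Q - 1) * (J + J) := by gcongr
  have h4 : F h ^ Q ≤ 2 ^ (Q - 1) * (J + J) / (2 * ENNReal.ofReal R) := by
    rw [ENNReal.le_div_iff_mul_le (Or.inl (by simp [hR0]))
      (Or.inl (ENNReal.mul_ne_top (by simp) ENNReal.ofReal_ne_top))]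
    exact h3
  refine h4.trans (le_of_eq ?_)
  rw [← two_mul, mul_left_comm, ENNReal.mul_div_mul_left _ _ (by simp) (by simp), div_eq_mul_inv]
  ring

section Flow

variable {Φ : ℝ → Pt d → Pt d} {V : Pt d → Pt d} {p q : ℝ≥0∞}

lemma IsFlow.increment_subadditive (hΦ : IsFlow Φ V) (hp : 1 ≤ p) {u : Pt d → ℝ}
    (hu : AEStronglyMeasurable u volume) (h h' : ℝ) :
    eLpNorm (fun z => u (Φ h z) - u z) p volume ≤ eLpNorm (fun z => u (Φ h' z) - u z) p volume +
      eLpNorm (fun z => u (Φ (h - h') z) - u z) p volume := by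
  have h1 : ∀ t, AEStronglyMeasurable (fun z => u (Φ t z) - u z) volume := fun t =>
    (hΦ.aestronglyMeasurable hu t).sub hu
  rw [← hΦ.eLpNorm_comp (h1 (h - h')) h']
  refine le_trans (le_of_eq ?_) (eLpNorm_add_le (h1 h') (hΦ.aestronglyMeasurable (h1 (h - h')) h') hp)
  congr 1
  ext z
  simp only [Pi.add_apply, ← hΦ.add, sub_add_cancel]
  ring

lemma IsFlow.increment_zero (hΦ : IsFlow Φ V) (u : Pt d → ℝ) :
    eLpNorm (fun z => u (Φ 0 z) - u z) p volume = 0 := by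
  simp [hΦ.zero]

/-- For `q = ∞` the modulus is `ρ ^ s` times the quasi-norm. -/
lemma IsFlow.exists_modulus_top (hΦ : IsFlow Φ V) (κ : ℝ≥0) {s : ℝ} (hs : 0 < s) {m : ℕ}
    (hm : 0 < m) (e : ℕ) (u : Pt d → ℝ) :
    ∃ M : ℝ≥0 → ℝ≥0∞, Measurable M ∧
      (∀ ρ : ℝ≥0, 0 < ρ → ∀ h : ℝ, |h| ≤ (ρ : ℝ) ^ m →
        eLpNorm (fun z => u (Φ h z) - u z) p volume ≤ (ρ : ℝ≥0∞) ^ e * M ρ) ∧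
      scaleNorm d κ s ∞ M ≤ (κ ^ s : ℝ≥0) * dirSeminorm Φ m (e + s) p ∞ u := by
  set S := dirSeminorm Φ m (e + s) p ∞ u with hS
  have hm' : (0 : ℝ) < m := by exact_mod_cast hm
  refine ⟨fun ρ => ENNReal.ofReal ((ρ : ℝ) ^ s) * S, ?_, fun ρ hρ h hh => ?_, ?_⟩
  · exact (measurable_coe_nnreal_real.pow_const s).ennreal_ofReal.mul_const S
  · have hρ' : (0 : ℝ) < ρ := hρ
    rcases eq_or_ne h 0 with rfl | hh0
    · rw [hΦ.increment_zero]
      exact zero_le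
    · have h1 : eLpNorm (fun z => u (Φ h z) - u z) p volume /
          ENNReal.ofReal (|h| ^ (((e : ℝ) + s) / m)) ≤ S := by
        rw [hS, dirSeminorm, if_pos rfl]
        exact le_iSup₂ (f := fun (h : ℝ) (_ : h ≠ 0) => eLpNorm (fun z => u (Φ h z) - u z) p volume /
          ENNReal.ofReal (|h| ^ (((e : ℝ) + s) / m))) h hh0
      have h2 : 0 < |h| ^ (((e : ℝ) + s) / m) := Real.rpow_pos_of_pos (abs_pos.2 hh0) _
      rw [ENNReal.div_le_iff (ENNReal.ofReal_pos.2 h2).ne' ENNReal.ofReal_ne_top] at h1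
      have h3 : |h| ^ (((e : ℝ) + s) / m) ≤ (ρ : ℝ) ^ e * (ρ : ℝ) ^ s := by
        refine (Real.rpow_le_rpow (abs_nonneg h) hh (by positivity)).trans (le_of_eq ?_)
        rw [← Real.rpow_natCast _ m, ← Real.rpow_mul hρ'.le, mul_div_cancel₀ _ hm'.ne',
          Real.rpow_add hρ', Real.rpow_natCast]
      calc _ ≤ S * ENNReal.ofReal (|h| ^ (((e : ℝ) + s) / m)) := h1
        _ ≤ S * ENNReal.ofReal ((ρ : ℝ) ^ e * (ρ : ℝ) ^ s) := by gcongr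
        _ = _ := by
          rw [ENNReal.ofReal_mul (by positivity), ENNReal.ofReal_pow hρ'.le,
            ENNReal.ofReal_coe_nnreal]
          ring
  · rw [scaleNorm, if_pos rfl]
    refine iSup₂_le fun ζ hζ => ?_
    have hH := homNorm_pos hζ
    have hpos : 0 < homNorm ζ ^ s := Real.rpow_pos_of_pos hH s
    refine ENNReal.div_le_of_le_mul (le_of_eq ?_)
    rw [coe_scale, Real.mul_rpow κ.coe_nonneg hH.le, ENNReal.ofReal_mul (by positivity),
      ← NNReal.coe_rpow, ENNReal.ofReal_coe_nnreal]
    ring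

/-- For `q < ∞` the modulus at the scale `ρ` is an `L^q` average of the increments over
`|h| ≤ 2 ρ ^ m`, divided by `ρ ^ e`. By Tonelli's theorem its size is an integral over `h` of the
increments against the tail `∫ ‖ζ‖_B ^ (-𝐝 - a)` over `κ ‖ζ‖_B ≥ (|h| / 2) ^ (1 / m)`, with
`a = m + (e + s) q`. -/
lemma IsFlow.exists_modulus_of_ne_top (hΦ : IsFlow Φ V) (hp : 1 ≤ p) (hq : 1 ≤ q) (hq' : q ≠ ∞)
    {κ : ℝ≥0} (hκ : 0 < κ) {s : ℝ} (hs : 0 < s) {m : ℕ} (hm : 0 < m) (e : ℕ) :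
    ∃ C : ℝ≥0, ∀ u : Pt d → ℝ, AEStronglyMeasurable u volume → ∃ M : ℝ≥0 → ℝ≥0∞, Measurable M ∧
      (∀ ρ : ℝ≥0, 0 < ρ → ∀ h : ℝ, |h| ≤ (ρ : ℝ) ^ m →
        eLpNorm (fun z => u (Φ h z) - u z) p volume ≤ (ρ : ℝ≥0∞) ^ e * M ρ) ∧
      scaleNorm d κ s q M ≤ C * dirSeminorm Φ m (e + s) p q u := by
  set Q := q.toReal with hQ
  have hQ1 : 1 ≤ Q := one_le_toReal hq hq'
  have hQ0 : 0 < Q := by linarith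
  have hm' : (0 : ℝ) < m := by exact_mod_cast hm
  have hκ' : (0 : ℝ) < κ := hκ
  set a : ℝ := m + (e + s) * Q with ha
  have ha0 : 0 < a := by positivity
  obtain ⟨C₀, hC₀, hker⟩ := exists_lintegral_homNorm_le (d := d) ha0
  set c₁ : ℝ≥0∞ := 2 ^ (Q - 1) * (ENNReal.ofReal ((κ : ℝ) ^ ((m : ℝ) + e * Q)))⁻¹ with hc₁
  have hc₁top : c₁ ≠ ∞ := by
    refine ENNReal.mul_ne_top (ENNReal.rpow_ne_top_of_nonneg (by linarith) (by simp)) ?_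
    exact ENNReal.inv_ne_top.2 (ENNReal.ofReal_pos.2 (Real.rpow_pos_of_pos hκ' _)).ne'
  set c₂ : ℝ≥0∞ := c₁ * ENNReal.ofReal (C₀ * (2 ^ (a / m) * (κ : ℝ) ^ a)) with hc₂
  have hc₂top : c₂ ≠ ∞ := ENNReal.mul_ne_top hc₁top ENNReal.ofReal_ne_top
  refine ⟨c₂.toNNReal ^ (1 / Q), fun u hu => ?_⟩
  set F : ℝ → ℝ≥0∞ := fun h => eLpNorm (fun z => u (Φ h z) - u z) p volume with hF
  have hFm : Measurable F := hΦ.measurable_increment hp hu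
  have hF0 : F 0 = 0 := hΦ.increment_zero u
  set J : ℝ≥0 → ℝ≥0∞ := fun ρ => ∫⁻ x in Icc (-(2 * (ρ : ℝ) ^ m)) (2 * (ρ : ℝ) ^ m), F x ^ Q with hJ
  have hJm : Measurable J := by
    refine Monotone.measurable fun ρ ρ' hρ => lintegral_mono_set ?_
    have : (ρ : ℝ) ^ m ≤ (ρ' : ℝ) ^ m := pow_le_pow_left₀ ρ.coe_nonneg (by exact_mod_cast hρ) m
    exact Icc_subset_Icc (by linarith) (by linarith)
  set M : ℝ≥0 → ℝ≥0∞ := fun ρ =>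
    (2 ^ (Q - 1) * (ENNReal.ofReal ((ρ : ℝ) ^ ((m : ℝ) + e * Q)))⁻¹ * J ρ) ^ (1 / Q) with hM
  have hMm : Measurable M := by
    refine Measurable.pow_const (Measurable.mul (Measurable.const_mul ?_ _) hJm) _
    exact (measurable_coe_nnreal_real.pow_const _).ennreal_ofReal.inv
  have hMQ : ∀ ρ, M ρ ^ Q = 2 ^ (Q - 1) * (ENNReal.ofReal ((ρ : ℝ) ^ ((m : ℝ) + e * Q)))⁻¹ * J ρ := by
    intro ρ
    rw [hM, ← ENNReal.rpow_mul, one_div_mul_cancel hQ0.ne', ENNReal.rpow_one]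
  refine ⟨M, hMm, fun ρ hρ h hh => ?_, ?_⟩
  · have hρ' : (0 : ℝ) < ρ := hρ
    have h1 := rpow_le_average_of_subadditive hFm (hΦ.increment_subadditive hp hu) hQ1
      (pow_pos hρ' m) hh
    rw [← ENNReal.rpow_le_rpow_iff hQ0, ENNReal.mul_rpow_of_nonneg _ _ hQ0.le, hMQ]
    refine h1.trans (le_of_eq ?_)
    have e1 : ((ρ : ℝ≥0∞) ^ e) ^ Q = ENNReal.ofReal ((ρ : ℝ) ^ ((e : ℝ) * Q)) := by
      rw [← ENNReal.ofReal_coe_nnreal, ← ENNReal.ofReal_pow hρ'.le,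
        ENNReal.ofReal_rpow_of_pos (by positivity), ← Real.rpow_natCast, ← Real.rpow_mul hρ'.le]
    have hpos : 0 < (ρ : ℝ) ^ ((e : ℝ) * Q) := Real.rpow_pos_of_pos hρ' _
    have e2 : (ENNReal.ofReal ((ρ : ℝ) ^ m))⁻¹ = ENNReal.ofReal ((ρ : ℝ) ^ ((e : ℝ) * Q)) *
        (ENNReal.ofReal ((ρ : ℝ) ^ ((m : ℝ) + e * Q)))⁻¹ := by
      rw [← ENNReal.ofReal_inv_of_pos (by positivity),
        ← ENNReal.ofReal_inv_of_pos (Real.rpow_pos_of_pos hρ' _), ← ENNReal.ofReal_mul hpos.le,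
        Real.rpow_add hρ', Real.rpow_natCast]
      congr 1
      field_simp
    rw [e1, e2]
    ring
  · -- after exchanging the integrals, the inner one is over `{ζ : |h| ≤ 2 (κ ‖ζ‖) ^ m}`
    have hkm : Measurable fun ζ : Pt d => (ENNReal.ofReal (homNorm ζ ^ ((homDim d : ℝ) + a)))⁻¹ :=
      measurable_kernel _
    set T : Set (Pt d × ℝ) := {w | |w.2| ≤ 2 * ((κ : ℝ) * homNorm w.1) ^ m} with hT
    have hTm : MeasurableSet T :=
      measurableSet_le measurable_snd.abs
        ((((measurable_homNorm.comp measurable_fst).const_mul _).pow_const m).const_mul 2)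
    have hTζ : ∀ ζ : Pt d, (Prod.mk ζ ⁻¹' T) =
        Icc (-(2 * (scale κ ζ : ℝ) ^ m)) (2 * (scale κ ζ : ℝ) ^ m) := by
      intro ζ
      ext h
      simp [hT, coe_scale, abs_le]
    set G : Pt d → ℝ → ℝ≥0∞ := fun ζ h => (ENNReal.ofReal (homNorm ζ ^ ((homDim d : ℝ) + a)))⁻¹ *
      T.indicator (fun w => F w.2 ^ Q) (ζ, h) with hG
    have hGm : Measurable (Function.uncurry G) :=
      (hkm.comp measurable_fst).mul (((hFm.comp measurable_snd).pow_const Q).indicator hTm)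
    have hstep1 : ∫⁻ ζ : Pt d, M (scale κ ζ) ^ Q ∂kernelMeasure d s q ≤
        c₁ * ∫⁻ ζ : Pt d, ∫⁻ h, G ζ h := by
      rw [kernelMeasure, lintegral_withDensity_eq_lintegral_mul _ (measurable_kernel _)
        (show Measurable fun ζ : Pt d => M (scale κ ζ) ^ Q from
          (hMm.comp (measurable_scale κ)).pow_const Q), ← lintegral_const_mul _
        (show Measurable fun ζ : Pt d => ∫⁻ h, G ζ h from hGm.lintegral_prod_right')]
      refine lintegral_mono fun ζ => ?_
      have hGJ : ∫⁻ h, G ζ h = (ENNReal.ofReal (homNorm ζ ^ ((homDim d : ℝ) + a)))⁻¹ *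
          J (scale κ ζ) := by
        have e3 : ∀ h, T.indicator (fun w => F w.2 ^ Q) (ζ, h) =
            (Icc (-(2 * (scale κ ζ : ℝ) ^ m)) (2 * (scale κ ζ : ℝ) ^ m)).indicator
              (fun h => F h ^ Q) h := by
          intro h
          rw [← hTζ]
          rfl
        simp only [hG, e3]
        rw [lintegral_const_mul _ ((hFm.pow_const Q).indicator measurableSet_Icc),
          lintegral_indicator measurableSet_Icc]
      rw [hGJ, Pi.mul_apply]
      beta_reduce
      rw [hMQ, coe_scale]
      rcases (homNorm_nonneg ζ).eq_or_lt with h0 | hH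
      · have hJ0 : J (scale κ ζ) = 0 := by
          have : (scale κ ζ : ℝ) = 0 := by rw [coe_scale, ← h0, mul_zero]
          rw [hJ]
          beta_reduce
          rw [this, zero_pow hm.ne']
          simp
        rw [hJ0]
        simp
      · have hpos : ∀ y : ℝ, 0 < homNorm ζ ^ y := fun y => Real.rpow_pos_of_pos hH y
        have hposκ : 0 < (κ : ℝ) ^ ((m : ℝ) + e * Q) := Real.rpow_pos_of_pos hκ' _
        have e4 : (ENNReal.ofReal (homNorm ζ ^ ((homDim d : ℝ) + s * Q)))⁻¹ *
            (ENNReal.ofReal (((κ : ℝ) * homNorm ζ) ^ ((m : ℝ) + e * Q)))⁻¹ =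
            (ENNReal.ofReal ((κ : ℝ) ^ ((m : ℝ) + e * Q)))⁻¹ *
            (ENNReal.ofReal (homNorm ζ ^ ((homDim d : ℝ) + a)))⁻¹ := by
          rw [Real.mul_rpow hκ'.le hH.le, ← ENNReal.ofReal_inv_of_pos (hpos _),
            ← ENNReal.ofReal_inv_of_pos (mul_pos hposκ (hpos _)),
            ← ENNReal.ofReal_inv_of_pos hposκ, ← ENNReal.ofReal_inv_of_pos (hpos _),
            ← ENNReal.ofReal_mul (inv_nonneg.2 (hpos _).le),
            ← ENNReal.ofReal_mul (inv_nonneg.2 hposκ.le)]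
          congr 1
          have e5 : (homDim d : ℝ) + a = ((homDim d : ℝ) + s * Q) + ((m : ℝ) + e * Q) := by
            rw [ha]
            ring
          rw [e5, Real.rpow_add hH _ ((m : ℝ) + e * Q), mul_inv, mul_inv]
          ring
        refine le_of_eq ?_
        calc _ = 2 ^ (Q - 1) * ((ENNReal.ofReal (homNorm ζ ^ ((homDim d : ℝ) + s * Q)))⁻¹ *
            (ENNReal.ofReal (((κ : ℝ) * homNorm ζ) ^ ((m : ℝ) + e * Q)))⁻¹) * J (scale κ ζ) := by
              ring
          _ = _ := by
              rw [e4, hc₁]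
              ring
    have hstep2 : ∀ h, ∫⁻ ζ : Pt d, G ζ h ≤ ENNReal.ofReal (C₀ * (2 ^ (a / m) * (κ : ℝ) ^ a)) *
        (F h ^ Q / ENNReal.ofReal (|h| ^ (1 + Q * (((e : ℝ) + s) / m)))) := by
      intro h
      rcases eq_or_ne h 0 with rfl | hh
      · have : ∀ ζ : Pt d, G ζ 0 = 0 := by
          intro ζ
          simp [hG, indicator_apply, hF0, ENNReal.zero_rpow_of_pos hQ0]
        simp [this]
      · have hh' : 0 < |h| := abs_pos.2 hh
        set R : ℝ := (|h| / 2) ^ (1 / (m : ℝ)) / κ with hR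
        have hR0 : 0 < R := by positivity
        have hset : ∀ ζ : Pt d, (ζ, h) ∈ T ↔ R ≤ homNorm ζ := by
          intro ζ
          have hH := homNorm_nonneg ζ
          simp only [hT, mem_ofPred_eq]
          rw [hR, div_le_iff₀ hκ', mul_comm (homNorm ζ), one_div,
            Real.rpow_inv_le_iff_of_pos (by positivity) (by positivity) hm', Real.rpow_natCast,
            div_le_iff₀ (by norm_num), mul_comm (2 : ℝ)]
        have hSm : MeasurableSet {ζ : Pt d | R ≤ homNorm ζ} :=
          measurableSet_le measurable_const measurable_homNorm
        have e6 : ∀ ζ : Pt d, G ζ h = F h ^ Q * {ζ : Pt d | R ≤ homNorm ζ}.indicator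
            (fun ζ => (ENNReal.ofReal (homNorm ζ ^ ((homDim d : ℝ) + a)))⁻¹) ζ := by
          intro ζ
          by_cases hζ : R ≤ homNorm ζ
          · rw [indicator_of_mem (show ζ ∈ {ζ : Pt d | R ≤ homNorm ζ} from hζ), hG]
            beta_reduce
            rw [indicator_of_mem ((hset ζ).2 hζ), mul_comm]
          · rw [indicator_of_notMem (show ζ ∉ {ζ : Pt d | R ≤ homNorm ζ} from hζ), hG]
            beta_reduce
            rw [indicator_of_notMem (mt (hset ζ).1 hζ), mul_zero, mul_zero]
        simp_rw [e6]
        rw [lintegral_const_mul _ (hkm.indicator hSm), lintegral_indicator hSm]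
        refine (mul_le_mul' le_rfl (hker R hR0)).trans (le_of_eq ?_)
        have hpw : 0 < |h| ^ (1 + Q * (((e : ℝ) + s) / m)) := Real.rpow_pos_of_pos hh' _
        have e7 : R ^ (-a) = 2 ^ (a / m) * (κ : ℝ) ^ a *
            (|h| ^ (1 + Q * (((e : ℝ) + s) / m)))⁻¹ := by
          have e8 : 1 + Q * (((e : ℝ) + s) / m) = a / m := by
            rw [ha]
            field_simp
          rw [e8, Real.rpow_neg hR0.le, hR, Real.div_rpow (by positivity) hκ'.le,
            ← Real.rpow_mul (by positivity), one_div_mul_eq_div,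
            Real.div_rpow hh'.le (by norm_num)]
          have p1 : 0 < |h| ^ (a / m) := Real.rpow_pos_of_pos hh' _
          have p2 : 0 < (2 : ℝ) ^ (a / m) := Real.rpow_pos_of_pos (by norm_num) _
          have p3 : 0 < (κ : ℝ) ^ a := Real.rpow_pos_of_pos hκ' _
          field_simp
        rw [e7, ← mul_assoc, ENNReal.ofReal_mul (by positivity), ENNReal.ofReal_inv_of_pos hpw,
          ENNReal.div_eq_inv_mul]
        ring
    rw [scaleNorm, if_neg hq', dirSeminorm, if_neg hq']
    have hfin : ∫⁻ ζ : Pt d, M (scale κ ζ) ^ Q ∂kernelMeasure d s q ≤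
        c₂ * ∫⁻ h, F h ^ Q / ENNReal.ofReal (|h| ^ (1 + Q * (((e : ℝ) + s) / m))) := by
      have hm3 : Measurable fun h : ℝ =>
          F h ^ Q / ENNReal.ofReal (|h| ^ (1 + Q * (((e : ℝ) + s) / m))) :=
        (hFm.pow_const Q).div (measurable_id.abs.pow_const _).ennreal_ofReal
      refine hstep1.trans ?_
      rw [hc₂, mul_assoc c₁]
      refine mul_le_mul' le_rfl ?_
      rw [lintegral_lintegral_swap hGm.aemeasurable, ← lintegral_const_mul _ hm3]
      exact lintegral_mono hstep2
    refine (ENNReal.rpow_le_rpow hfin (by positivity)).trans (le_of_eq ?_)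
    rw [ENNReal.mul_rpow_of_nonneg _ _ (by positivity), ENNReal.coe_rpow_of_nonneg _ (by positivity),
      ENNReal.coe_toNNReal hc₂top]

/-- A Besov quasi-norm along a flow controls the increments along that flow at all scales by a
modulus. -/
lemma IsFlow.exists_modulus (hΦ : IsFlow Φ V) (hp : 1 ≤ p) (hq : 1 ≤ q)
    {κ : ℝ≥0} (hκ : 0 < κ) {s : ℝ} (hs : 0 < s) {m : ℕ} (hm : 0 < m) (e : ℕ) :
    ∃ C : ℝ≥0, ∀ u : Pt d → ℝ, AEStronglyMeasurable u volume → ∃ M : ℝ≥0 → ℝ≥0∞, Measurable M ∧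
      (∀ ρ : ℝ≥0, 0 < ρ → ∀ h : ℝ, |h| ≤ (ρ : ℝ) ^ m →
        eLpNorm (fun z => u (Φ h z) - u z) p volume ≤ (ρ : ℝ≥0∞) ^ e * M ρ) ∧
      scaleNorm d κ s q M ≤ C * dirSeminorm Φ m (e + s) p q u := by
  by_cases hq' : q = ∞
  · subst hq'
    exact ⟨κ ^ s, fun u _ => hΦ.exists_modulus_top κ hs hm e u⟩
  · exact hΦ.exists_modulus_of_ne_top hp hq hq' hκ hs hm e

end Flow

end

/-! ### Besov quasi-norms and the scale of regularity -/

section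

section Congr

variable {r : ℕ} {d : Fin (r + 1) → ℕ} {B : Matrix (Coord d) (Coord d) ℝ} {p q : ℝ≥0∞}
  {u u' : Pt d → ℝ}

lemma IsFlow.dirSeminorm_congr {Φ V} (hΦ : IsFlow Φ V) (m σ : ℝ) (h : u =ᵐ[volume] u') :
    dirSeminorm Φ m σ p q u = dirSeminorm Φ m σ p q u' := by
  have h1 : ∀ t, eLpNorm (fun z => u (Φ t z) - u z) p volume =
      eLpNorm (fun z => u' (Φ t z) - u' z) p volume := by
    intro t
    refine eLpNorm_congr_ae ?_
    filter_upwards [h, (hΦ.measurePreserving t).quasiMeasurePreserving.ae h] with z hz hz'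
    rw [hz, hz']
  simp only [dirSeminorm, h1]

lemma isWeak_congr_left_iff {A : (Pt d → ℝ) → Pt d → ℝ} {v : Pt d → ℝ} (h : u =ᵐ[volume] u') :
    IsWeak A u v ↔ IsWeak A u' v :=
  ⟨fun hw => hw.congr_left h, fun hw => hw.congr_left h.symm⟩

lemma besovSeminorm_congr (hB : IsBlockMatrix d B) {s : ℝ} (n : ℕ) (h : u =ᵐ[volume] u') :
    besovSeminorm B s p q n u = besovSeminorm B s p q n u' := by
  have hX : ∀ (i : Fin (d 0)) (F : (Pt d → ℝ) → ℝ≥0∞),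
      (⨅ (v : Pt d → ℝ) (_ : IsWeakDX ⟨0, i⟩ u v), F v) =
        ⨅ (v : Pt d → ℝ) (_ : IsWeakDX ⟨0, i⟩ u' v), F v := fun i F =>
    iInf_congr fun v => iInf_congr_Prop (isWeak_congr_left_iff h) fun _ => rfl
  match n with
  | 0 =>
    simp only [besovSeminorm, seminormX, seminormY, (isFlow_flowX _).dirSeminorm_congr _ _ h,
      hB.isFlow_flowY.dirSeminorm_congr _ _ h]
  | 1 =>
    simp only [besovSeminorm, hX, seminormY, hB.isFlow_flowY.dirSeminorm_congr _ _ h]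
  | n + 2 =>
    have hY : (⨅ (v : Pt d → ℝ) (_ : IsWeakDY B u v), besovSeminorm B s p q n v) =
        ⨅ (v : Pt d → ℝ) (_ : IsWeakDY B u' v), besovSeminorm B s p q n v :=
      iInf_congr fun v => iInf_congr_Prop (isWeak_congr_left_iff h) fun _ => rfl
    simp only [besovSeminorm, hX, hY]

/-- By uniqueness of weak derivatives, the infima in the definition of `besovSeminorm` are
attained. -/
lemma exists_isWeak_eq_iInf {A : (Pt d → ℝ) → Pt d → ℝ} {F : (Pt d → ℝ) → ℝ≥0∞}
    (hF : ∀ v v', v =ᵐ[volume] v' → F v = F v')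
    (h : ⨅ (v : Pt d → ℝ) (_ : IsWeak A u v), F v < ∞) :
    ∃ v, IsWeak A u v ∧ F v = ⨅ (v : Pt d → ℝ) (_ : IsWeak A u v), F v := by
  obtain ⟨v, hv⟩ := iInf_lt_iff.1 h
  obtain ⟨hw, -⟩ := iInf_lt_iff.1 hv
  exact ⟨v, hw, le_antisymm (le_iInf₂ fun v' hw' => (hF v v' (hw.ae_unique hw')).le)
    (iInf₂_le v hw)⟩

end Congr

section Modulus

variable {r : ℕ} {d : Fin (r + 1) → ℕ} {B : Matrix (Coord d) (Coord d) ℝ} {p q : ℝ≥0∞}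
  {κ : ℝ≥0} {s : ℝ}

lemma exists_modulus_sum_add (hq : 1 ≤ q) {ι : Type*} [Fintype ι] {C : ℝ≥0∞} {a : ι → ℝ≥0∞}
    {b : ℝ≥0∞} {MX : ι → ℝ≥0 → ℝ≥0∞} {MY : ℝ≥0 → ℝ≥0∞} (hX : ∀ i, Measurable (MX i))
    (hY : Measurable MY) (haX : ∀ i, scaleNorm d κ s q (MX i) ≤ C * a i)
    (hbY : scaleNorm d κ s q MY ≤ C * b) :
    ∃ M : ℝ≥0 → ℝ≥0∞, Measurable M ∧ (∀ i ρ, MX i ρ ≤ M ρ) ∧ (∀ ρ, MY ρ ≤ M ρ) ∧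
      scaleNorm d κ s q M ≤ C * (∑ i, a i + b) := by
  have hs : Measurable (∑ i, MX i) := by
    rw [Finset.sum_fn]
    exact Finset.measurable_fun_sum _ fun i _ => hX i
  refine ⟨∑ i, MX i + MY, hs.add hY, fun i ρ => ?_, fun ρ => ?_, ?_⟩
  · rw [Pi.add_apply, Finset.sum_apply]
    exact (Finset.single_le_sum (f := fun i => MX i ρ) (fun _ _ => zero_le)
      (Finset.mem_univ i)).trans le_self_add
  · rw [Pi.add_apply]
    exact le_add_self
  · rw [mul_add, Finset.mul_sum]
    exact (scaleNorm_add_le hq hs hY).trans (add_le_add ((scaleNorm_sum_le hq _ hX).trans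
      (Finset.sum_le_sum fun i _ => haX i)) hbY)

lemma exists_scaleBound_zero (hB : IsBlockMatrix d B) (hp : 1 ≤ p) (hq : 1 ≤ q) (hκ : 0 < κ)
    (hs : 0 < s) :
    ∃ C : ℝ≥0, ∀ u : Pt d → ℝ, LocallyIntegrable u volume → besovSeminorm B s p q 0 u < ∞ →
      ∃ M : ℝ≥0 → ℝ≥0∞, Measurable M ∧ (∀ ρ : ℝ≥0, 0 < ρ → ScaleBound B p ρ 0 u (M ρ)) ∧
        scaleNorm d κ s q M ≤ C * besovSeminorm B s p q 0 u := by
  choose CX hCX using fun i : Fin (d 0) =>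
    (isFlow_flowX (⟨0, i⟩ : Coord d)).exists_modulus hp hq hκ hs one_pos 0
  obtain ⟨CY, hCY⟩ := hB.isFlow_flowY.exists_modulus hp hq hκ hs two_pos 0
  simp only [Nat.cast_zero, Nat.cast_one, Nat.cast_ofNat, zero_add, pow_zero, one_mul, pow_one]
    at hCX hCY
  refine ⟨∑ i, CX i + CY, fun u hu _ => ?_⟩
  choose MX hMXm hMX hMXs using fun i => hCX i u hu.aestronglyMeasurable
  obtain ⟨MY, hMYm, hMY, hMYs⟩ := hCY u hu.aestronglyMeasurable
  obtain ⟨M, hMm, hMX', hMY', hMs⟩ := exists_modulus_sum_add hq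
    (C := ((∑ i, CX i + CY : ℝ≥0) : ℝ≥0∞)) hMXm hMYm
    (fun i => (hMXs i).trans (mul_le_mul' (ENNReal.coe_le_coe.2
      ((Finset.single_le_sum (fun _ _ => zero_le) (Finset.mem_univ i)).trans
        le_self_add)) le_rfl))
    (hMYs.trans (mul_le_mul' (ENNReal.coe_le_coe.2 le_add_self) le_rfl))
  exact ⟨M, hMm, fun ρ hρ => ⟨hu, fun i h hh => (hMX i ρ hρ h hh).trans (hMX' i ρ),
    fun h hh => (hMY ρ hρ h hh).trans (hMY' ρ)⟩, hMs⟩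

lemma exists_scaleBound_one (hB : IsBlockMatrix d B) (hp : 1 ≤ p) (hq : 1 ≤ q) (hκ : 0 < κ)
    (hs : 0 < s) :
    ∃ C : ℝ≥0, ∀ u : Pt d → ℝ, LocallyIntegrable u volume → besovSeminorm B s p q 1 u < ∞ →
      ∃ M : ℝ≥0 → ℝ≥0∞, Measurable M ∧ (∀ ρ : ℝ≥0, 0 < ρ → ScaleBound B p ρ 1 u (M ρ)) ∧
        scaleNorm d κ s q M ≤ C * besovSeminorm B s p q 1 u := by
  obtain ⟨C, hC⟩ := exists_scaleBound_zero (B := B) hB hp hq hκ hs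
  obtain ⟨CY, hCY⟩ := hB.isFlow_flowY.exists_modulus hp hq hκ hs two_pos 1
  simp only [Nat.cast_one, Nat.cast_ofNat, pow_one] at hCY
  refine ⟨C + CY, fun u hu hfin => ?_⟩
  rw [besovSeminorm, ENNReal.add_lt_top, ENNReal.sum_lt_top] at hfin
  choose v hv hveq using fun i : Fin (d 0) => exists_isWeak_eq_iInf
    (fun v v' => besovSeminorm_congr hB 0) (hfin.1 i (Finset.mem_univ i))
  choose MX hMXm hMX hMXs using fun i => hC (v i) (hv i).2.1
    ((hveq i).trans_lt (hfin.1 i (Finset.mem_univ i)))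
  obtain ⟨MY, hMYm, hMY, hMYs⟩ := hCY u hu.aestronglyMeasurable
  obtain ⟨M, hMm, hMX', hMY', hMs⟩ := exists_modulus_sum_add hq
    (C := ((C + CY : ℝ≥0) : ℝ≥0∞)) hMXm hMYm
    (fun i => (hMXs i).trans (mul_le_mul' (ENNReal.coe_le_coe.2 le_self_add) (hveq i).le))
    (hMYs.trans (mul_le_mul' (ENNReal.coe_le_coe.2 le_add_self) le_rfl))
  exact ⟨M, hMm, fun ρ hρ => ⟨hu, fun i => ⟨v i, hv i, (hMX i ρ hρ).mono (hMX' i ρ)⟩,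
    fun h hh => (hMY ρ hρ h hh).trans (mul_le_mul' le_rfl (hMY' ρ))⟩, hMs⟩

/-- A function of finite Besov quasi-norm is regular at all scales, with a modulus whose size is
controlled by the quasi-norm. -/
theorem exists_scaleBound (hB : IsBlockMatrix d B) (hp : 1 ≤ p) (hq : 1 ≤ q) (hκ : 0 < κ)
    (hs : 0 < s) (n : ℕ) :
    ∃ C : ℝ≥0, ∀ u : Pt d → ℝ, LocallyIntegrable u volume → besovSeminorm B s p q n u < ∞ →
      ∃ M : ℝ≥0 → ℝ≥0∞, Measurable M ∧ (∀ ρ : ℝ≥0, 0 < ρ → ScaleBound B p ρ n u (M ρ)) ∧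
        scaleNorm d κ s q M ≤ C * besovSeminorm B s p q n u := by
  induction n using Nat.twoStepInduction with
  | zero => exact exists_scaleBound_zero hB hp hq hκ hs
  | one => exact exists_scaleBound_one hB hp hq hκ hs
  | more n ih1 ih2 =>
    obtain ⟨C1, hC1⟩ := ih1
    obtain ⟨C2, hC2⟩ := ih2
    refine ⟨C2 + C1, fun u hu hfin => ?_⟩
    rw [besovSeminorm, ENNReal.add_lt_top, ENNReal.sum_lt_top] at hfin
    choose v hv hveq using fun i : Fin (d 0) => exists_isWeak_eq_iInf
      (fun v v' => besovSeminorm_congr hB (n + 1)) (hfin.1 i (Finset.mem_univ i))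
    obtain ⟨w, hw, hweq⟩ := exists_isWeak_eq_iInf
      (fun v v' => besovSeminorm_congr hB n) hfin.2
    choose MX hMXm hMX hMXs using fun i => hC2 (v i) (hv i).2.1
      ((hveq i).trans_lt (hfin.1 i (Finset.mem_univ i)))
    obtain ⟨MY, hMYm, hMY, hMYs⟩ := hC1 w hw.2.1 (hweq.trans_lt hfin.2)
    obtain ⟨M, hMm, hMX', hMY', hMs⟩ := exists_modulus_sum_add hq
      (C := ((C2 + C1 : ℝ≥0) : ℝ≥0∞)) hMXm hMYm
      (fun i => (hMXs i).trans (mul_le_mul' (ENNReal.coe_le_coe.2 le_self_add) (hveq i).le))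
      (hMYs.trans (mul_le_mul' (ENNReal.coe_le_coe.2 le_add_self) hweq.le))
    exact ⟨M, hMm, fun ρ hρ => ⟨hu, fun i => ⟨v i, hv i, (hMX i ρ hρ).mono (hMX' i ρ)⟩,
      w, hw, (hMY ρ hρ).mono (hMY' ρ)⟩, hMs⟩

end Modulus

end

/-! ### The Taylor estimate -/

section

variable {r : ℕ} {d : Fin (r + 1) → ℕ} {B : Matrix (Coord d) (Coord d) ℝ} {p q : ℝ≥0∞} {s : ℝ}

/-- The Taylor remainder of a function of finite Besov quasi-norm at the increment `ζ` is bounded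
by its modulus of regularity at a scale comparable to `‖ζ‖_B`. -/
theorem exists_remainderNorm_le_scale (hB : IsBlockMatrix d B) (hp : 1 ≤ p) (hq : 1 ≤ q)
    (hs : 0 < s) (n : ℕ) :
    ∃ κ : ℝ≥0, ∃ C₁ C₂ : ℝ≥0, ∀ u : Pt d → ℝ, MemBesov B n s p q u →
      (∃ D, IsDerivFamily B n u D) ∧ ∃ M : ℝ≥0 → ℝ≥0∞, Measurable M ∧
        (∀ D, IsDerivFamily B n u D → ∀ ζ : Pt d, ζ ≠ 0 →
          remainderNorm B n p u D ζ ≤ C₁ * (ENNReal.ofReal (homNorm ζ ^ n) * M (scale κ ζ))) ∧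
        scaleNorm d κ s q M ≤ C₂ * besovSeminorm B s p q n u := by
  obtain ⟨A, hA⟩ := hB.exists_abs_expB_le
  obtain ⟨C, hC⟩ := exists_remainderNorm_le (B := B) hB hp n
  obtain ⟨C', hC'⟩ := exists_taylor (B := B) hB hp n
  set κ : ℝ≥0 := A + 1 with hκ
  have hκ1 : 1 ≤ κ := le_add_self
  have hκ0 : 0 < κ := zero_lt_one.trans_le hκ1
  obtain ⟨C₂, hC₂⟩ := exists_scaleBound (B := B) (q := q) hB hp hq hκ0 hs n
  refine ⟨κ, C * κ ^ n, C₂, fun u hu => ?_⟩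
  obtain ⟨M, hMm, hM, hMs⟩ := hC₂ u (hu.1.locallyIntegrable hp) hu.2
  refine ⟨?_, M, hMm, fun D hD ζ hζ => ?_, hMs⟩
  · obtain ⟨D, hD, -⟩ := hC' 1 u (M 1) (hM 1 one_pos)
    exact ⟨D, hD⟩
  have hH : 0 < homNorm ζ := homNorm_pos hζ
  have hκ1' : (1 : ℝ) ≤ κ := by exact_mod_cast hκ1
  have hle : homNorm ζ ≤ scale κ ζ := by
    rw [coe_scale]
    exact le_mul_of_one_le_left hH.le hκ1'
  have hpos : 0 < scale κ ζ := by
    have : (0 : ℝ) < scale κ ζ := hH.trans_le hle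
    exact_mod_cast this
  have hcoe : ((Real.toNNReal (homNorm ζ) : ℝ≥0) : ℝ) = homNorm ζ := Real.coe_toNNReal _ hH.le
  -- the inverse of `ζ` lies in the homogeneous box of size `κ ‖ζ‖_B`
  have h1 : |ζ.1| ≤ (scale κ ζ : ℝ) ^ 2 :=
    (abs_fst_le_homNorm ζ).trans (pow_le_pow_left₀ hH.le hle 2)
  have h2 : ∀ j : Coord d, |expB B (-ζ.1) ζ.2 j| ≤ (scale κ ζ : ℝ) ^ (2 * (j.1 : ℕ) + 1) := by
    intro j
    have h3 := hA (Real.toNNReal (homNorm ζ)) (-ζ.1)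
      (by rw [abs_neg, hcoe]; exact abs_fst_le_homNorm ζ) ζ.2
      (fun j => by rw [hcoe]; exact abs_snd_le_homNorm ζ j) j
    rw [hcoe] at h3
    refine h3.trans ?_
    rw [coe_scale, mul_pow]
    refine mul_le_mul_of_nonneg_right ?_ (by positivity)
    refine le_trans ?_ (le_self_pow₀ hκ1' (by omega))
    rw [hκ]
    push_cast
    linarith
  refine (hC (scale κ ζ) u _ (hM _ hpos) D hD ζ h1 h2).trans (le_of_eq ?_)
  rw [scale, ENNReal.coe_mul, ENNReal.coe_mul, mul_pow, ENNReal.coe_pow, ENNReal.ofReal_pow hH.le]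
  simp only [ENNReal.ofReal]
  ring

end

end Kolmogorov

theorem theorem2p4 {r : ℕ} (d : Fin (r + 1) → ℕ)
    (B : Matrix (Kolmogorov.Coord d) (Kolmogorov.Coord d) ℝ) (hB : Kolmogorov.IsBlockMatrix d B)
    (n : ℕ) (s : ℝ) (hs₀ : 0 < s) (hs₁ : s < 1) (p q : ℝ≥0∞) (hp : 1 ≤ p) (hq : 1 ≤ q) :
    ∃ c : ℝ≥0, ∀ u : Kolmogorov.Pt d → ℝ, Kolmogorov.MemBesov B n s p q u →
      (∃ D : ℕ → (Kolmogorov.Coord d → ℕ) → Kolmogorov.Pt d → ℝ,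
        Kolmogorov.IsDerivFamily B n u D) ∧
      ∀ D : ℕ → (Kolmogorov.Coord d → ℕ) → Kolmogorov.Pt d → ℝ,
        Kolmogorov.IsDerivFamily B n u D →
        (q ≠ ∞ →
          ∫⁻ ζ : Kolmogorov.Pt d, Kolmogorov.remainderNorm B n p u D ζ ^ q.toReal /
              ENNReal.ofReal (Kolmogorov.homNorm ζ ^
                ((Kolmogorov.homDim d : ℝ) + ((n : ℝ) + s) * q.toReal))
            ≤ c * Kolmogorov.besovSeminorm B s p q n u ^ q.toReal) ∧
        (q = ∞ →
          ⨆ (ζ : Kolmogorov.Pt d) (_ : ζ ≠ 0), Kolmogorov.remainderNorm B n p u D ζ /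
              ENNReal.ofReal (Kolmogorov.homNorm ζ ^ ((n : ℝ) + s))
            ≤ c * Kolmogorov.besovSeminorm B s p q n u) := by
  obtain ⟨κ, C₁, C₂, hC⟩ :=
    Kolmogorov.exists_remainderNorm_le_scale (B := B) hB hp hq hs₀ n
  have hpow : ∀ {ζ : Kolmogorov.Pt d} (y : ℝ), ζ ≠ 0 → 0 < Kolmogorov.homNorm ζ ^ y :=
    fun y hζ => Real.rpow_pos_of_pos (Kolmogorov.homNorm_pos hζ) y
  by_cases hq' : q = ∞
  · refine ⟨C₁ * C₂, fun u hu => ?_⟩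
    obtain ⟨hD, M, hMm, hM, hMs⟩ := hC u hu
    refine ⟨hD, fun D hD => ⟨fun h => absurd hq' h, fun _ => iSup₂_le fun ζ hζ => ?_⟩⟩
    have hH := Kolmogorov.homNorm_pos hζ
    have h1 : M (Kolmogorov.scale κ ζ) / ENNReal.ofReal (Kolmogorov.homNorm ζ ^ s) ≤
        C₂ * Kolmogorov.besovSeminorm B s p q n u := by
      refine le_trans ?_ hMs
      rw [Kolmogorov.scaleNorm, if_pos hq']
      exact le_iSup₂ (f := fun (ζ : Kolmogorov.Pt d) (_ : ζ ≠ 0) =>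
        M (Kolmogorov.scale κ ζ) / ENNReal.ofReal (Kolmogorov.homNorm ζ ^ s)) ζ hζ
    rw [ENNReal.div_le_iff (ENNReal.ofReal_pos.2 (hpow s hζ)).ne' ENNReal.ofReal_ne_top] at h1
    rw [ENNReal.div_le_iff (ENNReal.ofReal_pos.2 (hpow _ hζ)).ne' ENNReal.ofReal_ne_top]
    refine (hM D hD ζ hζ).trans ?_
    rw [Real.rpow_add hH, Real.rpow_natCast, ENNReal.ofReal_mul (by positivity), ENNReal.coe_mul]
    calc _ ≤ (C₁ : ℝ≥0∞) * (ENNReal.ofReal (Kolmogorov.homNorm ζ ^ n) *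
          (C₂ * Kolmogorov.besovSeminorm B s p q n u *
            ENNReal.ofReal (Kolmogorov.homNorm ζ ^ s))) := by gcongr
      _ = _ := by ring
  · have hQ1 := Kolmogorov.one_le_toReal hq hq'
    have hQ0 : 0 < q.toReal := by linarith
    refine ⟨(C₁ * C₂) ^ q.toReal, fun u hu => ?_⟩
    obtain ⟨hD, M, hMm, hM, hMs⟩ := hC u hu
    refine ⟨hD, fun D hD => ⟨fun _ => ?_, fun h => absurd h hq'⟩⟩
    have hMm' : Measurable fun ζ : Kolmogorov.Pt d => M (Kolmogorov.scale κ ζ) ^ q.toReal :=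
      (hMm.comp (Kolmogorov.measurable_scale κ)).pow_const _
    have h1 : ∫⁻ ζ : Kolmogorov.Pt d, (ENNReal.ofReal (Kolmogorov.homNorm ζ ^
        ((Kolmogorov.homDim d : ℝ) + s * q.toReal)))⁻¹ * M (Kolmogorov.scale κ ζ) ^ q.toReal ≤
        (C₂ * Kolmogorov.besovSeminorm B s p q n u) ^ q.toReal := by
      have h2 := lintegral_withDensity_eq_lintegral_mul (volume : Measure (Kolmogorov.Pt d))
        (Kolmogorov.measurable_kernel ((Kolmogorov.homDim d : ℝ) + s * q.toReal)) hMm'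
      simp only [Pi.mul_apply] at h2
      rw [← h2]
      rw [Kolmogorov.scaleNorm, if_neg hq', one_div, ENNReal.rpow_inv_le_iff hQ0] at hMs
      exact hMs
    have hnull : volume {(0 : Kolmogorov.Pt d)} = 0 := by
      rw [← Prod.mk_zero_zero, ← singleton_prod_singleton, Measure.volume_eq_prod,
        Measure.prod_prod, Real.volume_singleton, zero_mul]
    have hC₁ : ((C₁ : ℝ≥0∞)) ^ q.toReal ≠ ∞ :=
      ENNReal.rpow_ne_top_of_nonneg hQ0.le ENNReal.coe_ne_top
    calc _ ≤ ∫⁻ ζ : Kolmogorov.Pt d, (C₁ : ℝ≥0∞) ^ q.toReal * ((ENNReal.ofReal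
            (Kolmogorov.homNorm ζ ^ ((Kolmogorov.homDim d : ℝ) + s * q.toReal)))⁻¹ *
              M (Kolmogorov.scale κ ζ) ^ q.toReal) := by
          -- the quotients at `ζ = 0` need not be controlled
          refine lintegral_mono_ae ?_
          filter_upwards [compl_mem_ae_iff.2 hnull] with ζ hζ
          have hζ' : ζ ≠ 0 := hζ
          have hH := Kolmogorov.homNorm_pos hζ'
          have hn : 0 < Kolmogorov.homNorm ζ ^ ((n : ℝ) * q.toReal) := hpow _ hζ'
          have e1 : ENNReal.ofReal (Kolmogorov.homNorm ζ ^ n) ^ q.toReal =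
              ENNReal.ofReal (Kolmogorov.homNorm ζ ^ ((n : ℝ) * q.toReal)) := by
            rw [ENNReal.ofReal_rpow_of_pos (by positivity), ← Real.rpow_natCast,
              ← Real.rpow_mul hH.le]
          have e2 : (Kolmogorov.homDim d : ℝ) + ((n : ℝ) + s) * q.toReal =
              (n : ℝ) * q.toReal + ((Kolmogorov.homDim d : ℝ) + s * q.toReal) := by ring
          refine ENNReal.div_le_of_le_mul ?_
          refine (ENNReal.rpow_le_rpow (hM D hD ζ hζ') hQ0.le).trans (le_of_eq ?_)
          rw [ENNReal.mul_rpow_of_nonneg _ _ hQ0.le, ENNReal.mul_rpow_of_nonneg _ _ hQ0.le, e1, e2,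
            Real.rpow_add hH ((n : ℝ) * q.toReal), ENNReal.ofReal_mul hn.le]
          have e3 := ENNReal.mul_inv_cancel
            (ENNReal.ofReal_pos.2 (hpow ((Kolmogorov.homDim d : ℝ) + s * q.toReal) hζ')).ne'
            ENNReal.ofReal_ne_top
          set X := ENNReal.ofReal
            (Kolmogorov.homNorm ζ ^ ((Kolmogorov.homDim d : ℝ) + s * q.toReal))
          set Z := ENNReal.ofReal (Kolmogorov.homNorm ζ ^ ((n : ℝ) * q.toReal))
          set W := M (Kolmogorov.scale κ ζ) ^ q.toReal
          calc (C₁ : ℝ≥0∞) ^ q.toReal * (Z * W) = C₁ ^ q.toReal * (Z * W) * 1 := (mul_one _).symm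
            _ = _ := by
              rw [← e3]
              ring
      _ ≤ _ := by
          rw [lintegral_const_mul' _ _ hC₁, ENNReal.coe_rpow_of_nonneg _ hQ0.le, ENNReal.coe_mul,
            ← ENNReal.mul_rpow_of_nonneg _ _ hQ0.le, mul_assoc,
            ENNReal.mul_rpow_of_nonneg _ _ hQ0.le]
          exact mul_le_mul' le_rfl h1
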